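/- Let $\mathbb F=\mathbb R$ or $\mathbb C$, and let $\mathcal A,\mathcal B$ be (not necessarily unital) graded $C^*$-categories over $\mathbb F$: the morphism sets are Banach spaces over $\mathbb F$ with $\|xy\|\le\|x\|\|y\|$, there is an involution with $\|x^*x\|=\|x\|^2$ and $x^*x\ge 0$, and there is a grading $\delta$, i.e. a $*$-functor with $\delta^2=\mathrm{id}$ that fixes the objects; $x$ has degree $d\in\{0,1\}$ if $\delta(x)=(-1)^dx$. **Notation.** $S=C_0(\mathbb R)$, graded by even and odd functions. $\mathcal K$ is the graded $C^*$-category of all separable graded Hilbert spaces $H=H_0\oplus H_1$ and compact operators; $H^{\mathrm{opp}}=H_1\oplus H_0$. The graded tensor product $\hat\otimes$ is the completed spatial one, with $(u\otimes v)(x\otimes y)=(-1)^{\deg v\deg x}ux\otimes vy$, $(x\otimes y)^*=(-1)^{\deg x\deg y}x^*\otimes y^*$, $\delta(x\otimes y)=\delta(x)\otimes\delta(y)$; $I\mathcal C=\mathcal C\,\hat\otimes\,C[0,1]$ with $C[0,1]$ trivially graded. The additive completion $\mathcal C_\oplus$ has as objects the finite (possibly empty) formal sequences $c_1\oplus\dots\oplus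 c_n$ of objects of $\mathcal C$ and as morphisms the matrices of morphisms of $\mathcal C$; its zero object is the empty sequence. One has $S\hat\otimes\mathcal A_\oplus=(S\hat\otimes\mathcal A)_\oplus$, and $\mathcal B_\oplus\hat\otimes\mathcal K$ is taken as $(\mathcal B\hat\otimes\mathcal K)_\oplus$. A graded asymptotic functor $\varphi:\mathcal C\dashrightarrow\mathcal D$ consists of a map $\varphi$ on objects and maps $\varphi_t:\mathrm{Hom}(a,b)\to\mathrm{Hom}(\varphi(a),\varphi(b))$, $t\in[1,\infty)$, such that $t\mapsto\varphi_t(x)$ is continuous and bounded for each $x$, and such that $\varphi_t(\lambda x+\mu y)-\lambda\varphi_t(x)-\mu\varphi_t(y)$, $\varphi_t(xy)-\varphi_t(x)\varphi_t(y)$, $\varphi_t(x^*)-\varphi_t(x)^*$ and $\delta(\varphi_t(x))-\varphi_t(\delta(x))$ tend to $0$ in norm as $t\to\infty$. A homotopy from $\varphi$ to $\psi$ is a graded asymptotic functor $\theta:\mathcal C\dashrightarrow I\mathcal D$ with $E_0\circ\theta=\varphi$ and $E_1\circ\theta=\psi$, where $E_0,E_1$ are the evaluations at $0$ and $1$; in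 particular $\varphi$, $\psi$ and $\theta$ agree on objects. A graded asymptotic functor $\mathcal C_\oplus\dashrightarrow\mathcal D_\oplus$ is additive if it is of the form $\varphi_\oplus$ for some $\varphi:\mathcal C\dashrightarrow\mathcal D_\oplus$, where $\varphi_\oplus(c_1\oplus\dots\oplus c_n)=\varphi(c_1)\oplus\dots\oplus\varphi(c_n)$ and $(\varphi_\oplus)_t((x_{ij}))=(\varphi_t(x_{ij}))$; the direct sum of $\varphi_\oplus$ and $\psi_\oplus$ is $(\varphi\oplus\psi)_\oplus$, with $(\varphi\oplus\psi)(c)=\varphi(c)\oplus\psi(c)$ and $(\varphi\oplus\psi)_t(x)=\varphi_t(x)\oplus\psi_t(x)$. A null functor is one that sends every morphism to $0$ (its values on objects are arbitrary); the zero functor is the null functor that sends every object to the zero object. Let $\llbracket S\hat\otimes\mathcal A_\oplus,\mathcal B_\oplus\hat\otimes\mathcal K\rrbracket_\oplus$ be the set of classes $[\varphi]$ of additive graded asymptotic functors $S\hat\otimes\mathcal A_\oplus\dashrightarrow\mathcal B_\oplus\hat\otimes\mathcal K$ for the equivalence relation generated by homotopy and by $\varphi\sim\varphi\oplus\omega$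 and $\varphi\sim\omega\oplus\varphi$ for all additive null functors $\omega$. **Lemma.** The set $\llbracket S\hat\otimes\mathcal A_\oplus,\mathcal B_\oplus\hat\otimes\mathcal K\rrbracket_\oplus$ is an abelian group under a well-defined operation given by $[\varphi]+[\psi]=[\varphi\oplus\psi]$. Its identity is the class of the zero functor, and $-[\varphi]=[\varphi^{\mathrm{opp}}]$, where $\varphi^{\mathrm{opp}}$ is obtained from $\varphi\circ\delta$ by replacing each summand $b\otimes H$ of an object $\varphi(a)$ by $b\otimes H^{\mathrm{opp}}$. (Here $\mathrm{Hom}(b\otimes H,b'\otimes H')$ is identified with $\mathrm{Hom}(b\otimes H^{\mathrm{opp}},b'\otimes H'^{\mathrm{opp}})$ by $x\otimes k\mapsto(-1)^{\deg x}x\otimes k$. If $\mathcal B$ is represented on graded Hilbert spaces and $x\otimes k$ by $x\otimes\varepsilon_{H'}^{\deg x}k$, where $\varepsilon_{H'}$ is the grading operator of $H'$, then this leaves the operators unchanged and only reverses the gradings of $H$ and $H'$.) -/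

import Mathlib

open scoped TensorProduct ZeroAtInfty ENNReal Topology
open Filter

universe u v w u₁ v₁ u₂ v₂

noncomputable section

namespace ETheory

/-- The algebraic laws of a graded `*`-category over `𝕜`. -/
structure StarLaws (𝕜 : Type) [RCLike 𝕜] {Ob : Type u} (Hom : Ob → Ob → Type v)
    [∀ a b, AddCommGroup (Hom a b)] [∀ a b, Module 𝕜 (Hom a b)]
    (comp : ∀ {a b c : Ob}, Hom b c → Hom a b → Hom a c)
    (star : ∀ {a b : Ob}, Hom a b → Hom b a)
    (grade : ∀ {a b : Ob}, Hom a b → Hom a b) : Prop where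
  assoc : ∀ {a b c d : Ob} (x : Hom c d) (y : Hom b c) (z : Hom a b),
    comp (comp x y) z = comp x (comp y z)
  add_comp : ∀ {a b c : Ob} (x y : Hom b c) (z : Hom a b), comp (x + y) z = comp x z + comp y z
  comp_add : ∀ {a b c : Ob} (x : Hom b c) (y z : Hom a b), comp x (y + z) = comp x y + comp x z
  smul_comp : ∀ {a b c : Ob} (r : 𝕜) (x : Hom b c) (y : Hom a b), comp (r • x) y = r • comp x y
  comp_smul : ∀ {a b c : Ob} (r : 𝕜) (x : Hom b c) (y : Hom a b), comp x (r • y) = r • comp x y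
  star_add : ∀ {a b : Ob} (x y : Hom a b), star (x + y) = star x + star y
  star_smul : ∀ {a b : Ob} (r : 𝕜) (x : Hom a b), star (r • x) = (starRingEnd 𝕜 r) • star x
  star_star : ∀ {a b : Ob} (x : Hom a b), star (star x) = x
  star_comp : ∀ {a b c : Ob} (x : Hom b c) (y : Hom a b), star (comp x y) = comp (star y) (star x)
  grade_add : ∀ {a b : Ob} (x y : Hom a b), grade (x + y) = grade x + grade y
  grade_smul : ∀ {a b : Ob} (r : 𝕜) (x : Hom a b), grade (r • x) = r • grade x
  grade_comp : ∀ {a b c : Ob} (x : Hom b c) (y : Hom a b),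
    grade (comp x y) = comp (grade x) (grade y)
  grade_star : ∀ {a b : Ob} (x : Hom a b), grade (star x) = star (grade x)
  grade_grade : ∀ {a b : Ob} (x : Hom a b), grade (grade x) = x

/-- A (non-unital) graded `*`-category over `𝕜`: `star` is the involution and `grade` is the
grading `δ`, a `*`-functor that fixes the objects and squares to the identity. -/
structure GradedStarCategory (𝕜 : Type) [RCLike 𝕜] where
  Ob : Type u
  Hom : Ob → Ob → Type v
  [acg : ∀ a b, AddCommGroup (Hom a b)]
  [mod : ∀ a b, Module 𝕜 (Hom a b)]
  comp : ∀ {a b c : Ob}, Hom b c → Hom a b → Hom a c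
  star : ∀ {a b : Ob}, Hom a b → Hom b a
  grade : ∀ {a b : Ob}, Hom a b → Hom a b
  laws : StarLaws 𝕜 Hom comp star grade

attribute [instance] GradedStarCategory.acg GradedStarCategory.mod

/-- A graded `*`-category with a submultiplicative seminorm on its morphism spaces, for which the
involution is isometric. -/
structure NormedGradedStarCategory (𝕜 : Type) [RCLike 𝕜] where
  Ob : Type u
  Hom : Ob → Ob → Type v
  [sng : ∀ a b, SeminormedAddCommGroup (Hom a b)]
  [nsp : ∀ a b, NormedSpace 𝕜 (Hom a b)]
  comp : ∀ {a b c : Ob}, Hom b c → Hom a b → Hom a c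
  star : ∀ {a b : Ob}, Hom a b → Hom b a
  grade : ∀ {a b : Ob}, Hom a b → Hom a b
  laws : StarLaws 𝕜 Hom comp star grade
  norm_comp_le : ∀ {a b c : Ob} (x : Hom b c) (y : Hom a b), ‖comp x y‖ ≤ ‖x‖ * ‖y‖
  norm_star : ∀ {a b : Ob} (x : Hom a b), ‖star x‖ = ‖x‖

attribute [instance] NormedGradedStarCategory.sng NormedGradedStarCategory.nsp

/-- The underlying graded `*`-category. -/
@[reducible] def NormedGradedStarCategory.alg {𝕜 : Type} [RCLike 𝕜]
    (C : NormedGradedStarCategory.{u, v} 𝕜) : GradedStarCategory.{u, v} 𝕜 where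
  Ob := C.Ob
  Hom := C.Hom
  comp := C.comp
  star := C.star
  grade := C.grade
  laws := C.laws

/-- A (not necessarily unital) graded `C*`-category over `𝕜 = ℝ` or `ℂ`: the morphism spaces are
Banach spaces, the `C*`-identity holds, and every `x* x` is a positive element of the endomorphism
algebra, i.e. `r + x* x` is invertible in the unitization for every real `r > 0`
(the inverse being `r⁻¹ + y`). -/
structure GradedCStarCategory (𝕜 : Type) [RCLike 𝕜] extends NormedGradedStarCategory.{u, v} 𝕜 where
  eq_zero_of_norm : ∀ {a b : Ob} (x : Hom a b), ‖x‖ = 0 → x = 0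
  complete : ∀ a b : Ob, CompleteSpace (Hom a b)
  norm_star_comp_self : ∀ {a b : Ob} (x : Hom a b), ‖comp (star x) x‖ = ‖x‖ ^ 2
  star_comp_self_pos : ∀ {a b : Ob} (x : Hom a b) (r : ℝ), 0 < r → ∃ y : Hom a a,
    (r : 𝕜) • y + (r⁻¹ : 𝕜) • comp (star x) x + comp (comp (star x) x) y = 0 ∧
    (r : 𝕜) • y + (r⁻¹ : 𝕜) • comp (star x) x + comp y (comp (star x) x) = 0

/-- A graded Hilbert space `H = H₀ ⊕ H₁`, given by the self-adjoint unitary `ε` that is `1` on `H₀`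
and `-1` on `H₁`. -/
structure GradedHilbert (𝕜 : Type) [RCLike 𝕜] where
  carrier : Type w
  [nacg : NormedAddCommGroup carrier]
  [ips : InnerProductSpace 𝕜 carrier]
  [cs : CompleteSpace carrier]
  eps : carrier →L[𝕜] carrier
  eps_eps : eps ∘L eps = ContinuousLinearMap.id 𝕜 carrier
  eps_adj : ContinuousLinearMap.adjoint eps = eps

attribute [instance] GradedHilbert.nacg GradedHilbert.ips GradedHilbert.cs

instance {𝕜 : Type} [RCLike 𝕜] : CoeSort (GradedHilbert.{w} 𝕜) (Type w) := ⟨GradedHilbert.carrier⟩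

/-- The graded Hilbert space `Hᵒᵖᵖ = H₁ ⊕ H₀` with the opposite grading. -/
def GradedHilbert.opp {𝕜 : Type} [RCLike 𝕜] (H : GradedHilbert.{w} 𝕜) : GradedHilbert.{w} 𝕜 where
  carrier := H.carrier
  eps := -H.eps
  eps_eps := by simp [H.eps_eps]
  eps_adj := by simp [H.eps_adj]

/-- A graded representation of `C`: a graded `*`-functor into graded Hilbert spaces and bounded
operators. (For a `C*`-category the last condition holds automatically.) -/
structure Rep {𝕜 : Type} [RCLike 𝕜] (C : NormedGradedStarCategory.{u, v} 𝕜) where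
  obj : C.Ob → GradedHilbert.{v} 𝕜
  map : ∀ {a b : C.Ob}, C.Hom a b →ₗ[𝕜] (obj a →L[𝕜] obj b)
  map_comp : ∀ {a b c : C.Ob} (x : C.Hom b c) (y : C.Hom a b),
    map (C.comp x y) = map x ∘L map y
  map_star : ∀ {a b : C.Ob} (x : C.Hom a b),
    map (C.star x) = ContinuousLinearMap.adjoint (map x)
  map_grade : ∀ {a b : C.Ob} (x : C.Hom a b),
    map (C.grade x) = (obj b).eps ∘L map x ∘L (obj a).eps
  norm_map_le : ∀ {a b : C.Ob} (x : C.Hom a b), ‖map x‖ ≤ ‖x‖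

/-- Formal sequences `a₁ ⊕ ⋯ ⊕ aₙ`, the empty one included. -/
structure FormalSum (X : Type u) where
  len : ℕ
  fam : Fin len → X

/-- Matrices of morphisms from `⊕ⱼ uⱼ` to `⊕ᵢ wᵢ`. -/
def Mat {𝕜 : Type} [RCLike 𝕜] (C : GradedStarCategory.{u, v} 𝕜) {ι κ : Type} (s : ι → C.Ob) (t : κ → C.Ob) :
    Type v := ∀ (i : κ) (j : ι), C.Hom (s j) (t i)

namespace Mat

variable {𝕜 : Type} [RCLike 𝕜] {C : GradedStarCategory.{u, v} 𝕜} {ι κ μ ν : Type}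
  {s : ι → C.Ob} {t : κ → C.Ob} {r : μ → C.Ob} {q : ν → C.Ob}

instance : AddCommGroup (Mat C s t) := inferInstanceAs (AddCommGroup (∀ i j, C.Hom (s j) (t i)))
instance : Module 𝕜 (Mat C s t) := inferInstanceAs (Module 𝕜 (∀ i j, C.Hom (s j) (t i)))

@[simp] theorem add_apply (M N : Mat C s t) (i : κ) (j : ι) : (M + N) i j = M i j + N i j := rfl
@[simp] theorem sub_apply (M N : Mat C s t) (i : κ) (j : ι) : (M - N) i j = M i j - N i j := rfl
@[simp] theorem smul_apply (c : 𝕜) (M : Mat C s t) (i : κ) (j : ι) : (c • M) i j = c • M i j := rfl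

/-- The matrix product. -/
def comp [Fintype κ] (M : Mat C t r) (N : Mat C s t) : Mat C s r :=
  fun i j => ∑ k, C.comp (M i k) (N k j)

/-- The conjugate transpose. -/
def star (M : Mat C s t) : Mat C t s := fun i j => C.star (M j i)

/-- The grading, entry by entry. -/
def grade (M : Mat C s t) : Mat C s t := fun i j => C.grade (M i j)

end Mat

namespace GradedStarCategory

variable {𝕜 : Type} [RCLike 𝕜] (C : GradedStarCategory.{u, v} 𝕜)

theorem comp_zero {a b c : C.Ob} (x : C.Hom b c) : C.comp x (0 : C.Hom a b) = 0 := by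
  simpa using C.laws.comp_smul 0 x (0 : C.Hom a b)

theorem zero_comp {a b c : C.Ob} (x : C.Hom a b) : C.comp (0 : C.Hom b c) x = 0 := by
  simpa using C.laws.smul_comp 0 (0 : C.Hom b c) x

theorem star_zero {a b : C.Ob} : C.star (0 : C.Hom a b) = 0 := by
  simpa using C.laws.star_smul 0 (0 : C.Hom a b)

theorem grade_zero {a b : C.Ob} : C.grade (0 : C.Hom a b) = 0 := by
  simpa using C.laws.grade_smul 0 (0 : C.Hom a b)

theorem comp_sum {a b c : C.Ob} {ι : Type} (S : Finset ι) (x : C.Hom b c) (f : ι → C.Hom a b) :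
    C.comp x (∑ i ∈ S, f i) = ∑ i ∈ S, C.comp x (f i) := by
  classical
  induction S using Finset.induction_on with
  | empty => simp [comp_zero]
  | insert i S hi ih => simp [Finset.sum_insert hi, C.laws.comp_add, ih]

theorem sum_comp {a b c : C.Ob} {ι : Type} (S : Finset ι) (f : ι → C.Hom b c) (x : C.Hom a b) :
    C.comp (∑ i ∈ S, f i) x = ∑ i ∈ S, C.comp (f i) x := by
  classical
  induction S using Finset.induction_on with
  | empty => simp [zero_comp]
  | insert i S hi ih => simp [Finset.sum_insert hi, C.laws.add_comp, ih]

theorem star_sum {a b : C.Ob} {ι : Type} (S : Finset ι) (f : ι → C.Hom a b) :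
    C.star (∑ i ∈ S, f i) = ∑ i ∈ S, C.star (f i) := by
  classical
  induction S using Finset.induction_on with
  | empty => simp [star_zero]
  | insert i S hi ih => simp [Finset.sum_insert hi, C.laws.star_add, ih]

theorem grade_sum {a b : C.Ob} {ι : Type} (S : Finset ι) (f : ι → C.Hom a b) :
    C.grade (∑ i ∈ S, f i) = ∑ i ∈ S, C.grade (f i) := by
  classical
  induction S using Finset.induction_on with
  | empty => simp [grade_zero]
  | insert i S hi ih => simp [Finset.sum_insert hi, C.laws.grade_add, ih]

theorem addLaws : StarLaws 𝕜 (Ob := FormalSum C.Ob) (fun a b => Mat C a.fam b.fam)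
    (fun M N => M.comp N) (fun M => M.star) (fun M => M.grade) where
  assoc x y z := by
    funext i j
    simp only [Mat.comp, comp_sum, sum_comp, C.laws.assoc]
    exact Finset.sum_comm
  add_comp x y z := by
    funext i j; simp [Mat.comp, C.laws.add_comp, Finset.sum_add_distrib]
  comp_add x y z := by
    funext i j; simp [Mat.comp, C.laws.comp_add, Finset.sum_add_distrib]
  smul_comp r x y := by
    funext i j; simp [Mat.comp, C.laws.smul_comp, Finset.smul_sum]
  comp_smul r x y := by
    funext i j; simp [Mat.comp, C.laws.comp_smul, Finset.smul_sum]
  star_add x y := by funext i j; exact C.laws.star_add _ _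
  star_smul r x := by funext i j; exact C.laws.star_smul _ _
  star_star x := by funext i j; exact C.laws.star_star _
  star_comp x y := by
    funext i j
    simp only [Mat.comp, Mat.star, star_sum, C.laws.star_comp]
  grade_add x y := by funext i j; exact C.laws.grade_add _ _
  grade_smul r x := by funext i j; exact C.laws.grade_smul _ _
  grade_comp x y := by
    funext i j
    simp only [Mat.comp, Mat.grade, grade_sum, C.laws.grade_comp]
  grade_star x := by funext i j; exact C.laws.grade_star _
  grade_grade x := by funext i j; exact C.laws.grade_grade _

/-- The additive completion `C_⊕`. -/
@[reducible] def add : GradedStarCategory.{u, v} 𝕜 where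
  Ob := FormalSum C.Ob
  Hom a b := Mat C a.fam b.fam
  comp M N := M.comp N
  star M := M.star
  grade M := M.grade
  laws := C.addLaws

end GradedStarCategory

namespace Rep

variable {𝕜 : Type} [RCLike 𝕜] {C : NormedGradedStarCategory.{u, v} 𝕜} {ι κ μ : Type}
  [Fintype ι] [Fintype κ] [Fintype μ] {s : ι → C.Ob} {t : κ → C.Ob} {r : μ → C.Ob} (ρ : Rep C)

/-- The Hilbert space `⊕ᵢ ρ(sᵢ)`. -/
abbrev sumSpace (s : ι → C.Ob) : Type v := PiLp 2 (fun i => (ρ.obj (s i)).carrier)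

/-- The operator `⊕ⱼ ρ(sⱼ) → ⊕ᵢ ρ(tᵢ)` with matrix `(ρ(Mᵢⱼ))`. -/
def mat (M : Mat C.alg s t) : ρ.sumSpace s →L[𝕜] ρ.sumSpace t :=
  (PiLp.continuousLinearEquiv 2 𝕜 (fun i => (ρ.obj (t i)).carrier)).symm.toContinuousLinearMap ∘L
    ContinuousLinearMap.pi fun i => ∑ j, ρ.map (M i j) ∘L
      PiLp.proj 2 (fun i => (ρ.obj (s i)).carrier) j

@[simp] theorem mat_apply (M : Mat C.alg s t) (x : ρ.sumSpace s) (i : κ) :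
    ρ.mat M x i = ∑ j, ρ.map (M i j) (x j) := by
  simp [mat]

theorem mat_add (M N : Mat C.alg s t) : ρ.mat (M + N) = ρ.mat M + ρ.mat N := by
  ext x i; simp [Finset.sum_add_distrib]

theorem mat_smul (c : 𝕜) (M : Mat C.alg s t) : ρ.mat (c • M) = c • ρ.mat M := by
  ext x i; simp [Finset.smul_sum]

theorem mat_comp (M : Mat C.alg t r) (N : Mat C.alg s t) :
    ρ.mat (M.comp N) = ρ.mat M ∘L ρ.mat N := by
  ext x i
  simp only [mat_apply, Mat.comp, map_sum, ContinuousLinearMap.comp_apply, ρ.map_comp,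
    _root_.sum_apply]
  rw [Finset.sum_comm]

theorem mat_star (M : Mat C.alg s t) :
    ρ.mat M.star = ContinuousLinearMap.adjoint (ρ.mat M) := by
  rw [ContinuousLinearMap.eq_adjoint_iff]
  intro x y
  simp only [PiLp.inner_apply, mat_apply, Mat.star, ρ.map_star, sum_inner, inner_sum,
    ContinuousLinearMap.adjoint_inner_left]
  exact Finset.sum_comm

theorem norm_mat_le (M : Mat C.alg s t) : ‖ρ.mat M‖ ≤ ∑ i, ∑ j, ‖M i j‖ := by
  refine ContinuousLinearMap.opNorm_le_bound _ (by positivity) fun x => ?_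
  have h1 : ‖ρ.mat M x‖ ≤ ∑ i, ‖ρ.mat M x i‖ := by
    rw [PiLp.norm_eq_of_L2]
    refine Real.sqrt_le_left (by positivity) |>.2 ?_
    exact Finset.sum_sq_le_sq_sum_of_nonneg fun _ _ => norm_nonneg _
  refine h1.trans ?_
  rw [Finset.sum_mul]
  refine Finset.sum_le_sum fun i _ => ?_
  rw [mat_apply, Finset.sum_mul]
  refine (norm_sum_le _ _).trans (Finset.sum_le_sum fun j _ => ?_)
  refine ((ρ.map (M i j)).le_opNorm _).trans ?_
  exact mul_le_mul (ρ.norm_map_le _) (PiLp.norm_apply_le x j) (norm_nonneg _) (norm_nonneg _)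

end Rep

namespace NormedGradedStarCategory

variable {𝕜 : Type} [RCLike 𝕜] (C : NormedGradedStarCategory.{u, v} 𝕜)

/-- Sends a matrix `M` to the family of operators `(ρ_⊕(M))`, where `ρ` runs over all graded
representations of `C`. -/
def matFamily {ι κ : Type} [Fintype ι] [Fintype κ] (s : ι → C.Ob) (t : κ → C.Ob) :
    Mat C.alg s t →ₗ[𝕜] lp (fun ρ : Rep C => ρ.sumSpace s →L[𝕜] ρ.sumSpace t) ∞ where
  toFun M := ⟨fun ρ => ρ.mat M, memℓp_infty ⟨∑ i, ∑ j, ‖M i j‖, by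
    rintro _ ⟨ρ, rfl⟩; exact ρ.norm_mat_le M⟩⟩
  map_add' M N := by ext1; funext ρ; exact ρ.mat_add M N
  map_smul' c M := by ext1; funext ρ; exact ρ.mat_smul c M

theorem matFamily_apply {ι κ : Type} [Fintype ι] [Fintype κ] (s : ι → C.Ob) (t : κ → C.Ob)
    (M : Mat C.alg s t) (ρ : Rep C) : C.matFamily s t M ρ = ρ.mat M := rfl

theorem norm_matFamily_le {ι κ : Type} [Fintype ι] [Fintype κ] (s : ι → C.Ob) (t : κ → C.Ob)
    (M : Mat C.alg s t) {r : ℝ} (hr : 0 ≤ r) (h : ∀ ρ : Rep C, ‖ρ.mat M‖ ≤ r) :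
    ‖C.matFamily s t M‖ ≤ r :=
  lp.norm_le_of_forall_le hr h

theorem norm_mat_le_norm {ι κ : Type} [Fintype ι] [Fintype κ] (s : ι → C.Ob) (t : κ → C.Ob)
    (M : Mat C.alg s t) (ρ : Rep C) : ‖ρ.mat M‖ ≤ ‖C.matFamily s t M‖ :=
  lp.norm_apply_le_norm (by simp) (C.matFamily s t M) ρ

/-- The additive completion `C_⊕`, with the norm `‖M‖ = sup_ρ ‖ρ_⊕(M)‖` on matrices. (When `C` is a
`C*`-category, a faithful `ρ` attains the supremum.) -/
def add : NormedGradedStarCategory.{u, v} 𝕜 where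
  Ob := FormalSum C.Ob
  Hom a b := Mat C.alg a.fam b.fam
  sng a b := SeminormedAddCommGroup.induced _ _ (C.matFamily a.fam b.fam)
  nsp a b := NormedSpace.induced 𝕜 _ _ (C.matFamily a.fam b.fam)
  comp M N := M.comp N
  star M := M.star
  grade M := M.grade
  laws := C.alg.addLaws
  norm_comp_le {a b c} M N := by
    change ‖C.matFamily a.fam c.fam (M.comp N)‖ ≤
      ‖C.matFamily b.fam c.fam M‖ * ‖C.matFamily a.fam b.fam N‖
    refine C.norm_matFamily_le _ _ _ (mul_nonneg (norm_nonneg _) (norm_nonneg _)) fun ρ => ?_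
    rw [ρ.mat_comp]
    exact (ContinuousLinearMap.opNorm_comp_le _ _).trans (mul_le_mul (C.norm_mat_le_norm _ _ M ρ)
      (C.norm_mat_le_norm _ _ N ρ) (norm_nonneg _) (norm_nonneg _))
  norm_star {a b} M := by
    change ‖C.matFamily b.fam a.fam M.star‖ = ‖C.matFamily a.fam b.fam M‖
    refine le_antisymm ?_ ?_
    · refine C.norm_matFamily_le _ _ _ (norm_nonneg _) fun ρ => ?_
      rw [ρ.mat_star, LinearIsometryEquiv.norm_map]
      exact C.norm_mat_le_norm _ _ M ρ
    · refine C.norm_matFamily_le _ _ _ (norm_nonneg _) fun ρ => ?_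
      have := C.norm_mat_le_norm _ _ M.star ρ
      rwa [ρ.mat_star, LinearIsometryEquiv.norm_map] at this

theorem norm_add_def {a b : C.add.Ob} (M : C.add.Hom a b) :
    ‖M‖ = ‖C.matFamily a.fam b.fam M‖ := rfl

end NormedGradedStarCategory

theorem GradedHilbert.norm_eps_apply {𝕜 : Type} [RCLike 𝕜] (H : GradedHilbert.{w} 𝕜) (x : H) :
    ‖H.eps x‖ = ‖x‖ := by
  have h : inner 𝕜 (H.eps x) (H.eps x) = inner 𝕜 x x := by
    conv_lhs => rw [← ContinuousLinearMap.adjoint_inner_right, H.eps_adj]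
    exact congrArg (inner 𝕜 x) (DFunLike.congr_fun H.eps_eps x)
  rw [@norm_eq_sqrt_re_inner 𝕜, h, ← @norm_eq_sqrt_re_inner 𝕜]

theorem Rep.norm_mat_grade_le {𝕜 : Type} [RCLike 𝕜] {C : NormedGradedStarCategory.{u, v} 𝕜}
    {ι κ : Type} [Fintype ι] [Fintype κ] {s : ι → C.Ob} {t : κ → C.Ob} (ρ : Rep C)
    (M : Mat C.alg s t) : ‖ρ.mat M.grade‖ ≤ ‖ρ.mat M‖ := by
  refine ContinuousLinearMap.opNorm_le_bound _ (norm_nonneg _) fun x => ?_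
  let x' : ρ.sumSpace s := WithLp.toLp 2 fun j => (ρ.obj (s j)).eps (x j)
  have hx : ‖x'‖ = ‖x‖ := by
    simp only [PiLp.norm_eq_of_L2, x', GradedHilbert.norm_eps_apply]
  have hy : ‖ρ.mat M.grade x‖ = ‖ρ.mat M x'‖ := by
    simp only [PiLp.norm_eq_of_L2]
    congr 1
    refine Finset.sum_congr rfl fun i _ => ?_
    rw [← GradedHilbert.norm_eps_apply (ρ.obj (t i)) (ρ.mat M x' i)]
    simp only [Rep.mat_apply, Mat.grade, ρ.map_grade, map_sum, x']
    rfl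
  rw [hy, ← hx]
  exact (ρ.mat M).le_opNorm x'

theorem NormedGradedStarCategory.add_continuous_grade {𝕜 : Type} [RCLike 𝕜]
    (C : NormedGradedStarCategory.{u, v} 𝕜) (a b : C.add.Ob) :
    Continuous (C.add.grade : C.add.Hom a b → C.add.Hom a b) := by
  refine AddMonoidHomClass.continuous_of_bound
    (AddMonoidHom.mk' (C.add.grade : C.add.Hom a b → C.add.Hom a b) C.add.laws.grade_add) 1
    fun M => ?_
  rw [one_mul]
  change ‖C.matFamily a.fam b.fam (Mat.grade M)‖ ≤ ‖C.matFamily a.fam b.fam M‖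
  exact C.norm_matFamily_le _ _ _ (norm_nonneg _) fun ρ =>
    (ρ.norm_mat_grade_le M).trans (C.norm_mat_le_norm _ _ M ρ)

namespace NormedGradedStarCategory

variable {𝕜 : Type} [RCLike 𝕜] (C : NormedGradedStarCategory.{u, v} 𝕜)

theorem continuous_comp {X : Type*} [TopologicalSpace X] {a b c : C.Ob} {f : X → C.Hom b c}
    {g : X → C.Hom a b} (hf : Continuous f) (hg : Continuous g) :
    Continuous fun x => C.comp (f x) (g x) := by
  let B : C.Hom b c →ₗ[𝕜] C.Hom a b →ₗ[𝕜] C.Hom a c := LinearMap.mk₂ 𝕜 C.comp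
    C.laws.add_comp C.laws.smul_comp C.laws.comp_add C.laws.comp_smul
  have hB := (B.mkContinuous₂ 1 fun x y => by
    simpa [B] using C.norm_comp_le x y).continuous₂
  exact hB.comp (hf.prodMk hg)

theorem continuous_star {a b : C.Ob} : Continuous (C.star : C.Hom a b → C.Hom b a) :=
  AddMonoidHomClass.continuous_of_bound
    (AddMonoidHom.mk' (C.star : C.Hom a b → C.Hom b a) C.laws.star_add) 1
    fun x => by simpa using (C.norm_star x).le

/-- The category `IC = C ⊗̂ C[0,1]`, with `C[0,1]` trivially graded: the objects are those of `C`,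
and the morphisms are continuous functions from `[0,1]` to the morphism spaces of `C`. -/
def cyl (hC : ∀ a b, Continuous (C.grade : C.Hom a b → C.Hom a b)) :
    NormedGradedStarCategory.{u, v} 𝕜 where
  Ob := C.Ob
  Hom a b := C(unitInterval, C.Hom a b)
  comp f g := ⟨fun s => C.comp (f s) (g s), C.continuous_comp f.continuous g.continuous⟩
  star f := ⟨fun s => C.star (f s), C.continuous_star.comp f.continuous⟩
  grade f := ⟨fun s => C.grade (f s), (hC _ _).comp f.continuous⟩
  laws :=
    { assoc := fun x y z => by ext1 s; exact C.laws.assoc _ _ _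
      add_comp := fun x y z => by ext1 s; exact C.laws.add_comp _ _ _
      comp_add := fun x y z => by ext1 s; exact C.laws.comp_add _ _ _
      smul_comp := fun r x y => by ext1 s; exact C.laws.smul_comp _ _ _
      comp_smul := fun r x y => by ext1 s; exact C.laws.comp_smul _ _ _
      star_add := fun x y => by ext1 s; exact C.laws.star_add _ _
      star_smul := fun r x => by ext1 s; exact C.laws.star_smul _ _
      star_star := fun x => by ext1 s; exact C.laws.star_star _
      star_comp := fun x y => by ext1 s; exact C.laws.star_comp _ _
      grade_add := fun x y => by ext1 s; exact C.laws.grade_add _ _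
      grade_smul := fun r x => by ext1 s; exact C.laws.grade_smul _ _
      grade_comp := fun x y => by ext1 s; exact C.laws.grade_comp _ _
      grade_star := fun x => by ext1 s; exact C.laws.grade_star _
      grade_grade := fun x => by ext1 s; exact C.laws.grade_grade _ }
  norm_comp_le f g := (ContinuousMap.norm_le _ (by positivity)).2 fun s =>
    (C.norm_comp_le _ _).trans (mul_le_mul (f.norm_coe_le_norm s) (g.norm_coe_le_norm s)
      (norm_nonneg _) (norm_nonneg _))
  norm_star f := le_antisymm
    ((ContinuousMap.norm_le _ (norm_nonneg _)).2 fun s =>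
      (C.norm_star (f s)).le.trans (f.norm_coe_le_norm s))
    ((ContinuousMap.norm_le _ (norm_nonneg _)).2 fun s =>
      (C.norm_star (f s)).ge.trans (ContinuousMap.norm_coe_le_norm
        (⟨fun s => C.star (f s), C.continuous_star.comp f.continuous⟩ : C(unitInterval, _)) s))

end NormedGradedStarCategory

/-! ### The category `S ⊗̂ A` -/

namespace GradedCStarCategory

variable {𝕜 : Type} [RCLike 𝕜] (A : GradedCStarCategory.{u, v} 𝕜)

/-- The pointwise composite of two `C₀`-functions. -/
def comp₀ {a b c : A.Ob} (f : C₀(ℝ, A.Hom b c)) (g : C₀(ℝ, A.Hom a b)) : C₀(ℝ, A.Hom a c) where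
  toFun r := A.comp (f r) (g r)
  continuous_toFun := A.continuous_comp f.continuous g.continuous
  zero_at_infty' := by
    have h := (tendsto_zero_iff_norm_tendsto_zero.1 f.zero_at_infty').mul
      (tendsto_zero_iff_norm_tendsto_zero.1 g.zero_at_infty')
    rw [mul_zero] at h
    exact squeeze_zero_norm (fun r => A.norm_comp_le _ _) h

/-- The pointwise involution of a `C₀`-function. -/
def star₀ {a b : A.Ob} (f : C₀(ℝ, A.Hom a b)) : C₀(ℝ, A.Hom b a) where
  toFun r := A.star (f r)
  continuous_toFun := A.continuous_star.comp f.continuous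
  zero_at_infty' := by
    have h := tendsto_zero_iff_norm_tendsto_zero.1 f.zero_at_infty'
    exact squeeze_zero_norm (fun r => (A.norm_star _).le) h

/-- The reflection `r ↦ f (-r)`, i.e. the grading of `S` applied in the first tensor factor. -/
def refl₀ {a b : A.Ob} (f : C₀(ℝ, A.Hom a b)) : C₀(ℝ, A.Hom a b) where
  toFun r := f (-r)
  continuous_toFun := f.continuous.comp continuous_neg
  zero_at_infty' := f.zero_at_infty'.comp (Homeomorph.neg ℝ).isClosedEmbedding.tendsto_cocompact

@[simp] theorem comp₀_apply {a b c : A.Ob} (f : C₀(ℝ, A.Hom b c)) (g : C₀(ℝ, A.Hom a b)) (r : ℝ) :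
    A.comp₀ f g r = A.comp (f r) (g r) := rfl
@[simp] theorem star₀_apply {a b : A.Ob} (f : C₀(ℝ, A.Hom a b)) (r : ℝ) :
    A.star₀ f r = A.star (f r) := rfl
@[simp] theorem refl₀_apply {a b : A.Ob} (f : C₀(ℝ, A.Hom a b)) (r : ℝ) :
    A.refl₀ f r = f (-r) := rfl

/-- The morphism space of `S ⊗̂ A`. A morphism is a `C₀`-function on `ℝ` with values in
`Hom(a,b) = Hom(a,b)ᵉᵛᵉⁿ ⊕ Hom(a,b)ᵒᵈᵈ`; it is recorded as the pair of its even and odd parts. -/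
def suspHom (a b : A.Ob) : Submodule 𝕜 (C₀(ℝ, A.Hom a b) × C₀(ℝ, A.Hom a b)) where
  carrier := {F | (∀ r, A.grade (F.1 r) = F.1 r) ∧ ∀ r, A.grade (F.2 r) = -F.2 r}
  add_mem' := by
    rintro F G ⟨h1, h2⟩ ⟨h3, h4⟩
    refine ⟨fun r => ?_, fun r => ?_⟩
    · simp [A.laws.grade_add, h1, h3]
    · simp [A.laws.grade_add, h2, h4, add_comm]
  zero_mem' := ⟨fun _ => A.alg.grade_zero, fun _ => by
    simpa using A.alg.grade_zero⟩
  smul_mem' := by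
    rintro c F ⟨h1, h2⟩
    exact ⟨fun r => by simp [A.laws.grade_smul, h1], fun r => by simp [A.laws.grade_smul, h2]⟩


@[ext] theorem suspHom_ext {a b : A.Ob} {F G : A.suspHom a b} (h1 : ∀ r, F.1.1 r = G.1.1 r)
    (h2 : ∀ r, F.1.2 r = G.1.2 r) : F = G :=
  Subtype.ext (Prod.ext (ZeroAtInftyContinuousMap.ext h1) (ZeroAtInftyContinuousMap.ext h2))

theorem star_neg {a b : A.Ob} (x : A.Hom a b) : A.star (-x) = -A.star x := by
  simpa using A.laws.star_smul (-1) x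

theorem comp_neg {a b c : A.Ob} (x : A.Hom b c) (y : A.Hom a b) : A.comp x (-y) = -A.comp x y := by
  simpa using A.laws.comp_smul (-1) x y

theorem neg_comp {a b c : A.Ob} (x : A.Hom b c) (y : A.Hom a b) : A.comp (-x) y = -A.comp x y := by
  simpa using A.laws.smul_comp (-1) x y

/-- Composition in `S ⊗̂ A`: `(f ⊗ x)(g ⊗ y) = (-1)^(deg x deg g) fg ⊗ xy`, so that an odd value of
the left factor reflects the argument of the right factor. -/
def suspComp {a b c : A.Ob} (F : A.suspHom b c) (G : A.suspHom a b) : A.suspHom a c :=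
  ⟨(A.comp₀ F.1.1 G.1.1 + A.comp₀ F.1.2 (A.refl₀ G.1.2),
    A.comp₀ F.1.1 G.1.2 + A.comp₀ F.1.2 (A.refl₀ G.1.1)), by
    obtain ⟨hF1, hF2⟩ := F.2
    obtain ⟨hG1, hG2⟩ := G.2
    refine ⟨fun r => ?_, fun r => ?_⟩
    · simp [A.laws.grade_add, A.laws.grade_comp, hF1, hF2, hG1, hG2, comp_neg, neg_comp]
    · simp [A.laws.grade_add, A.laws.grade_comp, hF1, hF2, hG1, hG2, comp_neg, neg_comp, add_comm]⟩

/-- The involution of `S ⊗̂ A`: `(f ⊗ x)* = (-1)^(deg f deg x) f* ⊗ x*`. -/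
def suspStar {a b : A.Ob} (F : A.suspHom a b) : A.suspHom b a :=
  ⟨(A.star₀ F.1.1, A.refl₀ (A.star₀ F.1.2)), by
    obtain ⟨hF1, hF2⟩ := F.2
    refine ⟨fun r => ?_, fun r => ?_⟩
    · simp [A.laws.grade_star, hF1]
    · simp [A.laws.grade_star, hF2, star_neg]⟩

/-- The grading of `S ⊗̂ A`: `δ(f ⊗ x) = δ_S(f) ⊗ δ_A(x)`, where `δ_S(f)(r) = f(-r)`. -/
def suspGrade {a b : A.Ob} (F : A.suspHom a b) : A.suspHom a b :=
  ⟨(A.refl₀ F.1.1, -A.refl₀ F.1.2), by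
    obtain ⟨hF1, hF2⟩ := F.2
    refine ⟨fun r => ?_, fun r => ?_⟩
    · simp [hF1]
    · have := A.laws.grade_smul (-1) (F.1.2 (-r))
      simp only [neg_smul, one_smul] at this
      simp [this, hF2]⟩

section

variable {a b c : A.Ob} (F F' : A.suspHom b c) (G : A.suspHom a b) (r : ℝ)

@[simp] theorem suspComp_fst : (A.suspComp F G).1.1 r =
    A.comp (F.1.1 r) (G.1.1 r) + A.comp (F.1.2 r) (G.1.2 (-r)) := rfl
@[simp] theorem suspComp_snd : (A.suspComp F G).1.2 r =
    A.comp (F.1.1 r) (G.1.2 r) + A.comp (F.1.2 r) (G.1.1 (-r)) := rfl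
@[simp] theorem suspStar_fst : (A.suspStar F).1.1 r = A.star (F.1.1 r) := rfl
@[simp] theorem suspStar_snd : (A.suspStar F).1.2 r = A.star (F.1.2 (-r)) := rfl
@[simp] theorem suspGrade_fst : (A.suspGrade F).1.1 r = F.1.1 (-r) := rfl
@[simp] theorem suspGrade_snd : (A.suspGrade F).1.2 r = -F.1.2 (-r) := rfl
@[simp] theorem susp_add_fst : (F + F').1.1 r = F.1.1 r + F'.1.1 r := rfl
@[simp] theorem susp_add_snd : (F + F').1.2 r = F.1.2 r + F'.1.2 r := rfl
@[simp] theorem susp_smul_fst (c : 𝕜) : (c • F).1.1 r = c • F.1.1 r := rfl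
@[simp] theorem susp_smul_snd (c : 𝕜) : (c • F).1.2 r = c • F.1.2 r := rfl

end

theorem suspLaws : StarLaws 𝕜 (fun a b : A.Ob => A.suspHom a b) (fun F G => A.suspComp F G)
    (fun F => A.suspStar F) (fun F => A.suspGrade F) where
  assoc x y z := by
    ext r
    · simp only [suspComp_fst, suspComp_snd, A.laws.comp_add, A.laws.add_comp, A.laws.assoc, neg_neg]
      abel
    · simp only [suspComp_fst, suspComp_snd, A.laws.comp_add, A.laws.add_comp, A.laws.assoc, neg_neg]
      abel
  add_comp x y z := by
    ext r <;> simp only [suspComp_fst, suspComp_snd, susp_add_fst, susp_add_snd, A.laws.add_comp] <;>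
      abel
  comp_add x y z := by
    ext r <;> simp only [suspComp_fst, suspComp_snd, susp_add_fst, susp_add_snd, A.laws.comp_add] <;>
      abel
  smul_comp c x y := by
    ext r <;> simp [A.laws.smul_comp]
  comp_smul c x y := by
    ext r <;> simp [A.laws.comp_smul]
  star_add x y := by ext r <;> simp [A.laws.star_add]
  star_smul c x := by ext r <;> simp [A.laws.star_smul]
  star_star x := by ext r <;> simp [A.laws.star_star]
  star_comp x y := by
    ext r
    · simp [A.laws.star_add, A.laws.star_comp]
    · simp [A.laws.star_add, A.laws.star_comp, add_comm]
  grade_add x y := by ext r <;> simp [add_comm]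
  grade_smul c x := by ext r <;> simp
  grade_comp x y := by
    ext r <;> simp [comp_neg, neg_comp, add_comm]
  grade_star x := by ext r <;> simp [star_neg]
  grade_grade x := by ext r <;> simp

/-- The graded tensor product `S ⊗̂ A`, where `S` is `C₀(ℝ)` graded by even and odd functions. Its
objects are those of `A`, and its morphisms are `C₀`-functions with values in the morphism spaces of
`A`. -/
def susp : GradedStarCategory.{u, v} 𝕜 where
  Ob := A.Ob
  Hom a b := A.suspHom a b
  comp F G := A.suspComp F G
  star F := A.suspStar F
  grade F := A.suspGrade F
  laws := A.suspLaws

end GradedCStarCategory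

/-! ### The category `B ⊗̂ K` -/

section HilbertTensor

variable {𝕜 : Type} [RCLike 𝕜] {E : Type u} {E' : Type u} {E'' : Type u} {F : Type v} {F' : Type v}
  {F'' : Type v}
  [NormedAddCommGroup E] [InnerProductSpace 𝕜 E] [NormedAddCommGroup E'] [InnerProductSpace 𝕜 E']
  [NormedAddCommGroup E''] [InnerProductSpace 𝕜 E'']
  [NormedAddCommGroup F] [InnerProductSpace 𝕜 F] [NormedAddCommGroup F'] [InnerProductSpace 𝕜 F']
  [NormedAddCommGroup F''] [InnerProductSpace 𝕜 F'']

variable (𝕜 E F) in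
/-- The Hilbert space tensor product. -/
abbrev HTensor : Type (max u v) := UniformSpace.Completion (E ⊗[𝕜] F)

/-- The operator `f ⊗ g` on Hilbert space tensor products. -/
def opTensor (f : E →L[𝕜] E') (g : F →L[𝕜] F') : HTensor 𝕜 E F →L[𝕜] HTensor 𝕜 E' F' :=
  (TensorProduct.mapL f g).completion

theorem opTensor_coe (f : E →L[𝕜] E') (g : F →L[𝕜] F') (z : E ⊗[𝕜] F) :
    opTensor f g (z : HTensor 𝕜 E F) = ((TensorProduct.mapL f g z : E' ⊗[𝕜] F') : HTensor 𝕜 E' F') :=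
  ContinuousLinearMap.completion_apply_coe _ _

theorem hTensor_ext {T T' : HTensor 𝕜 E F →L[𝕜] HTensor 𝕜 E' F'}
    (h : ∀ z : E ⊗[𝕜] F, T z = T' z) : T = T' := by
  ext x
  induction x using UniformSpace.Completion.induction_on with
  | hp => exact isClosed_eq T.continuous T'.continuous
  | ih z => exact h z

theorem opTensor_comp (f' : E' →L[𝕜] E'') (g' : F' →L[𝕜] F'') (f : E →L[𝕜] E') (g : F →L[𝕜] F') :
    opTensor f' g' ∘L opTensor f g = opTensor (f' ∘L f) (g' ∘L g) := by
  refine hTensor_ext fun z => ?_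
  rw [ContinuousLinearMap.comp_apply, opTensor_coe, opTensor_coe, opTensor_coe,
    TensorProduct.mapL_comp]
  rfl

theorem opTensor_id : opTensor (ContinuousLinearMap.id 𝕜 E) (ContinuousLinearMap.id 𝕜 F) =
    ContinuousLinearMap.id 𝕜 (HTensor 𝕜 E F) := by
  refine hTensor_ext fun z => ?_
  rw [opTensor_coe]
  simp

theorem opTensor_neg_right (f : E →L[𝕜] E') (g : F →L[𝕜] F') :
    opTensor f (-g) = -opTensor f g := by
  refine hTensor_ext fun z => ?_
  rw [_root_.neg_apply, opTensor_coe, opTensor_coe, ← UniformSpace.Completion.coe_neg]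
  congr 1
  have h := TensorProduct.mapL_smul_right (-1 : 𝕜) f g
  simp only [neg_smul, one_smul] at h
  rw [h]
  simp

theorem norm_opTensor_le (f : E →L[𝕜] E') (g : F →L[𝕜] F') : ‖opTensor f g‖ ≤ ‖f‖ * ‖g‖ := by
  refine ContinuousLinearMap.opNorm_le_bound _ (by positivity) fun x => ?_
  induction x using UniformSpace.Completion.induction_on with
  | hp => exact isClosed_le (by fun_prop) (by fun_prop)
  | ih z =>
    rw [opTensor_coe, UniformSpace.Completion.norm_coe, UniformSpace.Completion.norm_coe]
    exact (ContinuousLinearMap.le_opNorm _ _).trans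
      (mul_le_mul_of_nonneg_right (TensorProduct.norm_mapL_le f g) (norm_nonneg _))

theorem adjoint_opTensor [CompleteSpace E] [CompleteSpace E'] [CompleteSpace F] [CompleteSpace F']
    (f : E →L[𝕜] E') (g : F →L[𝕜] F') :
    ContinuousLinearMap.adjoint (opTensor f g) =
      opTensor (ContinuousLinearMap.adjoint f) (ContinuousLinearMap.adjoint g) := by
  symm
  rw [ContinuousLinearMap.eq_adjoint_iff]
  intro x y
  induction x, y using UniformSpace.Completion.induction_on₂ with
  | hp => exact isClosed_eq (by fun_prop) (by fun_prop)
  | ih x y =>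
    rw [opTensor_coe, opTensor_coe, UniformSpace.Completion.inner_coe,
      UniformSpace.Completion.inner_coe]
    induction x using TensorProduct.induction_on with
    | zero => simp
    | add x x' hx hx' => simp only [map_add, inner_add_left, hx, hx']
    | tmul e k =>
      induction y using TensorProduct.induction_on with
      | zero => simp
      | add y y' hy hy' => simp only [map_add, inner_add_right, hy, hy']
      | tmul e' k' =>
        simp [ContinuousLinearMap.adjoint_inner_left]

/-- The adjoint of a compact operator between Hilbert spaces is compact. -/
theorem isCompactOperator_adjoint [CompleteSpace F] [CompleteSpace F'] (k : F →L[𝕜] F')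
    (hk : IsCompactOperator k) : IsCompactOperator (ContinuousLinearMap.adjoint k) := by
  set k' := ContinuousLinearMap.adjoint k with hk'
  have hc : IsCompactOperator (k ∘L k') := hk.comp_clm k'
  refine (isCompactOperator_iff_isCompact_closure_image_closedBall (k' : F' →ₗ[𝕜] F)
    zero_lt_one).2 ?_
  have h1 : TotallyBounded ((k ∘L k') '' Metric.closedBall 0 1) :=
    ((isCompactOperator_iff_isCompact_closure_image_closedBall ((k ∘L k' : F' →L[𝕜] F') :
      F' →ₗ[𝕜] F') zero_lt_one).1 hc).totallyBounded.subset subset_closure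
  refine isCompact_iff_totallyBounded_isComplete.2
    ⟨TotallyBounded.closure ?_, isClosed_closure.isComplete⟩
  rw [Metric.totallyBounded_iff]
  intro ε hε
  obtain ⟨T, hTs, hTf, hT⟩ := Metric.finite_approx_of_totallyBounded h1 (ε ^ 2 / 4) (by positivity)
  choose! y hy hy' using fun z (hz : z ∈ T) => hTs hz
  refine ⟨(fun z => k' (y z)) '' T, hTf.image _, ?_⟩
  rintro _ ⟨x, hx, rfl⟩
  obtain ⟨z, hz, hxz⟩ := Set.mem_iUnion₂.1 (hT ⟨x, hx, rfl⟩)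
  refine Set.mem_iUnion₂.2 ⟨_, ⟨z, hz, rfl⟩, ?_⟩
  have hyz := hy' z hz
  rw [← hyz, Metric.mem_ball, dist_eq_norm] at hxz
  rw [Metric.mem_ball, dist_eq_norm]
  change ‖k' x - k' (y z)‖ < ε
  have hd : ‖x - y z‖ ≤ 2 := by
    have h2 := hy z hz
    rw [mem_closedBall_zero_iff] at hx h2
    linarith [norm_sub_le x (y z)]
  have hs : ‖k' (x - y z)‖ ^ 2 ≤ ε ^ 2 / 4 * 2 := by
    have : ‖k' (x - y z)‖ ^ 2 = RCLike.re (inner 𝕜 (k (k' (x - y z))) (x - y z)) := by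
      rw [← ContinuousLinearMap.adjoint_inner_right, ← hk', inner_self_eq_norm_sq]
    rw [this]
    refine (RCLike.re_le_norm _).trans ((norm_inner_le_norm _ _).trans ?_)
    refine mul_le_mul ?_ hd (norm_nonneg _) (by positivity)
    have : k (k' (x - y z)) = (k ∘L k') x - (k ∘L k') (y z) := by simp
    rw [this]
    exact hxz.le
  rw [← map_sub]
  nlinarith [norm_nonneg (k' (x - y z))]

end HilbertTensor

theorem mem_of_mem_closure_span {𝕜 : Type} [RCLike 𝕜] {X : Type u} {Y : Type v}
    [NormedAddCommGroup X] [NormedSpace 𝕜 X] [NormedAddCommGroup Y] [NormedSpace 𝕜 Y]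
    {σ : 𝕜 →+* 𝕜} (L : X →SL[σ] Y) {G : Set X} {S : Submodule 𝕜 Y} (hS : IsClosed (S : Set Y))
    (h : ∀ g ∈ G, L g ∈ S) {z : X} (hz : z ∈ (Submodule.span 𝕜 G).topologicalClosure) :
    L z ∈ S := by
  have h1 : (Submodule.span 𝕜 G) ≤ S.comap (L : X →ₛₗ[σ] Y) := Submodule.span_le.2 h
  exact Submodule.topologicalClosure_minimal _ h1 (hS.preimage L.continuous) hz

namespace GradedCStarCategory

variable {𝕜 : Type} [RCLike 𝕜] (B : GradedCStarCategory.{u, v} 𝕜)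

/-- Graded representations of a graded `C*`-category. -/
abbrev Reps : Type (max u (v + 1)) := Rep B.toNormedGradedStarCategory

/-- The objects `b ⊗ H` of `B ⊗̂ K`, where `K` is the graded `C*`-category of all separable graded
Hilbert spaces and compact operators. -/
structure TensorOb where
  ob : B.Ob
  hilb : GradedHilbert.{0} 𝕜
  sep : TopologicalSpace.SeparableSpace hilb

/-- The Hilbert space `ρ(b) ⊗ H`. -/
abbrev repSpace (ρ : B.Reps) (p : B.TensorOb) : Type v := HTensor 𝕜 (ρ.obj p.ob) p.hilb

/-- The grading operator of the Hilbert space `ρ(b) ⊗ H`. -/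
def repEps (ρ : B.Reps) (p : B.TensorOb) : B.repSpace ρ p →L[𝕜] B.repSpace ρ p :=
  opTensor (ρ.obj p.ob).eps p.hilb.eps

/-- Bounded families of operators `ρ(b) ⊗ H → ρ(b') ⊗ H'`, where `ρ` runs over all graded
representations of `B`, with the supremum norm. -/
def Fam (p q : B.TensorOb) : Type (max u (v + 1)) :=
  lp (fun ρ : B.Reps => B.repSpace ρ p →L[𝕜] B.repSpace ρ q) ∞

instance (p q : B.TensorOb) : NormedAddCommGroup (B.Fam p q) :=
  inferInstanceAs (NormedAddCommGroup
    (lp (fun ρ : B.Reps => B.repSpace ρ p →L[𝕜] B.repSpace ρ q) ∞))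

instance (p q : B.TensorOb) : NormedSpace 𝕜 (B.Fam p q) :=
  inferInstanceAs (NormedSpace 𝕜
    (lp (fun ρ : B.Reps => B.repSpace ρ p →L[𝕜] B.repSpace ρ q) ∞))

instance (p q : B.TensorOb) : CoeFun (B.Fam p q)
    fun _ => ∀ ρ : B.Reps, B.repSpace ρ p →L[𝕜] B.repSpace ρ q := ⟨fun z => z.1⟩

variable {B} {p q r : B.TensorOb}

theorem Fam.ext {z w : B.Fam p q} (h : ∀ ρ, z ρ = w ρ) : z = w := Subtype.ext (funext h)

theorem Fam.norm_apply_le (z : B.Fam p q) (ρ : B.Reps) : ‖z ρ‖ ≤ ‖z‖ :=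
  lp.norm_apply_le_norm (E := fun ρ : B.Reps => B.repSpace ρ p →L[𝕜] B.repSpace ρ q)
    (by simp) z ρ

theorem Fam.norm_le {z : B.Fam p q} {c : ℝ} (hc : 0 ≤ c) (h : ∀ ρ, ‖z ρ‖ ≤ c) : ‖z‖ ≤ c :=
  lp.norm_le_of_forall_le (E := fun ρ : B.Reps => B.repSpace ρ p →L[𝕜] B.repSpace ρ q) hc h

/-- The elementary tensor `x ⊗̂ k`, where `x` is homogeneous of degree `d`. It is represented by
`ρ(x) ⊗ ε^d k`; this representation respects the graded product
`(u ⊗ v)(x ⊗ y) = (-1)^(deg v deg x) ux ⊗ vy` and the graded involution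
`(x ⊗ y)* = (-1)^(deg x deg y) x* ⊗ y*`. -/
def elem (d : ℕ) (x : B.Hom p.ob q.ob) (k : p.hilb →L[𝕜] q.hilb) : B.Fam p q :=
  ⟨fun ρ => opTensor (ρ.map x) ((q.hilb.eps ^ d) ∘L k), memℓp_infty
    ⟨‖x‖ * ‖(q.hilb.eps ^ d) ∘L k‖, by
      rintro _ ⟨ρ, rfl⟩
      exact (norm_opTensor_le _ _).trans
        (mul_le_mul_of_nonneg_right (ρ.norm_map_le x) (norm_nonneg _))⟩⟩

theorem elem_apply (d : ℕ) (x : B.Hom p.ob q.ob) (k : p.hilb →L[𝕜] q.hilb) (ρ : B.Reps) :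
    elem d x k ρ = opTensor (ρ.map x) ((q.hilb.eps ^ d) ∘L k) := rfl

variable (p q) in
/-- The elementary tensors `x ⊗̂ k` with `x` homogeneous and `k` compact. -/
def elems : Set (B.Fam p q) :=
  {z | ∃ (d : ℕ) (x : B.Hom p.ob q.ob) (k : p.hilb →L[𝕜] q.hilb),
    B.grade x = (-1 : 𝕜) ^ d • x ∧ IsCompactOperator k ∧ z = elem d x k}

variable (p q) in
/-- The morphism space of `B ⊗̂ K`: the closed linear span of the elementary tensors, i.e. the
completion of the algebraic tensor product in the spatial norm. -/
def tensorHom : Submodule 𝕜 (B.Fam p q) := (Submodule.span 𝕜 (elems p q)).topologicalClosure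

theorem isClosed_tensorHom : IsClosed (tensorHom p q : Set (B.Fam p q)) :=
  Submodule.isClosed_topologicalClosure _

theorem elems_subset : elems p q ⊆ (tensorHom p q : Set (B.Fam p q)) :=
  fun _ hz => Submodule.le_topologicalClosure _ (Submodule.subset_span hz)

/-- Composition of families of operators. -/
def famComp (z : B.Fam q r) (w : B.Fam p q) : B.Fam p r :=
  ⟨fun ρ => z ρ ∘L w ρ, memℓp_infty ⟨‖z‖ * ‖w‖, by
    rintro _ ⟨ρ, rfl⟩
    exact (ContinuousLinearMap.opNorm_comp_le _ _).trans
      (mul_le_mul (z.norm_apply_le ρ) (w.norm_apply_le ρ)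
        (norm_nonneg _) (norm_nonneg _))⟩⟩

theorem norm_famComp_le (z : B.Fam q r) (w : B.Fam p q) : ‖famComp z w‖ ≤ ‖z‖ * ‖w‖ :=
  Fam.norm_le (by positivity) fun ρ =>
    (ContinuousLinearMap.opNorm_comp_le _ _).trans
      (mul_le_mul (z.norm_apply_le ρ) (w.norm_apply_le ρ)
        (norm_nonneg _) (norm_nonneg _))

/-- The adjoint of a family of operators. -/
def famStar (z : B.Fam p q) : B.Fam q p :=
  ⟨fun ρ => ContinuousLinearMap.adjoint (z ρ), memℓp_infty ⟨‖z‖, by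
    rintro _ ⟨ρ, rfl⟩
    simp only [LinearIsometryEquiv.norm_map]
    exact z.norm_apply_le ρ⟩⟩

theorem norm_famStar (z : B.Fam p q) : ‖famStar z‖ = ‖z‖ := by
  refine le_antisymm (Fam.norm_le (norm_nonneg _) fun ρ => ?_)
    (Fam.norm_le (norm_nonneg _) fun ρ => ?_)
  · exact (LinearIsometryEquiv.norm_map ContinuousLinearMap.adjoint (z ρ)).le.trans
      (z.norm_apply_le ρ)
  · exact (LinearIsometryEquiv.norm_map ContinuousLinearMap.adjoint (z ρ)).ge.trans
      ((famStar z).norm_apply_le ρ)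

theorem norm_eps_le (H : GradedHilbert.{w} 𝕜) : ‖H.eps‖ ≤ 1 :=
  ContinuousLinearMap.opNorm_le_bound _ zero_le_one fun x => by
    rw [H.norm_eps_apply, one_mul]

theorem norm_repEps_le (ρ : B.Reps) (p : B.TensorOb) : ‖B.repEps ρ p‖ ≤ 1 :=
  (norm_opTensor_le _ _).trans (mul_le_one₀ (norm_eps_le _) (norm_nonneg _) (norm_eps_le _))

theorem repEps_repEps (ρ : B.Reps) (p : B.TensorOb) :
    B.repEps ρ p ∘L B.repEps ρ p = ContinuousLinearMap.id 𝕜 _ := by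
  rw [repEps, opTensor_comp, GradedHilbert.eps_eps, GradedHilbert.eps_eps, opTensor_id]

theorem adjoint_repEps (ρ : B.Reps) (p : B.TensorOb) :
    ContinuousLinearMap.adjoint (B.repEps ρ p) = B.repEps ρ p := by
  rw [repEps, adjoint_opTensor, GradedHilbert.eps_adj, GradedHilbert.eps_adj]

theorem norm_conj_le (ρ : B.Reps) (T : B.repSpace ρ p →L[𝕜] B.repSpace ρ q) :
    ‖B.repEps ρ q ∘L T ∘L B.repEps ρ p‖ ≤ ‖T‖ := by
  refine (ContinuousLinearMap.opNorm_comp_le _ _).trans ?_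
  refine (mul_le_mul (norm_repEps_le ρ q) (ContinuousLinearMap.opNorm_comp_le _ _)
    (norm_nonneg _) zero_le_one).trans ?_
  rw [one_mul]
  exact mul_le_of_le_one_right (norm_nonneg _) (norm_repEps_le ρ p)

/-- The grading of a family of operators: conjugation by the grading operators. -/
def famGrade (z : B.Fam p q) : B.Fam p q :=
  ⟨fun ρ => B.repEps ρ q ∘L z ρ ∘L B.repEps ρ p, memℓp_infty ⟨‖z‖, by
    rintro _ ⟨ρ, rfl⟩
    exact (norm_conj_le ρ _).trans (z.norm_apply_le ρ)⟩⟩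

theorem famLaws : StarLaws 𝕜 (fun p q : B.TensorOb => B.Fam p q) (fun z w => famComp z w)
    (fun z => famStar z) (fun z => famGrade z) where
  assoc x y z := by refine Fam.ext fun ρ => ?_; rfl
  add_comp x y z := by refine Fam.ext fun ρ => ?_; exact ContinuousLinearMap.add_comp _ _ _
  comp_add x y z := by refine Fam.ext fun ρ => ?_; exact ContinuousLinearMap.comp_add _ _ _
  smul_comp r x y := by refine Fam.ext fun ρ => ?_; exact ContinuousLinearMap.smul_comp _ _ _
  comp_smul r x y := by refine Fam.ext fun ρ => ?_; exact ContinuousLinearMap.comp_smul _ _ _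
  star_add {p q} x y := by
    refine Fam.ext fun ρ => ?_
    exact map_add (ContinuousLinearMap.adjoint (𝕜 := 𝕜) (E := B.repSpace ρ p) (F := B.repSpace ρ q))
      (x ρ) (y ρ)
  star_smul {p q} r x := by
    refine Fam.ext fun ρ => ?_; exact map_smulₛₗ
      (ContinuousLinearMap.adjoint (𝕜 := 𝕜) (E := B.repSpace ρ p) (F := B.repSpace ρ q)) r (x ρ)
  star_star x := by refine Fam.ext fun ρ => ?_; exact ContinuousLinearMap.adjoint_adjoint _
  star_comp {p q r} x y := by
    refine Fam.ext fun ρ => ?_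
    exact ContinuousLinearMap.adjoint_comp (E := B.repSpace ρ p) (F := B.repSpace ρ q)
      (G := B.repSpace ρ r) (x ρ) (y ρ)
  grade_add {p q} x y := by
    refine Fam.ext fun ρ => ?_
    change B.repEps ρ q ∘L (x ρ + y ρ) ∘L B.repEps ρ p =
      B.repEps ρ q ∘L x ρ ∘L B.repEps ρ p + B.repEps ρ q ∘L y ρ ∘L B.repEps ρ p
    rw [ContinuousLinearMap.add_comp, ContinuousLinearMap.comp_add]
  grade_smul {p q} r x := by
    refine Fam.ext fun ρ => ?_
    change B.repEps ρ q ∘L (r • x ρ) ∘L B.repEps ρ p = r • (B.repEps ρ q ∘L x ρ ∘L B.repEps ρ p)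
    rw [ContinuousLinearMap.smul_comp, ContinuousLinearMap.comp_smul]
  grade_comp {p q r} x y := by
    refine Fam.ext fun ρ => ?_
    change B.repEps ρ r ∘L (x ρ ∘L y ρ) ∘L B.repEps ρ p =
      (B.repEps ρ r ∘L x ρ ∘L B.repEps ρ q) ∘L B.repEps ρ q ∘L y ρ ∘L B.repEps ρ p
    ext z
    have h := fun z' => DFunLike.congr_fun (repEps_repEps ρ q) z'
    simp only [ContinuousLinearMap.comp_apply, ContinuousLinearMap.id_apply] at h ⊢
    rw [h]
  grade_star {p q} x := by
    refine Fam.ext fun ρ => ?_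
    change B.repEps ρ p ∘L ContinuousLinearMap.adjoint (x ρ) ∘L B.repEps ρ q =
      ContinuousLinearMap.adjoint (B.repEps ρ q ∘L x ρ ∘L B.repEps ρ p)
    rw [ContinuousLinearMap.adjoint_comp, ContinuousLinearMap.adjoint_comp, adjoint_repEps,
      adjoint_repEps, ContinuousLinearMap.comp_assoc]
  grade_grade {p q} x := by
    refine Fam.ext fun ρ => ?_
    change B.repEps ρ q ∘L (B.repEps ρ q ∘L x ρ ∘L B.repEps ρ p) ∘L B.repEps ρ p = x ρ
    ext z
    have h := fun z' => DFunLike.congr_fun (repEps_repEps ρ p) z'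
    have h' := fun z' => DFunLike.congr_fun (repEps_repEps ρ q) z'
    simp only [ContinuousLinearMap.comp_apply, ContinuousLinearMap.id_apply] at h h' ⊢
    rw [h, h']

theorem eps_pow_conj (H : GradedHilbert.{w} 𝕜) (d : ℕ) : (H.eps ^ d) ∘L (H.eps ^ d) = 1 := by
  have h : H.eps * H.eps = 1 := H.eps_eps
  change H.eps ^ d * H.eps ^ d = 1
  rw [← pow_add, ← two_mul, pow_mul, pow_two, h, one_pow]

/-- The product of elementary tensors; here `v' = ε^d' v ε^d'` equals `(-1)^(d' deg v) v` for
homogeneous `v`. -/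
theorem famComp_elem (d d' : ℕ) (x' : B.Hom q.ob r.ob) (k' : q.hilb →L[𝕜] r.hilb)
    (x : B.Hom p.ob q.ob) (k : p.hilb →L[𝕜] q.hilb) :
    famComp (elem d' x' k') (elem d x k) =
      elem (d' + d) (B.comp x' x) ((r.hilb.eps ^ d) ∘L k' ∘L (q.hilb.eps ^ d) ∘L k) := by
  refine Fam.ext fun ρ => ?_
  change opTensor _ _ ∘L opTensor _ _ = opTensor _ _
  rw [opTensor_comp, ρ.map_comp, pow_add]
  congr 1
  ext z
  have h : ∀ z', (r.hilb.eps ^ d) ((r.hilb.eps ^ d) z') = z' :=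
    fun z' => DFunLike.congr_fun (eps_pow_conj r.hilb d) z'
  change (r.hilb.eps ^ d') (k' ((q.hilb.eps ^ d) (k z))) =
    (r.hilb.eps ^ d') ((r.hilb.eps ^ d) ((r.hilb.eps ^ d) (k' ((q.hilb.eps ^ d) (k z)))))
  rw [h]

theorem adjoint_eps_pow (H : GradedHilbert.{w} 𝕜) (d : ℕ) :
    ContinuousLinearMap.adjoint (H.eps ^ d) = H.eps ^ d := by
  have : star (H.eps ^ d) = (star H.eps) ^ d := star_pow _ _
  rw [ContinuousLinearMap.star_eq_adjoint, ContinuousLinearMap.star_eq_adjoint, H.eps_adj] at this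
  exact this

theorem famStar_elem (d : ℕ) (x : B.Hom p.ob q.ob) (k : p.hilb →L[𝕜] q.hilb) :
    famStar (elem d x k) = elem d (B.star x)
      ((p.hilb.eps ^ d) ∘L ContinuousLinearMap.adjoint k ∘L (q.hilb.eps ^ d)) := by
  refine Fam.ext fun ρ => ?_
  change ContinuousLinearMap.adjoint (opTensor (ρ.map x) ((q.hilb.eps ^ d) ∘L k)) =
    opTensor (ρ.map (B.star x))
      ((p.hilb.eps ^ d) ∘L ((p.hilb.eps ^ d) ∘L ContinuousLinearMap.adjoint k ∘L (q.hilb.eps ^ d)))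
  rw [adjoint_opTensor, ρ.map_star, ContinuousLinearMap.adjoint_comp, adjoint_eps_pow]
  congr 1
  rw [← ContinuousLinearMap.comp_assoc, eps_pow_conj]
  rfl

theorem famGrade_elem (d : ℕ) (x : B.Hom p.ob q.ob) (k : p.hilb →L[𝕜] q.hilb) :
    famGrade (elem d x k) = elem d (B.grade x) (q.hilb.eps ∘L k ∘L p.hilb.eps) := by
  refine Fam.ext fun ρ => ?_
  change B.repEps ρ q ∘L opTensor _ _ ∘L B.repEps ρ p = opTensor _ _
  rw [repEps, repEps, opTensor_comp, opTensor_comp, ρ.map_grade]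
  congr 1
  have : q.hilb.eps * q.hilb.eps ^ d = q.hilb.eps ^ d * q.hilb.eps := (Commute.self_pow _ _).eq
  exact congrArg (fun T => T ∘L k ∘L p.hilb.eps) this

theorem famComp_mem {z : B.Fam q r} {w : B.Fam p q} (hz : z ∈ tensorHom q r)
    (hw : w ∈ tensorHom p q) : famComp z w ∈ tensorHom p r := by
  let R : B.Fam q r →ₗ[𝕜] B.Fam p r :=
    { toFun := fun z => famComp z w
      map_add' := fun x y => famLaws.add_comp x y w
      map_smul' := fun c x => famLaws.smul_comp c x w }
  refine mem_of_mem_closure_span (R.mkContinuous ‖w‖ fun z => by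
    rw [mul_comm]; exact norm_famComp_le z w) isClosed_tensorHom ?_ hz
  rintro z ⟨d', x', k', hx', hk', rfl⟩
  let L : B.Fam p q →ₗ[𝕜] B.Fam p r :=
    { toFun := fun w => famComp (elem d' x' k') w
      map_add' := fun x y => famLaws.comp_add (elem d' x' k') x y
      map_smul' := fun c x => famLaws.comp_smul c (elem d' x' k') x }
  refine mem_of_mem_closure_span (L.mkContinuous ‖(elem d' x' k' : B.Fam q r)‖ fun w =>
    norm_famComp_le _ w) isClosed_tensorHom ?_ hw
  rintro w ⟨d, x, k, hx, hk, rfl⟩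
  refine elems_subset ⟨d' + d, B.comp x' x, _, ?_, ?_, famComp_elem d d' x' k' x k⟩
  · rw [B.laws.grade_comp, hx, hx', B.laws.smul_comp, B.laws.comp_smul, smul_smul, pow_add]
  · exact ((hk.clm_comp (q.hilb.eps ^ d)).clm_comp k').clm_comp (r.hilb.eps ^ d)

theorem famStar_mem {z : B.Fam p q} (hz : z ∈ tensorHom p q) : famStar z ∈ tensorHom q p := by
  let L : B.Fam p q →ₛₗ[starRingEnd 𝕜] B.Fam q p :=
    { toFun := famStar, map_add' := famLaws.star_add, map_smul' := famLaws.star_smul }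
  refine mem_of_mem_closure_span (L.mkContinuous 1 fun z => by
    simpa [L] using (norm_famStar z).le) isClosed_tensorHom ?_ hz
  rintro z ⟨d, x, k, hx, hk, rfl⟩
  refine elems_subset ⟨d, B.star x, _, ?_, ?_, famStar_elem d x k⟩
  · rw [B.laws.grade_star, hx, B.laws.star_smul]
    simp
  · exact ((isCompactOperator_adjoint k hk).comp_clm (q.hilb.eps ^ d)).clm_comp (p.hilb.eps ^ d)

theorem famGrade_mem {z : B.Fam p q} (hz : z ∈ tensorHom p q) : famGrade z ∈ tensorHom p q := by
  let L : B.Fam p q →ₗ[𝕜] B.Fam p q :=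
    { toFun := famGrade, map_add' := famLaws.grade_add, map_smul' := famLaws.grade_smul }
  refine mem_of_mem_closure_span (L.mkContinuous 1 fun z => by
    rw [one_mul]
    exact Fam.norm_le (norm_nonneg _) fun ρ =>
      (norm_conj_le ρ _).trans (z.norm_apply_le ρ)) isClosed_tensorHom ?_ hz
  rintro z ⟨d, x, k, hx, hk, rfl⟩
  refine elems_subset ⟨d, B.grade x, _, ?_, ?_, famGrade_elem d x k⟩
  · rw [hx, B.laws.grade_smul, hx]
  · exact (hk.comp_clm p.hilb.eps).clm_comp q.hilb.eps

variable (B)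

/-- The graded tensor product `B ⊗̂ K` of `B` with the graded `C*`-category `K` of all compact
operators between separable graded Hilbert spaces. -/
def tensorK : NormedGradedStarCategory.{max u 1, max u (v + 1)} 𝕜 where
  Ob := B.TensorOb
  Hom p q := tensorHom p q
  comp z w := ⟨famComp z.1 w.1, famComp_mem z.2 w.2⟩
  star z := ⟨famStar z.1, famStar_mem z.2⟩
  grade z := ⟨famGrade z.1, famGrade_mem z.2⟩
  laws :=
    { assoc := fun _ _ _ => Subtype.ext (famLaws.assoc _ _ _)
      add_comp := fun _ _ _ => Subtype.ext (famLaws.add_comp _ _ _)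
      comp_add := fun _ _ _ => Subtype.ext (famLaws.comp_add _ _ _)
      smul_comp := fun _ _ _ => Subtype.ext (famLaws.smul_comp _ _ _)
      comp_smul := fun _ _ _ => Subtype.ext (famLaws.comp_smul _ _ _)
      star_add := fun _ _ => Subtype.ext (famLaws.star_add _ _)
      star_smul := fun _ _ => Subtype.ext (famLaws.star_smul _ _)
      star_star := fun _ => Subtype.ext (famLaws.star_star _)
      star_comp := fun _ _ => Subtype.ext (famLaws.star_comp _ _)
      grade_add := fun _ _ => Subtype.ext (famLaws.grade_add _ _)
      grade_smul := fun _ _ => Subtype.ext (famLaws.grade_smul _ _)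
      grade_comp := fun _ _ => Subtype.ext (famLaws.grade_comp _ _)
      grade_star := fun _ => Subtype.ext (famLaws.grade_star _)
      grade_grade := fun _ => Subtype.ext (famLaws.grade_grade _) }
  norm_comp_le z w := norm_famComp_le z.1 w.1
  norm_star z := norm_famStar z.1

end GradedCStarCategory

/-! ### Graded asymptotic functors and homotopy classes -/

/-- The data of an asymptotic functor `φ : A ⇢ B`: a map on objects, and maps `φₜ` on morphisms for
`t ∈ [1,∞)`. -/
structure FunctorData {𝕜 : Type} [RCLike 𝕜] (A : GradedStarCategory.{u, v} 𝕜)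
    (B : GradedStarCategory.{u₂, v₂} 𝕜) where
  obj : A.Ob → B.Ob
  map : Set.Ici (1 : ℝ) → ∀ {a b : A.Ob}, A.Hom a b → B.Hom (obj a) (obj b)

/-- `φ : A ⇢ C` is a graded asymptotic functor. -/
structure IsGradedAsymptotic {𝕜 : Type} [RCLike 𝕜] {A : GradedStarCategory.{u, v} 𝕜}
    {C : NormedGradedStarCategory.{u₂, v₂} 𝕜} (φ : FunctorData A C.alg) : Prop where
  continuous : ∀ {a b : A.Ob} (x : A.Hom a b),
    Continuous fun t => (φ.map t x : C.Hom (φ.obj a) (φ.obj b))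
  bounded : ∀ {a b : A.Ob} (x : A.Hom a b),
    ∃ K : ℝ, ∀ t, ‖(φ.map t x : C.Hom (φ.obj a) (φ.obj b))‖ ≤ K
  linear : ∀ {a b : A.Ob} (r s : 𝕜) (x y : A.Hom a b),
    Tendsto (fun t => ‖(φ.map t (r • x + s • y) - r • φ.map t x - s • φ.map t y :
      C.Hom (φ.obj a) (φ.obj b))‖) atTop (𝓝 0)
  comp : ∀ {a b c : A.Ob} (x : A.Hom b c) (y : A.Hom a b),
    Tendsto (fun t => ‖(φ.map t (A.comp x y) - C.comp (φ.map t x) (φ.map t y) :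
      C.Hom (φ.obj a) (φ.obj c))‖) atTop (𝓝 0)
  star : ∀ {a b : A.Ob} (x : A.Hom a b),
    Tendsto (fun t => ‖(φ.map t (A.star x) - C.star (φ.map t x) :
      C.Hom (φ.obj b) (φ.obj a))‖) atTop (𝓝 0)
  grade : ∀ {a b : A.Ob} (x : A.Hom a b),
    Tendsto (fun t => ‖(C.grade (φ.map t x) - φ.map t (A.grade x) :
      C.Hom (φ.obj a) (φ.obj b))‖) atTop (𝓝 0)

/-- The direct sum of two formal sequences (concatenation). -/
def FormalSum.append {X : Type u} (p q : FormalSum X) : FormalSum X :=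
  ⟨p.len + q.len, fun i => Sum.elim p.fam q.fam (finSumFinEquiv.symm i)⟩

/-- The direct sum `⊕ₖ pₖ` of a sequence of formal sequences (concatenation). -/
def FormalSum.join {X : Type u} (p : FormalSum (FormalSum X)) : FormalSum X :=
  ⟨∑ k, (p.fam k).len, fun i =>
    (p.fam (finSigmaFinEquiv.symm i).1).fam (finSigmaFinEquiv.symm i).2⟩

/-- The block-diagonal matrix with blocks `M` and `N`, indexed by a disjoint union. -/
def blockSum {𝕜 : Type} [RCLike 𝕜] {C : GradedStarCategory.{u, v} 𝕜} {ι κ ι' κ' : Type}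
    {s : ι → C.Ob} {t : κ → C.Ob} {s' : ι' → C.Ob} {t' : κ' → C.Ob}
    (M : Mat C s t) (N : Mat C s' t') : Mat C (Sum.elim s s') (Sum.elim t t')
  | Sum.inl i, Sum.inl j => M i j
  | Sum.inl i, Sum.inr j => (0 : C.Hom (s' j) (t i))
  | Sum.inr i, Sum.inl j => (0 : C.Hom (s j) (t' i))
  | Sum.inr i, Sum.inr j => N i j

namespace FunctorData

variable {𝕜 : Type} [RCLike 𝕜] {A : GradedStarCategory.{u, v} 𝕜}
  {C : GradedStarCategory.{u₂, v₂} 𝕜}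

/-- The additive extension `φ_⊕ : A_⊕ ⇢ C_⊕` of `φ : A ⇢ C_⊕`:
`φ_⊕(a₁ ⊕ ⋯ ⊕ aₙ) = φ(a₁) ⊕ ⋯ ⊕ φ(aₙ)`, and `φ_⊕` acts on matrices entry by entry, each
`φₜ(xᵢⱼ)` being a block of the resulting matrix. -/
def extend (φ : FunctorData A C.add) : FunctorData A.add C.add where
  obj a := FormalSum.join ⟨a.len, fun k => φ.obj (a.fam k)⟩
  map t _ _ M := fun i j =>
    φ.map t (M (finSigmaFinEquiv.symm i).1 (finSigmaFinEquiv.symm j).1)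
      (finSigmaFinEquiv.symm i).2 (finSigmaFinEquiv.symm j).2

/-- The direct sum `φ ⊕ ψ`. -/
def dsum (φ ψ : FunctorData A C.add) : FunctorData A C.add where
  obj a := (φ.obj a).append (ψ.obj a)
  map t _ _ x := fun i j =>
    blockSum (φ.map t x) (ψ.map t x) (finSumFinEquiv.symm i) (finSumFinEquiv.symm j)

/-- The null functor with object map `Φ`: it sends every morphism to zero. -/
def null (Φ : A.Ob → C.add.Ob) : FunctorData A C.add where
  obj := Φ
  map _ _ _ _ := 0

/-- The zero functor: it sends every object to the zero object (the empty sequence). -/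
def zero : FunctorData A C.add := null fun _ => ⟨0, Fin.elim0⟩

end FunctorData

/-- An additive graded asymptotic functor `A_⊕ ⇢ C_⊕`. Being additive, it is of the form `φ_⊕` for
a unique `φ : A ⇢ C_⊕`, by which it is recorded. -/
structure AddAsymp {𝕜 : Type} [RCLike 𝕜] (A : GradedStarCategory.{u, v} 𝕜)
    (C : NormedGradedStarCategory.{u₂, v₂} 𝕜) where
  data : FunctorData A C.alg.add
  asymptotic : IsGradedAsymptotic (C := C.add) data.extend

namespace AddAsymp

variable {𝕜 : Type} [RCLike 𝕜] {A : GradedStarCategory.{u, v} 𝕜}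
  {C : NormedGradedStarCategory.{u₂, v₂} 𝕜}

/-- The evaluation functor `E_s : IC → C` on morphisms. -/
def cylEval (C : NormedGradedStarCategory.{u₂, v₂} 𝕜)
    (hC : ∀ a b, Continuous (C.grade : C.Hom a b → C.Hom a b)) (s : unitInterval) {a b : C.Ob}
    (f : (C.cyl hC).Hom a b) : C.Hom a b :=
  (show C(unitInterval, C.Hom a b) from f) s

/-- Evaluation of an asymptotic functor `A_⊕ ⇢ I(C_⊕)` at the point `s` of `[0,1]`. -/
def evalAt (θ : FunctorData A.add (C.add.cyl C.add_continuous_grade).alg) (s : unitInterval) :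
    FunctorData A.add C.alg.add where
  obj := θ.obj
  map t _ _ x := cylEval C.add C.add_continuous_grade s (θ.map t x)

/-- `φ` and `ψ` are homotopic: there is a graded asymptotic functor `θ : A_⊕ ⇢ I(C_⊕)` with
`E₀ ∘ θ = φ` and `E₁ ∘ θ = ψ`. -/
def Homotopic (φ ψ : AddAsymp A C) : Prop :=
  ∃ θ : FunctorData A.add (C.add.cyl C.add_continuous_grade).alg, IsGradedAsymptotic θ ∧
    evalAt θ 0 = φ.data.extend ∧ evalAt θ 1 = ψ.data.extend

/-- The relation that generates the equivalence of additive graded asymptotic functors: homotopic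
functors are identified, and so are `φ`, `φ ⊕ ω` and `ω ⊕ φ` for every null functor `ω`. (Homotopic
functors have the same values on objects; the second clause lets one compare functors whose values
on objects differ by summands on which they vanish.) -/
def Rel (φ ψ : AddAsymp A C) : Prop :=
  Homotopic φ ψ ∨ ∃ Φ : A.Ob → C.alg.add.Ob,
    ψ.data = φ.data.dsum (FunctorData.null Φ) ∨ ψ.data = (FunctorData.null Φ).dsum φ.data

end AddAsymp

/-- The set `⟦A_⊕, C_⊕⟧_⊕` of classes of additive graded asymptotic functors, i.e. their quotient by
the equivalence relation generated by `AddAsymp.Rel`. -/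
def Classes {𝕜 : Type} [RCLike 𝕜] (A : GradedStarCategory.{u, v} 𝕜)
    (C : NormedGradedStarCategory.{u₂, v₂} 𝕜) : Type (max (max u v) (max u₂ v₂)) :=
  Quot (AddAsymp.Rel (A := A) (C := C))

/-- The class `[φ]`. -/
def AddAsymp.toClass {𝕜 : Type} [RCLike 𝕜] {A : GradedStarCategory.{u, v} 𝕜}
    {C : NormedGradedStarCategory.{u₂, v₂} 𝕜} (φ : AddAsymp A C) : Classes A C := Quot.mk _ φ

/-! ### The opposite of an asymptotic functor into `(B ⊗̂ K)_⊕` -/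

namespace GradedCStarCategory

variable {𝕜 : Type} [RCLike 𝕜] {B : GradedCStarCategory.{u, v} 𝕜}

/-- The object `b ⊗ Hᵒᵖᵖ`. -/
def TensorOb.opp (p : B.TensorOb) : B.TensorOb := ⟨p.ob, p.hilb.opp, p.sep⟩

/-- Since `H` and `Hᵒᵖᵖ` have the same underlying Hilbert space, an operator
`ρ(b) ⊗ H → ρ(b') ⊗ H'` is also one `ρ(b) ⊗ Hᵒᵖᵖ → ρ(b') ⊗ H'ᵒᵖᵖ`. -/
def repOpp (ρ : B.Reps) (p q : B.TensorOb) (T : B.repSpace ρ p →L[𝕜] B.repSpace ρ q) :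
    B.repSpace ρ p.opp →L[𝕜] B.repSpace ρ q.opp := T

theorem norm_repOpp_le (ρ : B.Reps) (p q : B.TensorOb) (T : B.repSpace ρ p →L[𝕜] B.repSpace ρ q) :
    ‖repOpp ρ p q T‖ ≤ ‖T‖ :=
  ContinuousLinearMap.opNorm_le_bound _ (norm_nonneg _) fun x =>
    T.le_opNorm (show B.repSpace ρ p from x)

theorem repOpp_add (ρ : B.Reps) (p q : B.TensorOb) (T T' : B.repSpace ρ p →L[𝕜] B.repSpace ρ q) :
    repOpp ρ p q (T + T') = repOpp ρ p q T + repOpp ρ p q T' :=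
  ContinuousLinearMap.ext fun _ => rfl

theorem repOpp_smul (ρ : B.Reps) (p q : B.TensorOb) (c : 𝕜)
    (T : B.repSpace ρ p →L[𝕜] B.repSpace ρ q) : repOpp ρ p q (c • T) = c • repOpp ρ p q T :=
  ContinuousLinearMap.ext fun _ => rfl

/-- The same for families of operators. -/
def famOpp (p q : B.TensorOb) (z : B.Fam p q) : B.Fam p.opp q.opp :=
  ⟨fun ρ => repOpp ρ p q (z ρ), memℓp_infty ⟨‖z‖, by
    rintro _ ⟨ρ, rfl⟩; exact (norm_repOpp_le ρ p q _).trans (z.norm_apply_le ρ)⟩⟩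

theorem neg_pow_comp_smul {E : Type u} {F : Type v} [NormedAddCommGroup E] [NormedSpace 𝕜 E]
    [NormedAddCommGroup F] [NormedSpace 𝕜 F] (e : F →L[𝕜] F) (k : E →L[𝕜] F) (d : ℕ) :
    ((-e) ^ d) ∘L ((-1 : 𝕜) ^ d • k) = (e ^ d) ∘L k := by
  rcases d.even_or_odd with h | h
  · rw [h.neg_pow, h.neg_one_pow, one_smul]
  · rw [h.neg_pow, h.neg_one_pow, neg_smul, one_smul, ContinuousLinearMap.neg_comp,
      ContinuousLinearMap.comp_neg, neg_neg]

theorem famOpp_mem {p q : B.TensorOb} {z : B.Fam p q} (hz : z ∈ tensorHom p q) :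
    famOpp p q z ∈ tensorHom p.opp q.opp := by
  let L : B.Fam p q →ₗ[𝕜] B.Fam p.opp q.opp :=
    { toFun := famOpp p q
      map_add' := fun _ _ => Fam.ext fun _ => repOpp_add _ _ _ _ _
      map_smul' := fun _ _ => Fam.ext fun _ => repOpp_smul _ _ _ _ _ }
  refine mem_of_mem_closure_span (L.mkContinuous 1 fun z => by
    rw [one_mul]
    exact Fam.norm_le (norm_nonneg _) fun ρ =>
      (norm_repOpp_le ρ p q _).trans (z.norm_apply_le ρ)) isClosed_tensorHom ?_ hz
  rintro z ⟨d, x, k, hx, hk, rfl⟩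
  refine elems_subset ⟨d, x, (-1 : 𝕜) ^ d • k, hx, hk.smul _, ?_⟩
  refine Fam.ext fun ρ => ?_
  change opTensor (ρ.map x) ((q.hilb.eps ^ d) ∘L k) =
    opTensor (ρ.map x) (((-q.hilb.eps) ^ d) ∘L ((-1 : 𝕜) ^ d • k))
  rw [neg_pow_comp_smul]

/-- A morphism `b ⊗ H → b' ⊗ H'` of `B ⊗̂ K`, viewed as a morphism `b ⊗ Hᵒᵖᵖ → b' ⊗ H'ᵒᵖᵖ`. -/
def homOpp {p q : B.TensorOb} (z : tensorHom p q) : tensorHom p.opp q.opp :=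
  ⟨famOpp p q z.1, famOpp_mem z.2⟩

end GradedCStarCategory

/-- The opposite `φᵒᵖᵖ` of `φ : A ⇢ (B ⊗̂ K)_⊕`: if `φ(a) = ⊕ᵢ bᵢ ⊗ Hᵢ`, then
`φᵒᵖᵖ(a) = ⊕ᵢ bᵢ ⊗ Hᵢᵒᵖᵖ`, and `φᵒᵖᵖₜ(x) = φₜ(δ x)`. -/
def FunctorData.opp {𝕜 : Type} [RCLike 𝕜] {A : GradedStarCategory.{u, v} 𝕜}
    {B : GradedCStarCategory.{u₂, v₂} 𝕜} (φ : FunctorData A B.tensorK.alg.add) :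
    FunctorData A B.tensorK.alg.add where
  obj a := ⟨(φ.obj a).len, fun i => GradedCStarCategory.TensorOb.opp ((φ.obj a).fam i)⟩
  map t _ _ x := fun i j => GradedCStarCategory.homOpp (φ.map t (A.grade x) i j)

end ETheory

end

/-!
The sum of classes is well defined because a homotopy `φ ≃ φ'` and the constant homotopy of `ψ`
have a direct sum, and because `φ ⊕ ω ⊕ ψ` and `φ ⊕ ψ ⊕ ω` differ only by the order of the
summands. Renumbering the summands of the objects does not change the class: if `ψ` is a
renumbering of `φ`, then `φ ⊕ 0` is rotated into `0 ⊕ ψ` by conjugation with the isometries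
`(√(1-u), √u)` (`AddAsymp.toClass_eq_of_equivalent`). This gives commutativity and associativity;
the null functors are neutral by definition of the equivalence relation.

The inverse is the point where `S = C₀(ℝ)` enters. Write `f ∈ S` as `fₑ + fₒ`, with even and odd
parts. Let `ε = diag(1, -1)`, and let `J` be the matrix that exchanges two summands; it is odd when
the grading of the second summand is reversed. For each height `s`, the matrix-valued function
`fₑ(|z|) + fₒ(|z|) (re z ε + im z J) / |z|` of `r`, with `z = r + is`, depends multiplicatively on
`f`, because `ε` and `J` are anticommuting self-adjoint unitaries; together with `x ↦ diag(x, δ x)`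
on `A` this defines a homomorphism from `S ⊗̂ A` to `2 × 2` matrices over `S ⊗̂ A`
(`GradedCStarCategory.rot`). At `s = 0` it is `diag(id, δ)`, and for `s → ∞` it converges to zero
pointwise in norm: a function in `C₀` of the plane is small on a line far from the origin. So
`diag(id, δ)` is null-homotopic, and a null-homotopy of `φ ⊕ φᵒᵖᵖ` results by composition with `φ`
(`AddAsymp.toClass_dsum_opp`).

Two points make that composition nontrivial. The maps `φₜ` are not required to be continuous, so
they cannot be applied to a path pointwise. But they are asymptotically linear and asymptotically
bounded, and for such families every continuous path has a jointly continuous lift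
(`IsAsymptoticallyLinear.exists_lift`): Bernstein approximants of the path are lifted by linearity,
and glued along `t → ∞`. Asymptotic boundedness (`IsGradedAsymptotic.eventually_norm_sq_le`) is a
substitute for the automatic contractivity of `*`-homomorphisms. For small `x`, the elements
`1 - s x* x` with `0 ≤ s ≤ 1` have left inverses in the unitization of `S ⊗̂ A`, by Banach's fixed
point theorem; the images of these under `φₜ` keep `1 - s φₜ(x)* φₜ(x)` bounded below, so that
`limsup ‖φₜ(x)‖² ≤ 1`.

The norm of `C_⊕` is the supremum of the operator norms in all graded representations of `C`. Hence
all conditions on an asymptotic functor can be read off from the entries of the matrices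
(`isGradedAsymptotic_iff`), in the category `C.spatial` in which morphisms carry that supremum as a
norm. That norm satisfies the `C*`-identity, by which reversing the gradings of the Hilbert spaces
of `B ⊗̂ K` at the source or at the target only is isometric (`GradedCStarCategory.norm_twist`).
-/

noncomputable section

namespace ETheory

/-! ### The spatial norm and the entries of matrices -/

namespace Rep

variable {𝕜 : Type} [RCLike 𝕜] {C : NormedGradedStarCategory.{u, v} 𝕜} {ι κ : Type}
  [Fintype ι] [Fintype κ] {s : ι → C.Ob} {t : κ → C.Ob} (ρ : Rep C)

theorem norm_map_entry_le (M : Mat C.alg s t) (i : κ) (j : ι) : ‖ρ.map (M i j)‖ ≤ ‖ρ.mat M‖ := by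
  classical
  refine ContinuousLinearMap.opNorm_le_bound _ (norm_nonneg _) fun x => ?_
  have h : ρ.map (M i j) x =
      ρ.mat M (PiLp.single 2 (β := fun j => (ρ.obj (s j)).carrier) j x) i := by
    rw [mat_apply, Finset.sum_eq_single j]
    · simp
    · intro k _ hk
      rw [PiLp.single_eq_of_ne _ hk, map_zero]
    · simp
  rw [h]
  refine (PiLp.norm_apply_le _ i).trans (((ρ.mat M).le_opNorm _).trans ?_)
  rw [PiLp.norm_single]

theorem norm_map_sq {a b : C.Ob} (x : C.Hom a b) :
    ‖ρ.map x‖ ^ 2 = ‖ρ.map (C.comp (C.star x) x)‖ := by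
  rw [ρ.map_comp, ρ.map_star, ContinuousLinearMap.norm_adjoint_comp_self, pow_two]

theorem norm_mat_le_sum (M : Mat C.alg s t) : ‖ρ.mat M‖ ≤ ∑ i, ∑ j, ‖ρ.map (M i j)‖ := by
  refine ContinuousLinearMap.opNorm_le_bound _ (by positivity) fun x => ?_
  have h1 : ‖ρ.mat M x‖ ≤ ∑ i, ‖ρ.mat M x i‖ := by
    rw [PiLp.norm_eq_of_L2]
    refine Real.sqrt_le_left (by positivity) |>.2 ?_
    exact Finset.sum_sq_le_sq_sum_of_nonneg fun _ _ => norm_nonneg _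
  refine h1.trans ?_
  rw [Finset.sum_mul]
  refine Finset.sum_le_sum fun i _ => ?_
  rw [mat_apply, Finset.sum_mul]
  refine (norm_sum_le _ _).trans (Finset.sum_le_sum fun j _ => ?_)
  refine ((ρ.map (M i j)).le_opNorm _).trans ?_
  exact mul_le_mul_of_nonneg_left (PiLp.norm_apply_le x j) (norm_nonneg _)

end Rep

namespace NormedGradedStarCategory

variable {𝕜 : Type} [RCLike 𝕜] (C : NormedGradedStarCategory.{u, v} 𝕜)

/-- The family of operators `(ρ(x))`, where `ρ` runs over all graded representations of `C`. -/
def spatialFamily (a b : C.Ob) :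
    C.Hom a b →ₗ[𝕜] lp (fun ρ : Rep C => (ρ.obj a).carrier →L[𝕜] (ρ.obj b).carrier) ∞ where
  toFun x := ⟨fun ρ => ρ.map x, memℓp_infty ⟨‖x‖, by
    rintro _ ⟨ρ, rfl⟩; exact ρ.norm_map_le x⟩⟩
  map_add' x y := by ext1; funext ρ; exact map_add ρ.map x y
  map_smul' c x := by ext1; funext ρ; exact map_smul ρ.map c x

theorem norm_spatialFamily_le {a b : C.Ob} (x : C.Hom a b) {r : ℝ} (hr : 0 ≤ r)
    (h : ∀ ρ : Rep C, ‖ρ.map x‖ ≤ r) : ‖C.spatialFamily a b x‖ ≤ r :=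
  lp.norm_le_of_forall_le hr h

theorem norm_map_le_spatialFamily {a b : C.Ob} (x : C.Hom a b) (ρ : Rep C) :
    ‖ρ.map x‖ ≤ ‖C.spatialFamily a b x‖ :=
  lp.norm_apply_le_norm (by simp) (C.spatialFamily a b x) ρ

/-- The graded `*`-category `C` with the seminorm `‖x‖ = sup_ρ ‖ρ(x)‖`, where `ρ` runs over all
graded representations of `C`. This is the norm that `C_⊕` induces on matrix entries. -/
def spatial : NormedGradedStarCategory.{u, v} 𝕜 where
  Ob := C.Ob
  Hom := C.Hom
  sng a b := SeminormedAddCommGroup.induced _ _ (C.spatialFamily a b)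
  nsp a b := NormedSpace.induced 𝕜 _ _ (C.spatialFamily a b)
  comp := C.comp
  star := C.star
  grade := C.grade
  laws := C.laws
  norm_comp_le {a b c} x y := by
    change ‖C.spatialFamily a c (C.comp x y)‖ ≤ ‖C.spatialFamily b c x‖ * ‖C.spatialFamily a b y‖
    refine C.norm_spatialFamily_le _ (by positivity) fun ρ => ?_
    rw [ρ.map_comp]
    exact (ContinuousLinearMap.opNorm_comp_le _ _).trans (mul_le_mul
      (C.norm_map_le_spatialFamily x ρ) (C.norm_map_le_spatialFamily y ρ)
      (norm_nonneg _) (norm_nonneg _))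
  norm_star {a b} x := by
    change ‖C.spatialFamily b a (C.star x)‖ = ‖C.spatialFamily a b x‖
    refine le_antisymm ?_ ?_
    · refine C.norm_spatialFamily_le _ (norm_nonneg _) fun ρ => ?_
      rw [ρ.map_star, LinearIsometryEquiv.norm_map]
      exact C.norm_map_le_spatialFamily x ρ
    · refine C.norm_spatialFamily_le _ (norm_nonneg _) fun ρ => ?_
      have := C.norm_map_le_spatialFamily (C.star x) ρ
      rwa [ρ.map_star, LinearIsometryEquiv.norm_map] at this

/-- An object of `C`, regarded as an object of `C.spatial`. -/
def toSpatial (a : C.Ob) : C.spatial.Ob := a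

theorem norm_spatial_le {a b : C.spatial.Ob} (x : C.spatial.Hom a b) {r : ℝ} (hr : 0 ≤ r)
    (h : ∀ ρ : Rep C, ‖@Rep.map 𝕜 _ C ρ a b x‖ ≤ r) : ‖x‖ ≤ r :=
  C.norm_spatialFamily_le x hr h

theorem norm_map_le_spatial {a b : C.spatial.Ob} (x : C.spatial.Hom a b) (ρ : Rep C) :
    ‖@Rep.map 𝕜 _ C ρ a b x‖ ≤ ‖x‖ :=
  C.norm_map_le_spatialFamily x ρ

/-- The `C*`-identity for the spatial norm. -/
theorem spatial_norm_star_comp_self {a b : C.spatial.Ob} (x : C.spatial.Hom a b) :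
    ‖C.spatial.comp (C.spatial.star x) x‖ = ‖x‖ ^ 2 := by
  refine le_antisymm ?_ ?_
  · refine (C.spatial.norm_comp_le _ _).trans ?_
    rw [C.spatial.norm_star, pow_two]
  · have key : ‖x‖ ≤ Real.sqrt ‖C.spatial.comp (C.spatial.star x) x‖ := by
      refine C.norm_spatial_le x (Real.sqrt_nonneg _) fun ρ => Real.le_sqrt_of_sq_le ?_
      refine le_trans (le_of_eq ?_) (C.norm_map_le_spatial _ ρ)
      exact @Rep.norm_map_sq 𝕜 _ C ρ a b x
    calc ‖x‖ ^ 2 ≤ Real.sqrt ‖C.spatial.comp (C.spatial.star x) x‖ ^ 2 :=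
          pow_le_pow_left₀ (norm_nonneg _) key 2
      _ = _ := Real.sq_sqrt (norm_nonneg _)

/-- The entry of a matrix in `C_⊕`, as a morphism with the spatial norm. -/
def entry {a b : C.add.Ob} (M : C.add.Hom a b) (i : Fin b.len) (j : Fin a.len) :
    C.spatial.Hom (C.toSpatial (a.fam j)) (C.toSpatial (b.fam i)) := M i j

theorem norm_entry_le {a b : C.add.Ob} (M : C.add.Hom a b) (i : Fin b.len) (j : Fin a.len) :
    ‖C.entry M i j‖ ≤ ‖M‖ :=
  C.norm_spatial_le _ (norm_nonneg _) fun ρ =>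
    (ρ.norm_map_entry_le (C := C) (s := a.fam) (t := b.fam) M i j).trans
      (C.norm_mat_le_norm a.fam b.fam M ρ)

theorem norm_le_sum_entry {a b : C.add.Ob} (M : C.add.Hom a b) :
    ‖M‖ ≤ ∑ i, ∑ j, ‖C.entry M i j‖ :=
  C.norm_matFamily_le _ _ _ (by positivity) fun ρ =>
    (ρ.norm_mat_le_sum (C := C) (s := a.fam) (t := b.fam) M).trans
      (Finset.sum_le_sum fun i _ => Finset.sum_le_sum fun j _ =>
        C.norm_map_le_spatial (C.entry M i j) ρ)

theorem tendsto_norm_zero_iff_entry {X : Type*} {l : Filter X} {a b : C.add.Ob}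
    {f : X → C.add.Hom a b} :
    Tendsto (fun x => ‖f x‖) l (𝓝 0) ↔ ∀ i j, Tendsto (fun x => C.entry (f x) i j) l (𝓝 0) := by
  constructor
  · intro h i j
    exact squeeze_zero_norm (fun x => C.norm_entry_le (f x) i j) h
  · intro h
    refine squeeze_zero (fun _ => norm_nonneg _) (fun x => C.norm_le_sum_entry (f x)) ?_
    have : Tendsto (fun x => ∑ i, ∑ j, ‖C.entry (f x) i j‖) l (𝓝 (∑ _i : Fin b.len,
        ∑ _j : Fin a.len, 0)) :=
      tendsto_finsetSum _ fun i _ => tendsto_finsetSum _ fun j _ => (h i j).norm.trans (by simp)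
    simpa using this

theorem continuous_iff_entry {X : Type*} [TopologicalSpace X] {a b : C.add.Ob}
    {f : X → C.add.Hom a b} : Continuous f ↔ ∀ i j, Continuous fun x => C.entry (f x) i j := by
  rw [continuous_iff_continuousAt]
  simp only [continuous_iff_continuousAt (X := X) (Y := C.spatial.Hom _ _)]
  have h1 : ∀ x, Tendsto f (𝓝 x) (𝓝 (f x)) ↔
      ∀ i j, Tendsto (fun y => C.entry (f y) i j) (𝓝 x) (𝓝 (C.entry (f x) i j)) := by
    intro x
    rw [tendsto_iff_norm_sub_tendsto_zero, tendsto_norm_zero_iff_entry]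
    refine forall_congr' fun i => forall_congr' fun j => ?_
    rw [tendsto_iff_norm_sub_tendsto_zero (f := fun y => C.entry (f y) i j),
      tendsto_zero_iff_norm_tendsto_zero]
    rfl
  exact ⟨fun h i j x => (h1 x).1 (h x) i j, fun h x => (h1 x).2 fun i j => h i j x⟩

theorem bounded_iff_entry {X : Type*} {a b : C.add.Ob} {f : X → C.add.Hom a b} :
    (∃ K : ℝ, ∀ x, ‖f x‖ ≤ K) ↔ ∀ i j, ∃ K : ℝ, ∀ x, ‖C.entry (f x) i j‖ ≤ K := by
  constructor
  · rintro ⟨K, hK⟩ i j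
    exact ⟨K, fun x => (C.norm_entry_le _ i j).trans (hK x)⟩
  · intro h
    choose K hK using h
    exact ⟨∑ i, ∑ j, K i j, fun x => (C.norm_le_sum_entry _).trans
      (Finset.sum_le_sum fun i _ => Finset.sum_le_sum fun j _ => hK i j x)⟩

end NormedGradedStarCategory

/-! ### Asymptotic families of matrices over a parameter space -/

/-- A family, indexed by a parameter space `T`, of maps from the morphisms of `A` to matrices of
morphisms of `D`; the object `a` is sent to the family of objects `fam a`, which is indexed by an
arbitrary finite type `idx a`. For `T = [1,∞)` this is the shape of an asymptotic functor
`A ⇢ D_⊕`, for `T = [1,∞) × [0,1]` that of a homotopy. -/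
structure MatFam {𝕜 : Type} [RCLike 𝕜] (T : Type) (A : GradedStarCategory.{u, v} 𝕜)
    (D : GradedStarCategory.{u₂, v₂} 𝕜) where
  idx : A.Ob → Type
  [fin : ∀ a, Fintype (idx a)]
  fam : ∀ a, idx a → D.Ob
  map : T → ∀ {a b : A.Ob}, A.Hom a b → Mat D (fam a) (fam b)

attribute [instance] MatFam.fin

namespace MatFam

variable {𝕜 : Type} [RCLike 𝕜] {T T' : Type} {A : GradedStarCategory.{u, v} 𝕜}
  {D : NormedGradedStarCategory.{u₂, v₂} 𝕜}

/-- The conditions on a graded asymptotic functor, entry by entry and with the limit `t → ∞`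
replaced by the limit along a filter `l` on the parameter space. -/
structure IsAsymptotic [TopologicalSpace T] (l : Filter T) (F : MatFam T A D.alg) : Prop where
  continuous : ∀ {a b : A.Ob} (x : A.Hom a b) (i : F.idx b) (j : F.idx a),
    Continuous fun p => (F.map p x i j : D.Hom (F.fam a j) (F.fam b i))
  bounded : ∀ {a b : A.Ob} (x : A.Hom a b) (i : F.idx b) (j : F.idx a),
    ∃ K : ℝ, ∀ p, ‖(F.map p x i j : D.Hom (F.fam a j) (F.fam b i))‖ ≤ K
  linear : ∀ {a b : A.Ob} (r s : 𝕜) (x y : A.Hom a b) (i : F.idx b) (j : F.idx a),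
    Tendsto (fun p => (F.map p (r • x + s • y) i j - r • F.map p x i j - s • F.map p y i j :
      D.Hom (F.fam a j) (F.fam b i))) l (𝓝 0)
  comp : ∀ {a b c : A.Ob} (x : A.Hom b c) (y : A.Hom a b) (i : F.idx c) (j : F.idx a),
    Tendsto (fun p => (F.map p (A.comp x y) i j - ∑ k, D.comp (F.map p x i k) (F.map p y k j) :
      D.Hom (F.fam a j) (F.fam c i))) l (𝓝 0)
  star : ∀ {a b : A.Ob} (x : A.Hom a b) (i : F.idx a) (j : F.idx b),
    Tendsto (fun p => (F.map p (A.star x) i j - D.star (F.map p x j i) :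
      D.Hom (F.fam b j) (F.fam a i))) l (𝓝 0)
  grade : ∀ {a b : A.Ob} (x : A.Hom a b) (i : F.idx b) (j : F.idx a),
    Tendsto (fun p => (D.grade (F.map p x i j) - F.map p (A.grade x) i j :
      D.Hom (F.fam a j) (F.fam b i))) l (𝓝 0)

/-- Renumbering of the rows and columns. -/
@[reducible] def reindex {D : GradedStarCategory.{u₂, v₂} 𝕜} (F : MatFam T A D)
    (ι : A.Ob → Type) [∀ a, Fintype (ι a)] (e : ∀ a, ι a ≃ F.idx a) : MatFam T A D where
  idx := ι
  fam a i := F.fam a (e a i)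
  map p a b x := fun i j => F.map p x (e b i) (e a j)

/-- Pull-back along a map of parameter spaces. -/
@[reducible] def comap {D : GradedStarCategory.{u₂, v₂} 𝕜} (F : MatFam T A D) (g : T' → T) :
    MatFam T' A D where
  idx := F.idx
  fam := F.fam
  map p _ _ x := F.map (g p) x

/-- The additive extension, by block matrices. -/
@[reducible] def extend {D : GradedStarCategory.{u₂, v₂} 𝕜} (F : MatFam T A D) :
    MatFam T A.add D where
  idx a := Σ k : Fin a.len, F.idx (a.fam k)
  fam a i := F.fam (a.fam i.1) i.2
  map p _ _ M := fun i j => F.map p (M i.1 j.1) i.2 j.2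

/-- The direct sum. -/
@[reducible] def dsum {D : GradedStarCategory.{u₂, v₂} 𝕜} (F G : MatFam T A D) :
    MatFam T A D where
  idx a := F.idx a ⊕ G.idx a
  fam a := Sum.elim (F.fam a) (G.fam a)
  map p _ _ x := blockSum (F.map p x) (G.map p x)

variable [TopologicalSpace T] [TopologicalSpace T'] {l : Filter T} {l' : Filter T'}

theorem isAsymptotic_reindex_iff (F : MatFam T A D.alg) (ι : A.Ob → Type) [∀ a, Fintype (ι a)]
    (e : ∀ a, ι a ≃ F.idx a) : (F.reindex ι e).IsAsymptotic l ↔ F.IsAsymptotic l := by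
  constructor
  · intro h
    refine ⟨?_, ?_, ?_, ?_, ?_, ?_⟩
    · intro a b x i j
      obtain ⟨i, rfl⟩ := (e b).surjective i
      obtain ⟨j, rfl⟩ := (e a).surjective j
      exact h.continuous x i j
    · intro a b x i j
      obtain ⟨i, rfl⟩ := (e b).surjective i
      obtain ⟨j, rfl⟩ := (e a).surjective j
      exact h.bounded x i j
    · intro a b r s x y i j
      obtain ⟨i, rfl⟩ := (e b).surjective i
      obtain ⟨j, rfl⟩ := (e a).surjective j
      exact h.linear r s x y i j
    · intro a b c x y i j
      obtain ⟨i, rfl⟩ := (e c).surjective i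
      obtain ⟨j, rfl⟩ := (e a).surjective j
      refine (h.comp x y i j).congr fun p => congrArg _ ?_
      exact Equiv.sum_comp (e b) fun k => D.comp (F.map p x (e c i) k) (F.map p y k (e a j))
    · intro a b x i j
      obtain ⟨i, rfl⟩ := (e a).surjective i
      obtain ⟨j, rfl⟩ := (e b).surjective j
      exact h.star x i j
    · intro a b x i j
      obtain ⟨i, rfl⟩ := (e b).surjective i
      obtain ⟨j, rfl⟩ := (e a).surjective j
      exact h.grade x i j
  · intro h
    refine ⟨fun x i j => h.continuous x _ _, fun x i j => h.bounded x _ _,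
      fun r s x y i j => h.linear r s x y _ _, fun {a b c} x y i j => ?_,
      fun x i j => h.star x _ _, fun x i j => h.grade x _ _⟩
    refine (h.comp x y (e c i) (e a j)).congr fun p => congrArg _ ?_
    exact (Equiv.sum_comp (e b) fun k =>
      D.comp (F.map p x (e c i) k) (F.map p y k (e a j))).symm

namespace IsAsymptotic

variable {F G : MatFam T A D.alg}

theorem comap (h : F.IsAsymptotic l) {g : T' → T} (hg : Continuous g) (hl : Tendsto g l' l) :
    (F.comap g).IsAsymptotic l' where
  continuous x i j := (h.continuous x i j).comp hg
  bounded x i j := (h.bounded x i j).imp fun _ hK p => hK (g p)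
  linear r s x y i j := (h.linear r s x y i j).comp hl
  comp x y i j := (h.comp x y i j).comp hl
  star x i j := (h.star x i j).comp hl
  grade x i j := (h.grade x i j).comp hl

theorem map_zero (h : F.IsAsymptotic l) {a b : A.Ob} (i : F.idx b) (j : F.idx a) :
    Tendsto (fun p => (F.map p (0 : A.Hom a b) i j : D.Hom (F.fam a j) (F.fam b i))) l (𝓝 0) := by
  simpa using h.linear 0 0 (0 : A.Hom a b) 0 i j

theorem map_add (h : F.IsAsymptotic l) {a b : A.Ob} (x y : A.Hom a b) (i : F.idx b)
    (j : F.idx a) : Tendsto (fun p => (F.map p (x + y) i j - F.map p x i j - F.map p y i j :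
      D.Hom (F.fam a j) (F.fam b i))) l (𝓝 0) := by
  simpa using h.linear 1 1 x y i j

theorem map_smul (h : F.IsAsymptotic l) {a b : A.Ob} (r : 𝕜) (x : A.Hom a b) (i : F.idx b)
    (j : F.idx a) : Tendsto (fun p => (F.map p (r • x) i j - r • F.map p x i j :
      D.Hom (F.fam a j) (F.fam b i))) l (𝓝 0) := by
  simpa using h.linear r 0 x 0 i j

theorem map_sum (h : F.IsAsymptotic l) {a b : A.Ob} {κ : Type} (S : Finset κ)
    (x : κ → A.Hom a b) (i : F.idx b) (j : F.idx a) :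
    Tendsto (fun p => (F.map p (∑ k ∈ S, x k) i j - ∑ k ∈ S, F.map p (x k) i j :
      D.Hom (F.fam a j) (F.fam b i))) l (𝓝 0) := by
  classical
  induction S using Finset.induction_on with
  | empty => simpa using h.map_zero i j
  | insert k S hk ih =>
    have := (h.map_add (x k) (∑ k ∈ S, x k) i j).add ih
    rw [add_zero] at this
    refine this.congr fun p => ?_
    rw [Finset.sum_insert hk, Finset.sum_insert hk]
    abel

theorem extend (h : F.IsAsymptotic l) : F.extend.IsAsymptotic l where
  continuous M i j := h.continuous (M i.1 j.1) i.2 j.2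
  bounded M i j := h.bounded (M i.1 j.1) i.2 j.2
  linear r s M N i j := h.linear r s (M i.1 j.1) (N i.1 j.1) i.2 j.2
  comp {a b c} M N i j := by
    have h1 := h.map_sum Finset.univ (fun m => A.comp (M i.1 m) (N m j.1)) i.2 j.2
    have h2 := tendsto_finsetSum Finset.univ fun m _ => h.comp (M i.1 m) (N m j.1) i.2 j.2
    have h3 := h1.add h2
    rw [Finset.sum_const_zero, add_zero] at h3
    refine h3.congr fun p => ?_
    rw [Finset.sum_sub_distrib, sub_add_sub_cancel]
    congr 1
    exact (Fintype.sum_sigma fun q : Σ m : Fin b.len, F.idx (b.fam m) =>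
      D.comp (F.map p (M i.1 q.1) i.2 q.2) (F.map p (N q.1 j.1) q.2 j.2)).symm
  star M i j := h.star (M j.1 i.1) i.2 j.2
  grade M i j := h.grade (M i.1 j.1) i.2 j.2

theorem of_extend (h : F.extend.IsAsymptotic l) : F.IsAsymptotic l := by
  let o : A.Ob → A.add.Ob := fun a => ⟨1, fun _ => a⟩
  let m : ∀ {a b : A.Ob}, A.Hom a b → A.add.Hom (o a) (o b) := fun x _ _ => x
  refine ⟨fun x i j => h.continuous (m x) ⟨0, i⟩ ⟨0, j⟩, fun x i j => h.bounded (m x) ⟨0, i⟩ ⟨0, j⟩,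
    fun r s x y i j => h.linear r s (m x) (m y) ⟨0, i⟩ ⟨0, j⟩, fun {a b c} x y i j => ?_,
    fun x i j => h.star (m x) ⟨0, i⟩ ⟨0, j⟩, fun x i j => h.grade (m x) ⟨0, i⟩ ⟨0, j⟩⟩
  refine (h.comp (m x) (m y) ⟨0, i⟩ ⟨0, j⟩).congr fun p => ?_
  have e1 : A.add.comp (m x) (m y) = m (A.comp x y) := by
    funext i j
    exact Fin.sum_univ_one fun _ : Fin 1 => A.comp x y
  rw [e1]
  congr 1
  have e2 := Fintype.sum_sigma fun q : Σ _ : Fin 1, F.idx b =>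
    (D.comp (F.map p x i q.2) (F.map p y q.2 j) : D.Hom (F.fam a j) (F.fam c i))
  rw [Fin.sum_univ_one] at e2
  exact e2

end IsAsymptotic

end MatFam

/-! ### Asymptotic functors and homotopies in terms of matrix entries -/

section UniformLimits

variable {E : Type*} [SeminormedAddCommGroup E]

theorem tendsto_norm_continuousMap_iff {K X : Type*} [TopologicalSpace K] [CompactSpace K]
    {l : Filter X} {f : X → C(K, E)} :
    Tendsto (fun t => ‖f t‖) l (𝓝 0) ↔
      Tendsto (fun p : X × K => ‖f p.1 p.2‖) (l ×ˢ ⊤) (𝓝 0) := by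
  constructor
  · intro h
    have h1 : Tendsto (fun p : X × K => ‖f p.1‖) (l ×ˢ ⊤) (𝓝 0) := h.comp tendsto_fst
    exact squeeze_zero (fun _ => norm_nonneg _) (fun p => (f p.1).norm_coe_le_norm p.2) h1
  · intro h
    rw [Metric.tendsto_nhds] at h ⊢
    intro ε hε
    filter_upwards [Filter.mem_prod_top.1 (h (ε / 2) (by positivity))] with t ht
    rw [Real.dist_eq, sub_zero, abs_of_nonneg (norm_nonneg _)]
    refine lt_of_le_of_lt ((ContinuousMap.norm_le _ (by positivity : 0 ≤ ε / 2)).2 fun u => ?_)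
      (half_lt_self hε)
    have := ht u
    simp only [Real.dist_eq, sub_zero] at this
    exact (le_abs_self _).trans this.le

theorem continuous_continuousMap_iff {K X : Type*} [TopologicalSpace K] [TopologicalSpace X]
    [LocallyCompactSpace K] {f : X → C(K, E)} :
    Continuous f ↔ Continuous fun p : X × K => f p.1 p.2 :=
  ⟨fun h => ContinuousMap.continuous_uncurry_of_continuous ⟨f, h⟩,
    fun h => ContinuousMap.continuous_of_continuous_uncurry f h⟩

end UniformLimits

variable {𝕜 : Type} [RCLike 𝕜] {A : GradedStarCategory.{u, v} 𝕜}
  {C : NormedGradedStarCategory.{u₂, v₂} 𝕜} {T : Type}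

/-- A family of maps into `C_⊕`, as a family of matrices whose entries carry the spatial norm. -/
@[reducible] def famOf (O : A.Ob → C.alg.add.Ob)
    (m : T → ∀ {a b : A.Ob}, A.Hom a b → C.alg.add.Hom (O a) (O b)) :
    MatFam T A C.spatial.alg where
  idx a := Fin (O a).len
  fam a i := C.toSpatial ((O a).fam i)
  map p _ _ x := m p x

theorem isGradedAsymptotic_iff (φ : FunctorData A C.alg.add) :
    IsGradedAsymptotic (C := C.add) φ ↔
      (famOf (C := C) φ.obj fun t => φ.map t).IsAsymptotic atTop := by
  constructor
  · intro h
    exact ⟨fun x => C.continuous_iff_entry.1 (h.continuous x),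
      fun x => C.bounded_iff_entry.1 (h.bounded x),
      fun r s x y => C.tendsto_norm_zero_iff_entry.1 (h.linear r s x y),
      fun x y => C.tendsto_norm_zero_iff_entry.1 (h.comp x y),
      fun x => C.tendsto_norm_zero_iff_entry.1 (h.star x),
      fun x => C.tendsto_norm_zero_iff_entry.1 (h.grade x)⟩
  · intro h
    exact ⟨fun x => C.continuous_iff_entry.2 (h.continuous x),
      fun x => C.bounded_iff_entry.2 (h.bounded x),
      fun r s x y => C.tendsto_norm_zero_iff_entry.2 (h.linear r s x y),
      fun x y => C.tendsto_norm_zero_iff_entry.2 (h.comp x y),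
      fun x => C.tendsto_norm_zero_iff_entry.2 (h.star x),
      fun x => C.tendsto_norm_zero_iff_entry.2 (h.grade x)⟩

theorem bounded_continuousMap_iff {E X K : Type*} [SeminormedAddCommGroup E] [TopologicalSpace K]
    [CompactSpace K] {f : X → C(K, E)} :
    (∃ R : ℝ, ∀ t, ‖f t‖ ≤ R) ↔ ∃ R : ℝ, ∀ p : X × K, ‖f p.1 p.2‖ ≤ R := by
  constructor
  · rintro ⟨R, hR⟩
    exact ⟨R, fun p => ((f p.1).norm_coe_le_norm p.2).trans (hR p.1)⟩
  · rintro ⟨R, hR⟩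
    exact ⟨max R 0, fun t => (ContinuousMap.norm_le _ (le_max_right _ _)).2 fun u =>
      (hR (t, u)).trans (le_max_left _ _)⟩

section

variable {X : Type} {l : Filter X} {a b : C.add.Ob}
  {f : X → C(unitInterval, C.add.Hom a b)}

theorem continuous_cyl_iff_entry [TopologicalSpace X] : Continuous f ↔
    ∀ i j, Continuous fun p : X × unitInterval => C.entry (f p.1 p.2) i j :=
  continuous_continuousMap_iff.trans C.continuous_iff_entry

theorem bounded_cyl_iff_entry : (∃ R : ℝ, ∀ t, ‖f t‖ ≤ R) ↔
    ∀ i j, ∃ R : ℝ, ∀ p : X × unitInterval, ‖C.entry (f p.1 p.2) i j‖ ≤ R :=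
  bounded_continuousMap_iff.trans C.bounded_iff_entry

theorem tendsto_cyl_iff_entry : Tendsto (fun t => ‖f t‖) l (𝓝 0) ↔
    ∀ i j, Tendsto (fun p : X × unitInterval => C.entry (f p.1 p.2) i j) (l ×ˢ ⊤) (𝓝 0) :=
  tendsto_norm_continuousMap_iff.trans C.tendsto_norm_zero_iff_entry

end

theorem isGradedAsymptotic_cyl_iff
    (θ : FunctorData A (C.add.cyl C.add_continuous_grade).alg) :
    IsGradedAsymptotic θ ↔ (famOf (C := C) (T := Set.Ici (1 : ℝ) × unitInterval) θ.obj
      fun p _ _ x => AddAsymp.cylEval C.add C.add_continuous_grade p.2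
        (θ.map p.1 x)).IsAsymptotic (atTop ×ˢ ⊤) := by
  let D := C.add.cyl C.add_continuous_grade
  have e0 {a b : A.Ob} (x : A.Hom a b) := continuous_cyl_iff_entry (C := C)
    (f := fun t => (θ.map t x : D.Hom (θ.obj a) (θ.obj b)))
  have e1 {a b : A.Ob} (x : A.Hom a b) := bounded_cyl_iff_entry (C := C)
    (f := fun t => (θ.map t x : D.Hom (θ.obj a) (θ.obj b)))
  have e2 {a b : A.Ob} (r s : 𝕜) (x y : A.Hom a b) := tendsto_cyl_iff_entry (C := C) (l := atTop)
    (f := fun t => (θ.map t (r • x + s • y) - r • θ.map t x - s • θ.map t y :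
      D.Hom (θ.obj a) (θ.obj b)))
  have e3 {a b c : A.Ob} (x : A.Hom b c) (y : A.Hom a b) :=
    tendsto_cyl_iff_entry (C := C) (l := atTop)
      (f := fun t => (θ.map t (A.comp x y) - D.comp (θ.map t x) (θ.map t y) :
        D.Hom (θ.obj a) (θ.obj c)))
  have e4 {a b : A.Ob} (x : A.Hom a b) := tendsto_cyl_iff_entry (C := C) (l := atTop)
    (f := fun t => (θ.map t (A.star x) - D.star (θ.map t x) : D.Hom (θ.obj b) (θ.obj a)))
  have e5 {a b : A.Ob} (x : A.Hom a b) := tendsto_cyl_iff_entry (C := C) (l := atTop)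
    (f := fun t => (D.grade (θ.map t x) - θ.map t (A.grade x) : D.Hom (θ.obj a) (θ.obj b)))
  exact ⟨fun h => ⟨fun x => (e0 x).1 (h.continuous x), fun x => (e1 x).1 (h.bounded x),
      fun r s x y => (e2 r s x y).1 (h.linear r s x y), fun x y => (e3 x y).1 (h.comp x y),
      fun x => (e4 x).1 (h.star x), fun x => (e5 x).1 (h.grade x)⟩,
    fun h => ⟨fun x => (e0 x).2 (h.continuous x), fun x => (e1 x).2 (h.bounded x),
      fun r s x y => (e2 r s x y).2 (h.linear r s x y), fun x y => (e3 x y).2 (h.comp x y),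
      fun x => (e4 x).2 (h.star x), fun x => (e5 x).2 (h.grade x)⟩⟩

theorem famOf_extend (O : A.Ob → C.alg.add.Ob)
    (m : T → ∀ {a b : A.Ob}, A.Hom a b → C.alg.add.Hom (O a) (O b)) :
    famOf (C := C) (A := A.add) (fun a => FormalSum.join ⟨a.len, fun k => O (a.fam k)⟩)
      (fun p _ _ M i j => m p (M (finSigmaFinEquiv.symm i).1 (finSigmaFinEquiv.symm j).1)
        (finSigmaFinEquiv.symm i).2 (finSigmaFinEquiv.symm j).2) =
    (famOf (C := C) O m).extend.reindex (fun a => Fin (∑ k, (O (a.fam k)).len))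
      (fun _ => finSigmaFinEquiv.symm) := rfl

theorem isGradedAsymptotic_extend_iff (φ : FunctorData A C.alg.add) :
    IsGradedAsymptotic (C := C.add) φ.extend ↔
      (famOf (C := C) φ.obj fun t => φ.map t).IsAsymptotic atTop := by
  rw [isGradedAsymptotic_iff]
  refine Iff.trans ?_ ⟨MatFam.IsAsymptotic.of_extend, MatFam.IsAsymptotic.extend⟩
  exact MatFam.isAsymptotic_reindex_iff (famOf (C := C) φ.obj fun t => φ.map t).extend _
    fun _ => finSigmaFinEquiv.symm

namespace AddAsymp

theorem isAsymptotic (φ : AddAsymp A C) :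
    (famOf (C := C) φ.data.obj fun t => φ.data.map t).IsAsymptotic atTop :=
  (isGradedAsymptotic_extend_iff φ.data).1 φ.asymptotic

/-- An asymptotic functor `A ⇢ C_⊕`, as an additive one. -/
@[reducible] def ofData (d : FunctorData A C.alg.add)
    (h : (famOf (C := C) d.obj fun t => d.map t).IsAsymptotic atTop) : AddAsymp A C :=
  ⟨d, (isGradedAsymptotic_extend_iff d).2 h⟩

/-- The functor at the point `u` of a family of maps parametrized by `[1,∞) × [0,1]`. -/
@[reducible] def slice (O : A.Ob → C.alg.add.Ob)
    (m : Set.Ici (1 : ℝ) × unitInterval → ∀ {a b : A.Ob}, A.Hom a b → C.alg.add.Hom (O a) (O b))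
    (u : unitInterval) : FunctorData A C.alg.add where
  obj := O
  map t _ _ x := m (t, u) x

/-- A path of matrices, as a morphism of `I(C_⊕)`. -/
def sliceMap {a b : C.add.Ob} (f : unitInterval → C.add.Hom a b)
    (hf : ∀ i j, Continuous fun u => C.entry (f u) i j) : C(unitInterval, C.add.Hom a b) :=
  ⟨f, C.continuous_iff_entry.2 hf⟩

/-- A homotopy may be given on `A` instead of `A_⊕`: its additive extension is a homotopy. -/
theorem Homotopic.of_slice {φ ψ : AddAsymp A C} (O : A.Ob → C.alg.add.Ob)
    (m : Set.Ici (1 : ℝ) × unitInterval → ∀ {a b : A.Ob}, A.Hom a b → C.alg.add.Hom (O a) (O b))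
    (h : (famOf (C := C) O m).IsAsymptotic (atTop ×ˢ ⊤)) (h0 : φ.data = slice O m 0)
    (h1 : ψ.data = slice O m 1) : Homotopic φ ψ := by
  have hext := (MatFam.isAsymptotic_reindex_iff _
    (fun a : A.add.Ob => Fin (∑ k, (O (a.fam k)).len)) (fun _ => finSigmaFinEquiv.symm)).2 h.extend
  rw [← famOf_extend] at hext
  let θ : FunctorData A.add (C.add.cyl C.add_continuous_grade).alg :=
    { obj := fun a => FormalSum.join ⟨a.len, fun k => O (a.fam k)⟩
      map := fun t _ _ M => sliceMap (fun u => (slice O m u).extend.map t M)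
        fun i j => (hext.continuous M i j).comp (continuous_const.prodMk continuous_id) }
  refine ⟨θ, (isGradedAsymptotic_cyl_iff θ).2 hext, ?_, ?_⟩
  · rw [h0]; rfl
  · rw [h1]; rfl

end AddAsymp

/-! ### Direct sums and rotations -/

/-- The matrix with the given four blocks, indexed by disjoint unions. -/
def fromBlocks {𝕜 : Type} [RCLike 𝕜] {C : GradedStarCategory.{u, v} 𝕜} {ι κ ι' κ' : Type}
    {s : ι → C.Ob} {t : κ → C.Ob} {s' : ι' → C.Ob} {t' : κ' → C.Ob}
    (M : Mat C s t) (N : Mat C s' t) (P : Mat C s t') (Q : Mat C s' t') :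
    Mat C (Sum.elim s s') (Sum.elim t t')
  | Sum.inl i, Sum.inl j => M i j
  | Sum.inl i, Sum.inr j => N i j
  | Sum.inr i, Sum.inl j => P i j
  | Sum.inr i, Sum.inr j => Q i j

theorem tendsto_smul_zero {𝕜 E X : Type*} [RCLike 𝕜] [SeminormedAddCommGroup E] [NormedSpace 𝕜 E]
    {l : Filter X} {f : X → E} (hf : Tendsto f l (𝓝 0)) {w : X → ℝ} {K : ℝ}
    (hw : ∀ p, |w p| ≤ K) : Tendsto (fun p => (w p : 𝕜) • f p) l (𝓝 0) := by
  have h := (tendsto_zero_iff_norm_tendsto_zero.1 hf).const_mul K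
  rw [mul_zero] at h
  refine squeeze_zero_norm (fun p => ?_) h
  rw [norm_smul, RCLike.norm_ofReal]
  exact mul_le_mul_of_nonneg_right (hw p) (norm_nonneg _)

namespace NormedGradedStarCategory

variable {𝕜 : Type} [RCLike 𝕜] (D : NormedGradedStarCategory.{u, v} 𝕜)

theorem comp_zero' {a b c : D.Ob} (x : D.Hom b c) : D.comp x (0 : D.Hom a b) = 0 :=
  D.alg.comp_zero x

theorem zero_comp' {a b c : D.Ob} (x : D.Hom a b) : D.comp (0 : D.Hom b c) x = 0 :=
  D.alg.zero_comp x

theorem star_zero' {a b : D.Ob} : D.star (0 : D.Hom a b) = 0 := D.alg.star_zero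

theorem grade_zero' {a b : D.Ob} : D.grade (0 : D.Hom a b) = 0 := D.alg.grade_zero

variable {κ : Type} [Fintype κ] {P R : D.Ob} {Q : κ → D.Ob}

theorem sum_comp_zero (f : ∀ k, D.Hom (Q k) R) : ∑ k, D.comp (f k) (0 : D.Hom P (Q k)) = 0 :=
  Finset.sum_eq_zero fun _ _ => D.comp_zero' _

theorem sum_zero_comp (f : ∀ k, D.Hom P (Q k)) : ∑ k, D.comp (0 : D.Hom (Q k) R) (f k) = 0 :=
  Finset.sum_eq_zero fun _ _ => D.zero_comp' _

end NormedGradedStarCategory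

namespace MatFam

variable {𝕜 : Type} [RCLike 𝕜] {T : Type} {A : GradedStarCategory.{u, v} 𝕜}
  {D : NormedGradedStarCategory.{u₂, v₂} 𝕜} [TopologicalSpace T] {l : Filter T}

theorem IsAsymptotic.dsum {F G : MatFam T A D.alg} (hF : F.IsAsymptotic l)
    (hG : G.IsAsymptotic l) : (F.dsum G).IsAsymptotic l where
  continuous := by
    rintro a b x (i | i) (j | j)
    exacts [hF.continuous x i j, continuous_const, continuous_const, hG.continuous x i j]
  bounded := by
    rintro a b x (i | i) (j | j)
    exacts [hF.bounded x i j, ⟨0, fun _ => (norm_zero (E := D.Hom _ _)).le⟩,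
      ⟨0, fun _ => (norm_zero (E := D.Hom _ _)).le⟩, hG.bounded x i j]
  linear := by
    have z (P Q : D.Ob) (r s : 𝕜) : (0 : D.Hom P Q) = 0 - r • 0 - s • 0 := by simp
    rintro a b r s x y (i | i) (j | j)
    exacts [hF.linear r s x y i j, tendsto_const_nhds.congr fun p => z _ _ r s,
      tendsto_const_nhds.congr fun p => z _ _ r s, hG.linear r s x y i j]
  comp := by
    rintro a b c x y (i | i) (j | j)
    · refine (hF.comp x y i j).congr fun p => ?_
      rw [Fintype.sum_sum_type]
      have h := D.sum_zero_comp (P := F.fam a j) (Q := G.fam b) (R := F.fam c i) fun k => 0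
      exact congrArg _ ((congrArg _ h).trans (add_zero _)).symm
    · refine tendsto_const_nhds.congr fun p => ?_
      rw [Fintype.sum_sum_type]
      have h := D.sum_comp_zero (P := G.fam a j) (R := F.fam c i) fun k => F.map p x i k
      have h' := D.sum_zero_comp (P := G.fam a j) (R := F.fam c i) fun k => G.map p y k j
      exact ((congrArg (fun z => 0 - z) ((congrArg₂ (· + ·) h h').trans (add_zero _))).trans
        (sub_zero _)).symm
    · refine tendsto_const_nhds.congr fun p => ?_
      rw [Fintype.sum_sum_type]
      have h := D.sum_zero_comp (P := F.fam a j) (R := G.fam c i) fun k => F.map p y k j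
      have h' := D.sum_comp_zero (P := F.fam a j) (R := G.fam c i) fun k => G.map p x i k
      exact ((congrArg (fun z => 0 - z) ((congrArg₂ (· + ·) h h').trans (add_zero _))).trans
        (sub_zero _)).symm
    · refine (hG.comp x y i j).congr fun p => ?_
      rw [Fintype.sum_sum_type]
      have h := D.sum_zero_comp (P := G.fam a j) (Q := F.fam b) (R := G.fam c i) fun k => 0
      exact congrArg _ ((congrArg (fun z => z + _) h).trans (zero_add _)).symm
  star := by
    have z (P Q : D.Ob) : (0 : D.Hom P Q) = 0 - D.star 0 := by rw [D.star_zero', sub_zero]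
    rintro a b x (i | i) (j | j)
    exacts [hF.star x i j, tendsto_const_nhds.congr fun p => z _ _,
      tendsto_const_nhds.congr fun p => z _ _, hG.star x i j]
  grade := by
    have z (P Q : D.Ob) : (0 : D.Hom P Q) = D.grade 0 - 0 := by rw [D.grade_zero', sub_zero]
    rintro a b x (i | i) (j | j)
    exacts [hF.grade x i j, tendsto_const_nhds.congr fun p => z _ _,
      tendsto_const_nhds.congr fun p => z _ _, hG.grade x i j]

/-- The conjugate `V F V*` of `F` by the isometry `V = (c, s e)` from the family `F a` to the direct
sum of `F a` and the renumbered family `e* F a`; here `c² + s² = 1`. -/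
@[reducible] def rotate {D : GradedStarCategory.{u₂, v₂} 𝕜} (F : MatFam T A D)
    (ι : A.Ob → Type) [∀ a, Fintype (ι a)] (e : ∀ a, ι a ≃ F.idx a) (c s : T → ℝ) :
    MatFam T A D where
  idx a := F.idx a ⊕ ι a
  fam a := Sum.elim (F.fam a) (fun i => F.fam a (e a i))
  map p a b x := fromBlocks
    (fun i j => ((c p * c p : ℝ) : 𝕜) • F.map p x i j)
    (fun i j => ((c p * s p : ℝ) : 𝕜) • F.map p x i (e a j))
    (fun i j => ((s p * c p : ℝ) : 𝕜) • F.map p x (e b i) j)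
    (fun i j => ((s p * s p : ℝ) : 𝕜) • F.map p x (e b i) (e a j))

theorem IsAsymptotic.rotate {F : MatFam T A D.alg} (h : F.IsAsymptotic l)
    (ι : A.Ob → Type) [∀ a, Fintype (ι a)] (e : ∀ a, ι a ≃ F.idx a) {c s : T → ℝ}
    (hc : Continuous c) (hs : Continuous s) (hcs : ∀ p, c p * c p + s p * s p = 1) :
    (F.rotate ι e c s).IsAsymptotic l := by
  have bc : ∀ p, |c p| ≤ 1 := fun p => abs_le_one_iff_mul_self_le_one.2
    (by nlinarith [hcs p, mul_self_nonneg (s p)])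
  have bs : ∀ p, |s p| ≤ 1 := fun p => abs_le_one_iff_mul_self_le_one.2
    (by nlinarith [hcs p, mul_self_nonneg (c p)])
  have bm {v w : T → ℝ} (hv : ∀ p, |v p| ≤ 1) (hw : ∀ p, |w p| ≤ 1) : ∀ p, |v p * w p| ≤ 1 :=
    fun p => by rw [abs_mul]; exact mul_le_one₀ (hv p) (abs_nonneg _) (hw p)
  have K0 {v w : T → ℝ} (hv : Continuous v) (hw : Continuous w) {a b : A.Ob} (x : A.Hom a b)
      (i : F.idx b) (j : F.idx a) : Continuous fun p =>
        (((v p * w p : ℝ) : 𝕜) • F.map p x i j : D.Hom (F.fam a j) (F.fam b i)) :=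
    (RCLike.continuous_ofReal.comp (hv.mul hw)).smul (h.continuous x i j)
  have K1 {v w : T → ℝ} (hv : ∀ p, |v p| ≤ 1) (hw : ∀ p, |w p| ≤ 1) {a b : A.Ob} (x : A.Hom a b)
      (i : F.idx b) (j : F.idx a) : ∃ K : ℝ, ∀ p,
        ‖(((v p * w p : ℝ) : 𝕜) • F.map p x i j : D.Hom (F.fam a j) (F.fam b i))‖ ≤ K := by
    obtain ⟨K, hK⟩ := h.bounded x i j
    refine ⟨K, fun p => ?_⟩
    rw [norm_smul, RCLike.norm_ofReal]
    exact (mul_le_of_le_one_left (norm_nonneg _) (bm hv hw p)).trans (hK p)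
  have K2 {v w : T → ℝ} (hv : ∀ p, |v p| ≤ 1) (hw : ∀ p, |w p| ≤ 1) {a b : A.Ob} (r r' : 𝕜)
      (x y : A.Hom a b) (i : F.idx b) (j : F.idx a) : Tendsto (fun p =>
        (((v p * w p : ℝ) : 𝕜) • F.map p (r • x + r' • y) i j
          - r • ((v p * w p : ℝ) : 𝕜) • F.map p x i j
          - r' • ((v p * w p : ℝ) : 𝕜) • F.map p y i j : D.Hom (F.fam a j) (F.fam b i)))
        l (𝓝 0) := by
    refine (tendsto_smul_zero (𝕜 := 𝕜) (h.linear r r' x y i j) (bm hv hw)).congr fun p => ?_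
    rw [smul_sub, smul_sub, smul_comm _ r, smul_comm _ r']
  have K3 {v w : T → ℝ} (hv : ∀ p, |v p| ≤ 1) (hw : ∀ p, |w p| ≤ 1) {a b b' : A.Ob}
      (x : A.Hom b b') (y : A.Hom a b) (i : F.idx b') (j : F.idx a) : Tendsto (fun p =>
        (((v p * w p : ℝ) : 𝕜) • F.map p (A.comp x y) i j -
          (∑ k, D.comp (((v p * c p : ℝ) : 𝕜) • F.map p x i k)
              (((c p * w p : ℝ) : 𝕜) • F.map p y k j) +
            ∑ k, D.comp (((v p * s p : ℝ) : 𝕜) • F.map p x i (e b k))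
              (((s p * w p : ℝ) : 𝕜) • F.map p y (e b k) j)) :
          D.Hom (F.fam a j) (F.fam b' i))) l (𝓝 0) := by
    refine (tendsto_smul_zero (𝕜 := 𝕜) (h.comp x y i j) (bm hv hw)).congr fun p => ?_
    have e1 : ∑ k, (D.comp (((v p * s p : ℝ) : 𝕜) • F.map p x i (e b k))
        (((s p * w p : ℝ) : 𝕜) • F.map p y (e b k) j) : D.Hom (F.fam a j) (F.fam b' i)) =
        ∑ k, D.comp (((v p * s p : ℝ) : 𝕜) • F.map p x i k)
        (((s p * w p : ℝ) : 𝕜) • F.map p y k j) :=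
      Equiv.sum_comp (e b) fun k => D.comp (((v p * s p : ℝ) : 𝕜) • F.map p x i k)
        (((s p * w p : ℝ) : 𝕜) • F.map p y k j)
    rw [e1]
    simp only [D.laws.smul_comp, D.laws.comp_smul, smul_smul, ← Finset.smul_sum]
    rw [smul_sub, ← add_smul, ← RCLike.ofReal_mul, ← RCLike.ofReal_mul, ← RCLike.ofReal_add]
    congr 4
    linear_combination (- v p * w p) * hcs p
  have K4 {v w : T → ℝ} (hv : ∀ p, |v p| ≤ 1) (hw : ∀ p, |w p| ≤ 1) {a b : A.Ob} (x : A.Hom a b)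
      (i : F.idx a) (j : F.idx b) : Tendsto (fun p =>
        (((v p * w p : ℝ) : 𝕜) • F.map p (A.star x) i j
          - D.star (((w p * v p : ℝ) : 𝕜) • F.map p x j i) :
          D.Hom (F.fam b j) (F.fam a i))) l (𝓝 0) := by
    refine (tendsto_smul_zero (𝕜 := 𝕜) (h.star x i j) (bm hv hw)).congr fun p => ?_
    rw [D.laws.star_smul, RCLike.conj_ofReal, mul_comm (w p), smul_sub]
  have K5 {v w : T → ℝ} (hv : ∀ p, |v p| ≤ 1) (hw : ∀ p, |w p| ≤ 1) {a b : A.Ob} (x : A.Hom a b)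
      (i : F.idx b) (j : F.idx a) : Tendsto (fun p =>
        (D.grade (((v p * w p : ℝ) : 𝕜) • F.map p x i j)
          - ((v p * w p : ℝ) : 𝕜) • F.map p (A.grade x) i j :
          D.Hom (F.fam a j) (F.fam b i))) l (𝓝 0) := by
    refine (tendsto_smul_zero (𝕜 := 𝕜) (h.grade x i j) (bm hv hw)).congr fun p => ?_
    rw [D.laws.grade_smul, smul_sub]
  refine ⟨?_, ?_, ?_, ?_, ?_, ?_⟩
  · rintro a b x (i | i) (j | j)
    exacts [K0 hc hc x i j, K0 hc hs x i _, K0 hs hc x _ j, K0 hs hs x _ _]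
  · rintro a b x (i | i) (j | j)
    exacts [K1 bc bc x i j, K1 bc bs x i _, K1 bs bc x _ j, K1 bs bs x _ _]
  · rintro a b r r' x y (i | i) (j | j)
    exacts [K2 bc bc r r' x y i j, K2 bc bs r r' x y i _, K2 bs bc r r' x y _ j,
      K2 bs bs r r' x y _ _]
  · rintro a b b' x y (i | i) (j | j)
    · refine (K3 bc bc x y i j).congr fun p => ?_
      rw [Fintype.sum_sum_type]; rfl
    · refine (K3 bc bs x y i (e a j)).congr fun p => ?_
      rw [Fintype.sum_sum_type]; rfl
    · refine (K3 bs bc x y (e b' i) j).congr fun p => ?_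
      rw [Fintype.sum_sum_type]; rfl
    · refine (K3 bs bs x y (e b' i) (e a j)).congr fun p => ?_
      rw [Fintype.sum_sum_type]; rfl
  · rintro a b x (i | i) (j | j)
    exacts [K4 bc bc x i j, K4 bc bs x i _, K4 bs bc x _ j, K4 bs bs x _ _]
  · rintro a b x (i | i) (j | j)
    exacts [K5 bc bc x i j, K5 bc bs x i _, K5 bs bc x _ j, K5 bs bs x _ _]

end MatFam

/-! ### Renumbering of summands, and the sum of classes -/

variable {𝕜 : Type} [RCLike 𝕜] {A : GradedStarCategory.{u, v} 𝕜}
  {C : NormedGradedStarCategory.{u₂, v₂} 𝕜} {T : Type}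

theorem MatFam.isAsymptotic_of_map_eq_zero {D : NormedGradedStarCategory.{u₂, v₂} 𝕜}
    [TopologicalSpace T] {l : Filter T} {F : MatFam T A D.alg}
    (h : ∀ p {a b : A.Ob} (x : A.Hom a b) i j,
      (F.map p x i j : D.Hom (F.fam a j) (F.fam b i)) = 0) : F.IsAsymptotic l where
  continuous x i j := by simp only [h]; exact continuous_const
  bounded x i j := ⟨0, fun p => by rw [h, norm_zero]⟩
  linear r s x y i j := tendsto_const_nhds.congr fun p => by simp [h]
  comp x y i j := tendsto_const_nhds.congr fun p => by simp [h, D.comp_zero']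
  star x i j := tendsto_const_nhds.congr fun p => by simp [h, D.star_zero']
  grade x i j := tendsto_const_nhds.congr fun p => by simp [h, D.grade_zero']

theorem isAsymptotic_famOf_dsum [TopologicalSpace T] {l : Filter T} {O O' : A.Ob → C.alg.add.Ob}
    {m : T → ∀ {a b : A.Ob}, A.Hom a b → C.alg.add.Hom (O a) (O b)}
    {m' : T → ∀ {a b : A.Ob}, A.Hom a b → C.alg.add.Hom (O' a) (O' b)}
    (h : (famOf (C := C) O m).IsAsymptotic l) (h' : (famOf (C := C) O' m').IsAsymptotic l) :
    (famOf (C := C) (fun a => (O a).append (O' a)) fun p _ _ x i j =>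
      blockSum (m p x) (m' p x) (finSumFinEquiv.symm i) (finSumFinEquiv.symm j)).IsAsymptotic l :=
  (MatFam.isAsymptotic_reindex_iff ((famOf (C := C) O m).dsum (famOf (C := C) O' m'))
    (fun a => Fin ((O a).len + (O' a).len))
    (fun a => (finSumFinEquiv (m := (O a).len) (n := (O' a).len)).symm)).2 (h.dsum h')

namespace FunctorData

theorem ext_map {C : GradedStarCategory.{u₂, v₂} 𝕜} {O : A.Ob → C.Ob}
    {m m' : Set.Ici (1 : ℝ) → ∀ {a b : A.Ob}, A.Hom a b → C.Hom (O a) (O b)}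
    (h : ∀ t {a b : A.Ob} (x : A.Hom a b), m t x = m' t x) :
    FunctorData.mk O m = FunctorData.mk O m' := by
  congr
  funext t a b x
  exact h t x

variable {C : GradedStarCategory.{u₂, v₂} 𝕜}

/-- `d` with its summands renumbered by the bijections `e a`. -/
@[reducible] def reindex (d : FunctorData A C.add) (n : A.Ob → ℕ)
    (e : ∀ a, Fin (n a) ≃ Fin (d.obj a).len) : FunctorData A C.add where
  obj a := ⟨n a, fun i => (d.obj a).fam (e a i)⟩
  map t a b x := fun i j => d.map t x (e b i) (e a j)

/-- The restriction to the one-term sequences. -/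
@[reducible] def single (d : FunctorData A.add C) : FunctorData A C where
  obj a := d.obj ⟨1, fun _ => a⟩
  map t a b x := d.map t (a := ⟨1, fun _ => a⟩) (b := ⟨1, fun _ => b⟩) fun _ _ => x

end FunctorData

namespace MatFam

variable {C : GradedStarCategory.{u₂, v₂} 𝕜} {F F' F'' G G' : MatFam T A C}

/-- `F` and `G` differ by a renumbering of rows and columns. The entries of the matrices live in
morphism spaces that are only propositionally equal, hence the `HEq`. -/
def Equivalent (F G : MatFam T A C) : Prop :=
  ∃ e : ∀ a, F.idx a ≃ G.idx a, (∀ a i, F.fam a i = G.fam a (e a i)) ∧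
    ∀ p {a b : A.Ob} (x : A.Hom a b) i j, HEq (F.map p x i j) (G.map p x (e b i) (e a j))

theorem Equivalent.refl (F : MatFam T A C) : F.Equivalent F :=
  ⟨fun _ => Equiv.refl _, fun _ _ => rfl, fun _ _ _ _ _ _ => HEq.rfl⟩

theorem Equivalent.symm (h : F.Equivalent G) : G.Equivalent F := by
  obtain ⟨e, h1, h2⟩ := h
  refine ⟨fun a => (e a).symm, fun a i => ?_, fun p a b x i j => ?_⟩
  · obtain ⟨i, rfl⟩ := (e a).surjective i
    rw [h1, Equiv.symm_apply_apply]
  · obtain ⟨i, rfl⟩ := (e b).surjective i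
    obtain ⟨j, rfl⟩ := (e a).surjective j
    rw [Equiv.symm_apply_apply, Equiv.symm_apply_apply]
    exact (h2 p x i j).symm

theorem Equivalent.trans (h : F.Equivalent F') (h' : F'.Equivalent F'') : F.Equivalent F'' := by
  obtain ⟨e, h1, h2⟩ := h
  obtain ⟨e', h1', h2'⟩ := h'
  exact ⟨fun a => (e a).trans (e' a), fun a i => (h1 a i).trans (h1' a _),
    fun p a b x i j => (h2 p x i j).trans (h2' p x _ _)⟩

theorem equivalent_reindex (F : MatFam T A C) (ι : A.Ob → Type) [∀ a, Fintype (ι a)]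
    (e : ∀ a, ι a ≃ F.idx a) : (F.reindex ι e).Equivalent F :=
  ⟨e, fun _ _ => rfl, fun _ _ _ _ _ _ => HEq.rfl⟩

theorem zero_heq {a b a' b' : C.Ob} (ha : a = a') (hb : b = b') :
    HEq (0 : C.Hom a b) (0 : C.Hom a' b') := by
  subst ha; subst hb; rfl

theorem Equivalent.dsum (h : F.Equivalent F') (h' : G.Equivalent G') :
    (F.dsum G).Equivalent (F'.dsum G') := by
  obtain ⟨e, h1, h2⟩ := h
  obtain ⟨e', h1', h2'⟩ := h'
  refine ⟨fun a => Equiv.sumCongr (e a) (e' a), ?_, ?_⟩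
  · rintro a (i | i)
    exacts [h1 a i, h1' a i]
  · rintro p a b x (i | i) (j | j)
    exacts [h2 p x i j, zero_heq (h1' a j) (h1 b i), zero_heq (h1 a j) (h1' b i), h2' p x i j]

theorem dsum_comm (F G : MatFam T A C) : (F.dsum G).Equivalent (G.dsum F) := by
  refine ⟨fun a => Equiv.sumComm _ _, ?_, ?_⟩
  · rintro a (i | i) <;> rfl
  · rintro p a b x (i | i) (j | j) <;> exact HEq.rfl

theorem dsum_assoc (F F' F'' : MatFam T A C) :
    ((F.dsum F').dsum F'').Equivalent (F.dsum (F'.dsum F'')) := by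
  refine ⟨fun a => Equiv.sumAssoc _ _ _, ?_, ?_⟩
  · rintro a ((i | i) | i) <;> rfl
  · rintro p a b x ((i | i) | i) ((j | j) | j) <;> exact HEq.rfl

/-- The restriction to the one-term sequences. -/
@[reducible] def single (F : MatFam T A.add C) : MatFam T A C where
  idx a := F.idx ⟨1, fun _ => a⟩
  fam a := F.fam ⟨1, fun _ => a⟩
  map p a b x := F.map p (a := ⟨1, fun _ => a⟩) (b := ⟨1, fun _ => b⟩) fun _ _ => x

theorem IsAsymptotic.single {D : NormedGradedStarCategory.{u₂, v₂} 𝕜} [TopologicalSpace T]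
    {l : Filter T} {F : MatFam T A.add D.alg} (h : F.IsAsymptotic l) :
    F.single.IsAsymptotic l := by
  let o : A.Ob → A.add.Ob := fun a => ⟨1, fun _ => a⟩
  let m : ∀ {a b : A.Ob}, A.Hom a b → A.add.Hom (o a) (o b) := fun x _ _ => x
  refine ⟨fun {a b} x i j => h.continuous (a := o a) (b := o b) (m x) i j,
    fun {a b} x i j => h.bounded (a := o a) (b := o b) (m x) i j,
    fun {a b} r s x y i j => h.linear (a := o a) (b := o b) r s (m x) (m y) i j,
    fun {a b c} x y i j => ?_,
    fun {a b} x i j => h.star (a := o a) (b := o b) (m x) i j,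
    fun {a b} x i j => h.grade (a := o a) (b := o b) (m x) i j⟩
  have e : A.add.comp (m x) (m y) = m (A.comp x y) := by
    funext i j
    exact Fin.sum_univ_one fun _ : Fin 1 => A.comp x y
  have := h.comp (a := o a) (b := o b) (c := o c) (m x) (m y) i j
  rw [e] at this
  exact this

end MatFam

namespace AddAsymp

/-- `φ` as a family of matrices. -/
@[reducible] def toMatFam (φ : AddAsymp A C) : MatFam (Set.Ici (1 : ℝ)) A C.spatial.alg :=
  famOf (C := C) φ.data.obj fun t => φ.data.map t

theorem exists_eq_of_equivalent {φ ψ : AddAsymp A C} (h : ψ.toMatFam.Equivalent φ.toMatFam) :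
    ∃ (n : A.Ob → ℕ) (e : ∀ a, Fin (n a) ≃ Fin (φ.data.obj a).len),
      ψ.data = φ.data.reindex n e := by
  obtain ⟨e, h1, h2⟩ := h
  obtain ⟨⟨O, m⟩, hψ⟩ := ψ
  obtain ⟨n, F, rfl⟩ : ∃ (n : A.Ob → ℕ) (F : ∀ a, Fin (n a) → C.Ob), O = fun a => ⟨n a, F a⟩ :=
    ⟨fun a => (O a).len, fun a => (O a).fam, rfl⟩
  change ∀ a, Fin (n a) ≃ Fin (φ.data.obj a).len at e
  obtain rfl : F = fun a i => (φ.data.obj a).fam (e a i) :=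
    funext fun a => funext fun i => h1 a i
  refine ⟨n, e, FunctorData.ext_map fun t a b x => ?_⟩
  funext i j
  exact eq_of_heq (h2 t x i j)

/-- The direct sum of additive asymptotic functors. -/
@[reducible] def dsum (φ ψ : AddAsymp A C) : AddAsymp A C :=
  ofData (φ.data.dsum ψ.data) (isAsymptotic_famOf_dsum φ.isAsymptotic ψ.isAsymptotic)

/-- The null functor with object map `Φ`. -/
@[reducible] def null (Φ : A.Ob → C.alg.add.Ob) : AddAsymp A C :=
  ofData (FunctorData.null Φ) (MatFam.isAsymptotic_of_map_eq_zero fun _ _ _ _ _ _ => rfl)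

theorem ext {φ ψ : AddAsymp A C} (h : φ.data = ψ.data) : φ = ψ := by
  cases φ; cases ψ; cases h; rfl

theorem toClass_dsum_null (φ : AddAsymp A C) (Φ : A.Ob → C.alg.add.Ob) :
    (φ.dsum (null Φ)).toClass = φ.toClass :=
  (Quot.sound (show Rel φ (φ.dsum (null Φ)) from Or.inr ⟨Φ, Or.inl rfl⟩)).symm

theorem toClass_null_dsum (φ : AddAsymp A C) (Φ : A.Ob → C.alg.add.Ob) :
    ((null Φ).dsum φ).toClass = φ.toClass :=
  (Quot.sound (show Rel φ ((null Φ).dsum φ) from Or.inr ⟨Φ, Or.inr rfl⟩)).symm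

/-- The rotation `φ ⊕ 0 ≃ 0 ⊕ ψ`, where `ψ` is `φ` with its summands renumbered. -/
theorem homotopic_rotate (φ ψ : AddAsymp A C) (n : A.Ob → ℕ)
    (e : ∀ a, Fin (n a) ≃ Fin (φ.data.obj a).len) (hψ : ψ.data = φ.data.reindex n e) :
    Homotopic (φ.dsum (null ψ.data.obj)) ((null φ.data.obj).dsum ψ) := by
  have hφ : ((famOf (C := C) φ.data.obj fun t => φ.data.map t).comap
      (Prod.fst : Set.Ici (1 : ℝ) × unitInterval → _)).IsAsymptotic (atTop ×ˢ ⊤) :=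
    φ.isAsymptotic.comap continuous_fst tendsto_fst
  have hrot := hφ.rotate (fun a => Fin (n a)) e
    (c := fun p => Real.sqrt (1 - p.2)) (s := fun p => Real.sqrt p.2)
    (by fun_prop) (by fun_prop) (fun p => by
      rw [Real.mul_self_sqrt (sub_nonneg.2 p.2.2.2), Real.mul_self_sqrt p.2.2.1]; ring)
  have hre := (MatFam.isAsymptotic_reindex_iff _
    (fun a : A.Ob => Fin ((φ.data.obj a).len + n a)) fun _ => finSumFinEquiv.symm).2 hrot
  refine Homotopic.of_slice (C := C)
    (fun a => (φ.data.obj a).append ⟨n a, fun i => (φ.data.obj a).fam (e a i)⟩)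
    (fun p a b x => fun i j => fromBlocks
      (fun i j => ((Real.sqrt (1 - p.2) * Real.sqrt (1 - p.2) : ℝ) : 𝕜) • φ.data.map p.1 x i j)
      (fun i j => ((Real.sqrt (1 - p.2) * Real.sqrt p.2 : ℝ) : 𝕜) • φ.data.map p.1 x i (e a j))
      (fun i j => ((Real.sqrt p.2 * Real.sqrt (1 - p.2) : ℝ) : 𝕜) • φ.data.map p.1 x (e b i) j)
      (fun i j => ((Real.sqrt p.2 * Real.sqrt p.2 : ℝ) : 𝕜) • φ.data.map p.1 x (e b i) (e a j))
      (finSumFinEquiv.symm i) (finSumFinEquiv.symm j)) hre ?_ ?_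
  · change φ.data.dsum (FunctorData.null ψ.data.obj) = _
    rw [hψ]
    refine FunctorData.ext_map fun t a b x => ?_
    funext i j
    change blockSum _ _ (finSumFinEquiv.symm i) (finSumFinEquiv.symm j) =
      fromBlocks _ _ _ _ (finSumFinEquiv.symm i) (finSumFinEquiv.symm j)
    generalize finSumFinEquiv.symm i = i'
    generalize finSumFinEquiv.symm j = j'
    rcases i' with i' | i' <;> rcases j' with j' | j' <;> simp [blockSum, fromBlocks] <;> rfl
  · change (FunctorData.null φ.data.obj).dsum ψ.data = _
    rw [hψ]
    refine FunctorData.ext_map fun t a b x => ?_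
    funext i j
    change blockSum _ _ (finSumFinEquiv.symm i) (finSumFinEquiv.symm j) =
      fromBlocks _ _ _ _ (finSumFinEquiv.symm i) (finSumFinEquiv.symm j)
    generalize finSumFinEquiv.symm i = i'
    generalize finSumFinEquiv.symm j = j'
    rcases i' with i' | i' <;> rcases j' with j' | j' <;> simp [blockSum, fromBlocks] <;> rfl

/-- Renumbering the summands of the objects `φ(a)` does not change the class. -/
theorem toClass_eq_of_equivalent {φ ψ : AddAsymp A C} (h : ψ.toMatFam.Equivalent φ.toMatFam) :
    φ.toClass = ψ.toClass := by
  obtain ⟨n, e, hψ⟩ := exists_eq_of_equivalent h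
  calc φ.toClass = (φ.dsum (null ψ.data.obj)).toClass := (toClass_dsum_null _ _).symm
    _ = ((null φ.data.obj).dsum ψ).toClass := Quot.sound (Or.inl (homotopic_rotate φ ψ n e hψ))
    _ = ψ.toClass := toClass_null_dsum _ _

theorem toMatFam_dsum (φ ψ : AddAsymp A C) :
    (φ.dsum ψ).toMatFam.Equivalent (φ.toMatFam.dsum ψ.toMatFam) :=
  MatFam.equivalent_reindex (φ.toMatFam.dsum ψ.toMatFam)
    (fun a => Fin ((φ.data.obj a).len + (ψ.data.obj a).len)) fun _ => finSumFinEquiv.symm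

theorem toClass_dsum_comm (φ ψ : AddAsymp A C) : (φ.dsum ψ).toClass = (ψ.dsum φ).toClass :=
  toClass_eq_of_equivalent
    ((toMatFam_dsum ψ φ).trans ((MatFam.dsum_comm _ _).trans (toMatFam_dsum φ ψ).symm))

theorem toClass_dsum_assoc (φ ψ χ : AddAsymp A C) :
    ((φ.dsum ψ).dsum χ).toClass = (φ.dsum (ψ.dsum χ)).toClass := by
  refine toClass_eq_of_equivalent ?_
  have h1 := (toMatFam_dsum (φ.dsum ψ) χ).trans
    ((toMatFam_dsum φ ψ).dsum (MatFam.Equivalent.refl χ.toMatFam))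
  have h2 := (toMatFam_dsum φ (ψ.dsum χ)).trans
    ((MatFam.Equivalent.refl φ.toMatFam).dsum (toMatFam_dsum ψ χ))
  exact h2.trans ((MatFam.dsum_assoc _ _ _).symm.trans h1.symm)

/-- The restriction of an additive functor to the one-term sequences agrees with the original one up
to a renumbering of the summands. -/
theorem equivalent_single (φ ψ : AddAsymp A C) (h : ψ.data = φ.data.extend.single) :
    ψ.toMatFam.Equivalent φ.toMatFam := by
  obtain ⟨d, hd⟩ := ψ
  change d = _ at h
  subst h
  exact ⟨fun a => (finSigmaFinEquiv (n := fun _ : Fin 1 => (φ.data.obj a).len)).symm.trans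
    ⟨fun q => q.2, fun i => ⟨0, i⟩, fun q => Sigma.ext (Subsingleton.elim _ _) HEq.rfl,
      fun _ => rfl⟩, fun _ _ => rfl, fun _ _ _ _ _ _ => HEq.rfl⟩

/-- A homotopy need not be additive. It is replaced by the additive extension of its restriction to
the one-term sequences, to which a constant homotopy can be added. -/
theorem toClass_dsum_congr_of_homotopic {φ φ' : AddAsymp A C} (h : Homotopic φ φ')
    (ψ : AddAsymp A C) : (φ.dsum ψ).toClass = (φ'.dsum ψ).toClass := by
  obtain ⟨θ, hθ, h0, h1⟩ := h
  have hs := ((isGradedAsymptotic_cyl_iff θ).1 hθ).single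
  have hα (u : unitInterval) := hs.comap (l' := atTop) (g := fun t : Set.Ici (1 : ℝ) => (t, u))
    (by fun_prop) (tendsto_id.prodMk tendsto_top)
  let α (u : unitInterval) : AddAsymp A C := ofData (evalAt θ u).single (hα u)
  have hψ := ψ.isAsymptotic.comap (l' := atTop ×ˢ ⊤)
    (g := (Prod.fst : Set.Ici (1 : ℝ) × unitInterval → _)) continuous_fst tendsto_fst
  have e0 : (φ.dsum ψ).toClass = ((α 0).dsum ψ).toClass := by
    refine toClass_eq_of_equivalent ((toMatFam_dsum _ _).trans
      (((equivalent_single φ (α 0) ?_).dsum (.refl _)).trans (toMatFam_dsum _ _).symm))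
    rw [← h0]
  have e1 : (φ'.dsum ψ).toClass = ((α 1).dsum ψ).toClass := by
    refine toClass_eq_of_equivalent ((toMatFam_dsum _ _).trans
      (((equivalent_single φ' (α 1) ?_).dsum (.refl _)).trans (toMatFam_dsum _ _).symm))
    rw [← h1]
  rw [e0, e1]
  exact Quot.sound (Or.inl (Homotopic.of_slice (C := C) _ _ (isAsymptotic_famOf_dsum hs hψ)
    rfl rfl))

theorem toClass_dsum_congr_left {φ φ' : AddAsymp A C} (h : Rel φ φ') (ψ : AddAsymp A C) :
    (φ.dsum ψ).toClass = (φ'.dsum ψ).toClass := by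
  rcases h with h | ⟨Φ, h | h⟩
  · exact toClass_dsum_congr_of_homotopic h ψ
  · obtain rfl : φ' = φ.dsum (null Φ) := ext h
    rw [toClass_dsum_assoc, toClass_dsum_comm φ (dsum _ _), toClass_dsum_assoc, toClass_null_dsum,
      toClass_dsum_comm]
  · obtain rfl : φ' = (null Φ).dsum φ := ext h
    rw [toClass_dsum_assoc, toClass_null_dsum]

theorem toClass_dsum_congr_right {φ φ' : AddAsymp A C} (h : Rel φ φ') (ψ : AddAsymp A C) :
    (ψ.dsum φ).toClass = (ψ.dsum φ').toClass := by
  rw [toClass_dsum_comm ψ, toClass_dsum_comm ψ, toClass_dsum_congr_left h]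

theorem toClass_null (Φ : A.Ob → C.alg.add.Ob) :
    (null Φ : AddAsymp A C).toClass = (null fun _ => ⟨0, Fin.elim0⟩ : AddAsymp A C).toClass := by
  rw [← toClass_dsum_null (null Φ) fun _ => ⟨0, Fin.elim0⟩, toClass_null_dsum]

end AddAsymp

/-! ### Lifting continuous paths along asymptotically linear maps -/

section Lifting

variable {E D K X : Type*} [SeminormedAddCommGroup E] [SeminormedAddCommGroup D]

theorem eventually_prod_top_of_forall_nhds [TopologicalSpace K] [CompactSpace K] {l : Filter X}
    {P : X × K → Prop} (h : ∀ u, ∀ᶠ q in l ×ˢ 𝓝 u, P q) : ∀ᶠ q in l ×ˢ ⊤, P q := by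
  have := isCompact_univ.mem_prod_nhdsSet_of_forall (s := {q | P q}) fun u _ => h u
  rwa [nhdsSet_univ] at this

theorem tendsto_prod_top_of_forall_nhds [TopologicalSpace K] [CompactSpace K] {l : Filter X}
    {Y : Type*} {f : X × K → Y} {l' : Filter Y} (h : ∀ u, Tendsto f (l ×ˢ 𝓝 u) l') :
    Tendsto f (l ×ˢ ⊤) l' :=
  fun _ hs => eventually_prod_top_of_forall_nhds fun u => h u hs

theorem exists_bernstein_near (𝕜 : Type) [RCLike 𝕜] [NormedSpace 𝕜 E] (f : C(unitInterval, E))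
    {ε : ℝ} (hε : 0 < ε) :
    ∃ n : ℕ, ∀ u, ‖∑ k : Fin (n + 1), ((bernstein n k u : ℝ) : 𝕜) • f (bernstein.z k) - f u‖ ≤ ε := by
  let : NormedSpace ℝ E := NormedSpace.restrictScalars ℝ 𝕜 E
  obtain ⟨n, hn⟩ := ((Metric.tendsto_nhds.1 (bernsteinApproximation_uniform f)) ε hε).exists
  refine ⟨n, fun u => ?_⟩
  have h1 := (ContinuousMap.dist_apply_le_dist u).trans hn.le
  rw [dist_eq_norm, bernsteinApproximation.apply] at h1
  refine le_of_eq_of_le ?_ h1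
  congr 2

/-- The ramp function with value `0` for `t ≤ a` and `1` for `t ≥ a + 1`. -/
def ramp (a t : ℝ) : ℝ := max 0 (min 1 (t - a))

theorem ramp_nonneg (a t : ℝ) : 0 ≤ ramp a t := le_max_left _ _

theorem ramp_le_one (a t : ℝ) : ramp a t ≤ 1 := max_le zero_le_one (min_le_left _ _)

theorem ramp_eq_zero {a t : ℝ} (h : t ≤ a) : ramp a t = 0 :=
  max_eq_left ((min_le_right _ _).trans (sub_nonpos.2 h))

theorem ramp_eq_one {a t : ℝ} (h : a + 1 ≤ t) : ramp a t = 1 := by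
  rw [ramp, min_eq_left (by linarith), max_eq_right zero_le_one]

theorem continuous_ramp (a : ℝ) : Continuous (ramp a) := by
  unfold ramp; fun_prop

theorem norm_ramp_smul_le (𝕜 : Type) [RCLike 𝕜] [NormedSpace 𝕜 D] {a t c : ℝ} (hc : 0 ≤ c) (x : D)
    (h : a ≤ t → ‖x‖ ≤ c) : ‖((ramp a t : ℝ) : 𝕜) • x‖ ≤ c := by
  rcases le_total t a with ht | ht
  · rw [ramp_eq_zero ht]; simpa using hc
  · rw [norm_smul, RCLike.norm_ofReal, abs_of_nonneg (ramp_nonneg _ _)]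
    exact (mul_le_of_le_one_left (norm_nonneg _) (ramp_le_one _ _)).trans (h ht)

/-- Functions `Φₙ` on `[1,∞) × K`, of which consecutive ones are eventually `2⁻ⁿ`-close, can be
glued to a function that is eventually close to each of them. No completeness is needed, since at
each `t` only finitely many of the differences are added. -/
theorem exists_glue (𝕜 : Type) [RCLike 𝕜] [NormedSpace 𝕜 D] [TopologicalSpace K]
    (Φ : ℕ → Set.Ici (1 : ℝ) × K → D)
    (hc : ∀ n, Continuous (Φ n)) (hb : ∃ R : ℝ, ∀ q, ‖Φ 0 q‖ ≤ R)
    (hΦ : ∀ n, ∀ᶠ q in atTop ×ˢ ⊤, ‖Φ (n + 1) q - Φ n q‖ ≤ (1 / 2 : ℝ) ^ n) :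
    ∃ Ψ : Set.Ici (1 : ℝ) × K → D, Continuous Ψ ∧ (∃ R : ℝ, ∀ q, ‖Ψ q‖ ≤ R) ∧
      ∀ N, ∀ᶠ q in atTop ×ˢ ⊤, ‖Ψ q - Φ N q‖ ≤ 2 * (1 / 2 : ℝ) ^ N := by
  have hT : ∀ n : ℕ, ∃ T : ℝ, n ≤ T ∧ ∀ q : Set.Ici (1 : ℝ) × K, T ≤ q.1 →
      ‖Φ (n + 1) q - Φ n q‖ ≤ (1 / 2 : ℝ) ^ n := by
    intro n
    obtain ⟨T, hT⟩ := eventually_atTop.1 (Filter.mem_prod_top.1 (hΦ n))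
    exact ⟨max n T, le_max_left _ _, fun q hq => hT q.1 ((le_max_right (n : ℝ) (T : ℝ)).trans hq) q.2⟩
  choose T hTn hT using hT
  let g : ℕ → Set.Ici (1 : ℝ) × K → D := fun n q =>
    ((ramp (T n) q.1 : ℝ) : 𝕜) • (Φ (n + 1) q - Φ n q)
  have hg (n q) : ‖g n q‖ ≤ (1 / 2 : ℝ) ^ n :=
    norm_ramp_smul_le 𝕜 (by positivity) _ fun h => hT n q h
  have hgc (n) : Continuous (g n) :=
    (RCLike.continuous_ofReal.comp ((continuous_ramp _).comp (by fun_prop))).smul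
      ((hc _).sub (hc _))
  have hsupp (q : Set.Ici (1 : ℝ) × K) (N : ℕ) (hN : (q.1 : ℝ) ≤ N) :
      (Function.support fun n => g n q) ⊆ Finset.range N := by
    intro n hn
    rw [Finset.coe_range, Set.mem_Iio]
    by_contra! h
    refine hn ?_
    have : ((q.1 : ℝ)) ≤ T n := (hN.trans (by exact_mod_cast h)).trans (hTn n)
    simp [g, ramp_eq_zero this]
  have hsum (q : Set.Ici (1 : ℝ) × K) (N : ℕ) (hN : (q.1 : ℝ) ≤ N) :
      ∑ᶠ n, g n q = ∑ n ∈ Finset.range N, g n q :=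
    finsum_eq_sum_of_support_subset _ (hsupp q N hN)
  have hgeom (N M : ℕ) : ∑ n ∈ Finset.Ico N M, (1 / 2 : ℝ) ^ n ≤ 2 * (1 / 2 : ℝ) ^ N := by
    have := geom_sum_Ico_le_of_lt_one (x := (1 / 2 : ℝ)) (m := N) (n := M) (by norm_num) (by norm_num)
    refine this.trans (le_of_eq ?_)
    norm_num
    ring
  refine ⟨fun q => Φ 0 q + ∑ᶠ n, g n q, (hc 0).add (continuous_finsum hgc ?_), ?_, ?_⟩
  · intro q
    refine ⟨{q' | (q'.1 : ℝ) < q.1 + 1}, (isOpen_lt (by fun_prop) continuous_const).mem_nhds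
      (by simp), ?_⟩
    refine (Finset.range ⌈(q.1 : ℝ) + 1⌉₊).finite_toSet.subset ?_
    rintro n ⟨q', hq', hq''⟩
    refine hsupp q' _ ?_ hq'
    exact (le_of_lt hq'').trans (Nat.le_ceil _)
  · obtain ⟨R, hR⟩ := hb
    refine ⟨R + 2, fun q => (norm_add_le _ _).trans (add_le_add (hR q) ?_)⟩
    rw [hsum q _ (Nat.le_ceil _)]
    refine (norm_sum_le _ _).trans ((Finset.sum_le_sum fun n _ => hg n q).trans ?_)
    rw [Finset.range_eq_Ico]
    simpa using hgeom 0 ⌈(q.1 : ℝ)⌉₊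
  · intro N
    have hev : ∀ᶠ t : Set.Ici (1 : ℝ) in atTop, ∀ n ∈ Finset.range N, T n + 1 ≤ t := by
      rw [Filter.eventually_all_finset]
      intro n _
      exact eventually_atTop.2 ⟨⟨max 1 (T n + 1), Set.mem_Ici.2 (le_max_left _ _)⟩, fun t ht =>
        (le_max_right (1 : ℝ) (T n + 1)).trans ht⟩
    refine Filter.mem_prod_top.2 (hev.mono fun t ht u => ?_)
    change ‖Φ 0 (t, u) + ∑ᶠ n, g n (t, u) - Φ N (t, u)‖ ≤ _
    have hM : ((t : ℝ)) ≤ ((N + ⌈(t : ℝ)⌉₊ : ℕ) : ℝ) :=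
      (Nat.le_ceil _).trans (by exact_mod_cast Nat.le_add_left _ _)
    rw [hsum (t, u) _ hM, ← Finset.sum_range_add_sum_Ico _ (Nat.le_add_right N _)]
    have h1 : ∑ n ∈ Finset.range N, g n (t, u) = Φ N (t, u) - Φ 0 (t, u) := by
      rw [← Finset.sum_range_sub (fun n => Φ n (t, u)) N]
      refine Finset.sum_congr rfl fun n hn => ?_
      simp [g, ramp_eq_one (ht n hn)]
    rw [h1, show ∀ a b c : D, a + (b - a + c) - b = c from fun a b c => by abel]
    exact (norm_sum_le _ _).trans ((Finset.sum_le_sum fun n _ => hg n _).trans (hgeom _ _))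

end Lifting

section Lifting

variable {𝕜 : Type} [RCLike 𝕜] {E D : Type*}
  [SeminormedAddCommGroup E] [NormedSpace 𝕜 E] [SeminormedAddCommGroup D] [NormedSpace 𝕜 D]

/-- An asymptotically linear and asymptotically bounded family of maps `φₜ : E → D`. No continuity
of `φₜ` for fixed `t` is required. -/
structure IsAsymptoticallyLinear (𝕜 : Type) [RCLike 𝕜] [NormedSpace 𝕜 E] [NormedSpace 𝕜 D]
    (φ : Set.Ici (1 : ℝ) → E → D) (L : ℝ) : Prop where
  continuous : ∀ x, Continuous fun t => φ t x
  bounded : ∀ x, ∃ R : ℝ, ∀ t, ‖φ t x‖ ≤ R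
  linear : ∀ (r s : 𝕜) (x y : E),
    Tendsto (fun t => φ t (r • x + s • y) - r • φ t x - s • φ t y) atTop (𝓝 0)
  norm_le : ∀ x, ∀ ε > 0, ∀ᶠ t in atTop, ‖φ t x‖ ≤ L * ‖x‖ + ε

namespace IsAsymptoticallyLinear

variable {φ : Set.Ici (1 : ℝ) → E → D} {L : ℝ}

theorem sum (hφ : IsAsymptoticallyLinear 𝕜 φ L) {κ : Type} (S : Finset κ)
    (r : κ → 𝕜) (x : κ → E) :
    Tendsto (fun t => φ t (∑ k ∈ S, r k • x k) - ∑ k ∈ S, r k • φ t (x k)) atTop (𝓝 0) := by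
  classical
  induction S using Finset.induction_on with
  | empty => simpa using hφ.linear 0 0 0 0
  | insert k S hk ih =>
    have := (hφ.linear (r k) 1 (x k) (∑ k ∈ S, r k • x k)).add ih
    rw [add_zero] at this
    refine this.congr fun t => ?_
    rw [Finset.sum_insert hk, Finset.sum_insert hk, one_smul, one_smul]
    abel

theorem norm_map_sub_le (hφ : IsAsymptoticallyLinear 𝕜 φ L) (x y : E) {ε : ℝ} (hε : 0 < ε) :
    ∀ᶠ t in atTop, ‖φ t x - φ t y‖ ≤ L * ‖x - y‖ + ε := by
  have h1 : Tendsto (fun t => φ t x - φ t y - φ t (x - y)) atTop (𝓝 0) := by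
    have := (hφ.linear 1 (-1) x y).neg
    rw [neg_zero] at this
    refine this.congr fun t => ?_
    simp only [one_smul, neg_smul, ← sub_eq_add_neg]
    abel
  filter_upwards [hφ.norm_le (x - y) (ε / 2) (half_pos hε),
    (tendsto_zero_iff_norm_tendsto_zero.1 h1).eventually_le_const (half_pos hε)] with t h2 h3
  have := norm_add_le (φ t x - φ t y - φ t (x - y)) (φ t (x - y))
  rw [sub_add_cancel] at this
  linarith

/-- A continuous path `f` in `E` has a lift `Ψ` along `φ`: `Ψ(t,u)` is continuous in both variables
and `Ψ(t,u') - φₜ(f(u))` tends to `0` for `t → ∞`, `u' → u`. -/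
theorem exists_lift (hφ : IsAsymptoticallyLinear 𝕜 φ L) (hL : 0 ≤ L) (f : C(unitInterval, E)) :
    ∃ Ψ : Set.Ici (1 : ℝ) × unitInterval → D, Continuous Ψ ∧ (∃ R : ℝ, ∀ q, ‖Ψ q‖ ≤ R) ∧
      ∀ u, Tendsto (fun q => Ψ q - φ q.1 (f u)) (atTop ×ˢ 𝓝 u) (𝓝 0) := by
  -- Bernstein approximants of `f`, and their images under `φ`, in which the parameter `u` only
  -- enters through scalar coefficients.
  let δ : ℕ → ℝ := fun m => (1 / 2 : ℝ) ^ m / (8 * (L + 1))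
  have hδ (m) : 0 < δ m := by positivity
  choose n hn using fun m => exists_bernstein_near 𝕜 f (hδ m)
  let c : ∀ m, Fin (n m + 1) → unitInterval → 𝕜 := fun m k u => ((bernstein (n m) k u : ℝ) : 𝕜)
  have hcc (m k) : Continuous (c m k) :=
    RCLike.continuous_ofReal.comp (bernstein (n m) k).continuous
  let x : ℕ → unitInterval → E := fun m u => ∑ k, c m k u • f (bernstein.z k)
  let Φ : ℕ → Set.Ici (1 : ℝ) × unitInterval → D := fun m q =>
    ∑ k, c m k q.2 • φ q.1 (f (bernstein.z k))
  have hx (m u) : ‖x m u - f u‖ ≤ δ m := hn m u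
  have hΦc (m) : Continuous (Φ m) := continuous_finsetSum _ fun k _ =>
    ((hcc m k).comp continuous_snd).smul ((hφ.continuous _).comp continuous_fst)
  have hΦ (m u) : Tendsto (fun q => Φ m q - φ q.1 (x m u)) (atTop ×ˢ 𝓝 u) (𝓝 0) := by
    have h1 : Tendsto (fun q : Set.Ici (1 : ℝ) × unitInterval =>
        ∑ k, (c m k q.2 - c m k u) • φ q.1 (f (bernstein.z k))) (atTop ×ˢ 𝓝 u)
        (𝓝 (∑ _k : Fin (n m + 1), 0)) := by
      refine tendsto_finsetSum _ fun k _ => ?_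
      obtain ⟨R, hR⟩ := hφ.bounded (f (bernstein.z k))
      have h2 : Tendsto (fun q : Set.Ici (1 : ℝ) × unitInterval => ‖c m k q.2 - c m k u‖ * R)
          (atTop ×ˢ 𝓝 u) (𝓝 0) := by
        have := ((tendsto_iff_norm_sub_tendsto_zero.1
          ((hcc m k).tendsto u)).comp
            (tendsto_snd (f := (atTop : Filter (Set.Ici (1 : ℝ)))))).mul_const R
        rwa [zero_mul] at this
      refine squeeze_zero_norm (fun q => ?_) h2
      rw [norm_smul]
      exact mul_le_mul_of_nonneg_left (hR _) (norm_nonneg _)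
    have h3 := (hφ.sum Finset.univ (fun k => c m k u) fun k => f (bernstein.z k)).comp
      (tendsto_fst (f := atTop) (g := 𝓝 u))
    have h4 := h1.sub h3
    rw [Finset.sum_const_zero, sub_zero] at h4
    refine h4.congr fun q => ?_
    simp only [sub_smul, Finset.sum_sub_distrib, Function.comp, Φ, x]
    abel
  have hb : ∃ R : ℝ, ∀ q, ‖Φ 0 q‖ ≤ R := by
    choose R hR using fun k : Fin (n 0 + 1) => hφ.bounded (f (bernstein.z k))
    choose R' hR' using fun k : Fin (n 0 + 1) =>
      (isCompact_univ (X := unitInterval)).exists_bound_of_continuousOn (hcc 0 k).continuousOn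
    refine ⟨∑ k, R' k * R k, fun q => (norm_sum_le _ _).trans (Finset.sum_le_sum fun k _ => ?_)⟩
    rw [norm_smul]
    exact mul_le_mul (hR' k _ trivial) (hR k _) (norm_nonneg _)
      ((norm_nonneg _).trans (hR' k q.2 trivial))
  have hstep (m) : ∀ᶠ q in atTop ×ˢ ⊤, ‖Φ (m + 1) q - Φ m q‖ ≤ (1 / 2 : ℝ) ^ m := by
    refine eventually_prod_top_of_forall_nhds fun u => ?_
    have hε : 0 < (1 / 2 : ℝ) ^ m / 4 := by positivity
    have h1 := (tendsto_zero_iff_norm_tendsto_zero.1 (hΦ (m + 1) u)).eventually_le_const hε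
    have h2 := (tendsto_zero_iff_norm_tendsto_zero.1 (hΦ m u)).eventually_le_const hε
    have h3 := (tendsto_fst (f := atTop) (g := 𝓝 u)).eventually
      (hφ.norm_map_sub_le (x (m + 1) u) (x m u) hε)
    filter_upwards [h1, h2, h3] with q h1 h2 h3
    have h4 : ‖x (m + 1) u - x m u‖ ≤ δ (m + 1) + δ m := by
      have := norm_sub_le (x (m + 1) u - f u) (x m u - f u)
      rw [sub_sub_sub_cancel_right] at this
      exact this.trans (add_le_add (hx _ _) (hx _ _))
    have h5 : L * (δ (m + 1) + δ m) ≤ (1 / 2 : ℝ) ^ m / 4 := by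
      have e : δ (m + 1) + δ m = (1 / 2 : ℝ) ^ m * (3 / 16) / (L + 1) := by
        simp only [δ, pow_succ]
        field_simp
        norm_num
      rw [e, mul_div_assoc', div_le_iff₀ (by positivity)]
      nlinarith [pow_pos (one_half_pos (α := ℝ)) m]
    have h6 : ‖Φ (m + 1) q - Φ m q‖ ≤ ‖Φ (m + 1) q - φ q.1 (x (m + 1) u)‖ +
        ‖φ q.1 (x (m + 1) u) - φ q.1 (x m u)‖ + ‖Φ m q - φ q.1 (x m u)‖ := by
      have e : Φ (m + 1) q - Φ m q = (Φ (m + 1) q - φ q.1 (x (m + 1) u)) +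
        (φ q.1 (x (m + 1) u) - φ q.1 (x m u)) - (Φ m q - φ q.1 (x m u)) := by abel
      rw [e]
      exact (norm_sub_le _ _).trans (add_le_add_left (norm_add_le _ _) _)
    have h7 := mul_le_mul_of_nonneg_left h4 hL
    linarith
  obtain ⟨Ψ, hΨ, hΨb, hΨΦ⟩ := exists_glue 𝕜 Φ hΦc hb hstep
  refine ⟨Ψ, hΨ, hΨb, fun u => ?_⟩
  rw [tendsto_zero_iff_norm_tendsto_zero]
  refine tendsto_order.2 ⟨fun a ha => Eventually.of_forall fun q => ha.trans_le (norm_nonneg _),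
    fun ε hε => ?_⟩
  obtain ⟨N, hN⟩ := exists_pow_lt_of_lt_one (show 0 < ε / 8 by positivity)
    (show (1 / 2 : ℝ) < 1 by norm_num)
  have h1 := (tendsto_zero_iff_norm_tendsto_zero.1 (hΦ N u)).eventually_le_const
    (show 0 < ε / 8 by positivity)
  have h2 := (tendsto_fst (f := atTop) (g := 𝓝 u)).eventually
    (hφ.norm_map_sub_le (x N u) (f u) (show 0 < ε / 8 by positivity))
  have h3 := (hΨΦ N).filter_mono (Filter.prod_mono le_rfl (le_top : 𝓝 u ≤ ⊤))
  filter_upwards [h1, h2, h3] with q h1 h2 h3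
  have h4 : L * δ N ≤ (1 / 2 : ℝ) ^ N := by
    simp only [δ]
    rw [mul_div_assoc', div_le_iff₀ (by positivity)]
    nlinarith [pow_pos (one_half_pos (α := ℝ)) N]
  have h5 := mul_le_mul_of_nonneg_left (hx N u) hL
  have h6 : ‖Ψ q - φ q.1 (f u)‖ ≤ ‖Ψ q - Φ N q‖ + ‖Φ N q - φ q.1 (x N u)‖ +
      ‖φ q.1 (x N u) - φ q.1 (f u)‖ := by
    have e : Ψ q - φ q.1 (f u) = (Ψ q - Φ N q) + (Φ N q - φ q.1 (x N u)) +
      (φ q.1 (x N u) - φ q.1 (f u)) := by abel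
    rw [e]
    exact (norm_add_le _ _).trans (add_le_add_left (norm_add_le _ _) _)
  linarith

/-- The values of the lift at the two end points may be prescribed. -/
theorem exists_lift_endpoints (hφ : IsAsymptoticallyLinear 𝕜 φ L) (hL : 0 ≤ L)
    (f : C(unitInterval, E)) {p₀ p₁ : Set.Ici (1 : ℝ) → D}
    (hp₀ : Continuous p₀) (hp₁ : Continuous p₁) (hb₀ : ∃ R : ℝ, ∀ t, ‖p₀ t‖ ≤ R)
    (hb₁ : ∃ R : ℝ, ∀ t, ‖p₁ t‖ ≤ R)
    (h₀ : Tendsto (fun t => p₀ t - φ t (f 0)) atTop (𝓝 0))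
    (h₁ : Tendsto (fun t => p₁ t - φ t (f 1)) atTop (𝓝 0)) :
    ∃ Ψ : Set.Ici (1 : ℝ) × unitInterval → D, Continuous Ψ ∧ (∃ R : ℝ, ∀ q, ‖Ψ q‖ ≤ R) ∧
      (∀ u, Tendsto (fun q => Ψ q - φ q.1 (f u)) (atTop ×ˢ 𝓝 u) (𝓝 0)) ∧
      (∀ t, Ψ (t, 0) = p₀ t) ∧ ∀ t, Ψ (t, 1) = p₁ t := by
  obtain ⟨Ψ, hΨ, ⟨R, hR⟩, hΨφ⟩ := hφ.exists_lift hL f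
  obtain ⟨R₀, hR₀⟩ := hb₀
  obtain ⟨R₁, hR₁⟩ := hb₁
  have hend (u) {p : Set.Ici (1 : ℝ) → D} (hp : Tendsto (fun t => p t - φ t (f u)) atTop (𝓝 0)) :
      Tendsto (fun t => p t - Ψ (t, u)) atTop (𝓝 0) := by
    have h2 := (hΨφ u).comp (tendsto_id.prodMk (tendsto_const_nhds (x := u)))
    have h3 := hp.sub h2
    rw [sub_zero] at h3
    exact h3.congr fun t => by simp
  have hw (u : unitInterval) : |(1 - u : ℝ)| ≤ 1 := by
    rw [abs_le]; constructor <;> linarith [u.2.1, u.2.2]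
  have hw' (u : unitInterval) : |(u : ℝ)| ≤ 1 := by
    rw [abs_le]; constructor <;> linarith [u.2.1, u.2.2]
  refine ⟨fun q => Ψ q + ((1 - q.2 : ℝ) : 𝕜) • (p₀ q.1 - Ψ (q.1, 0)) +
    ((q.2 : ℝ) : 𝕜) • (p₁ q.1 - Ψ (q.1, 1)), ?_, ⟨R + (R₀ + R) + (R₁ + R), fun q => ?_⟩,
    fun u => ?_, fun t => ?_, fun t => ?_⟩
  · have c1 : Continuous fun q : Set.Ici (1 : ℝ) × unitInterval => ((1 - q.2 : ℝ) : 𝕜) :=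
      RCLike.continuous_ofReal.comp (by fun_prop)
    have c2 : Continuous fun q : Set.Ici (1 : ℝ) × unitInterval => ((q.2 : ℝ) : 𝕜) :=
      RCLike.continuous_ofReal.comp (by fun_prop)
    fun_prop
  · have b {w r : ℝ} (hw : |w| ≤ 1) {y : D} (hy : ‖y‖ ≤ r) : ‖(w : 𝕜) • y‖ ≤ r := by
      rw [norm_smul, RCLike.norm_ofReal]
      exact (mul_le_of_le_one_left (norm_nonneg _) hw).trans hy
    refine (norm_add_le _ _).trans (add_le_add ((norm_add_le _ _).trans (add_le_add (hR q) ?_)) ?_)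
    · exact b (hw _) ((norm_sub_le _ _).trans (add_le_add (hR₀ _) (hR _)))
    · exact b (hw' _) ((norm_sub_le _ _).trans (add_le_add (hR₁ _) (hR _)))
  · have t0 := tendsto_smul_zero (𝕜 := 𝕜) ((hend 0 h₀).comp (tendsto_fst (f := atTop) (g := 𝓝 u)))
      (w := fun q => 1 - (q.2 : ℝ)) fun q => hw q.2
    have t1 := tendsto_smul_zero (𝕜 := 𝕜) ((hend 1 h₁).comp (tendsto_fst (f := atTop) (g := 𝓝 u)))
      (w := fun q => (q.2 : ℝ)) fun q => hw' q.2
    have := ((hΨφ u).add t0).add t1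
    simp only [add_zero] at this
    refine this.congr fun q => ?_
    simp only [Function.comp]
    abel
  · simp
  · simp

end IsAsymptoticallyLinear

end Lifting

/-! ### Quasi-inverses and asymptotic contractivity -/

section ZeroAtInfty

variable {X E : Type*} [TopologicalSpace X] [SeminormedAddCommGroup E]

theorem norm_zeroAtInfty_apply_le (f : C₀(X, E)) (r : X) : ‖f r‖ ≤ ‖f‖ :=
  f.toBCF.norm_coe_le_norm r

theorem norm_zeroAtInfty_le {f : C₀(X, E)} {c : ℝ} (hc : 0 ≤ c) (h : ∀ r, ‖f r‖ ≤ c) : ‖f‖ ≤ c :=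
  (BoundedContinuousFunction.norm_le (f := f.toBCF) hc).2 h

/-- Banach's fixed point theorem, stated for a seminorm that happens to be a norm. -/
theorem exists_fixedPoint_of_norm_sub_le [CompleteSpace E] (hE : ∀ x : E, ‖x‖ = 0 → x = 0)
    {f : E → E} (hf : ∀ x y, ‖f x - f y‖ ≤ 1 / 2 * ‖x - y‖) : ∃ y, f y = y := by
  let _ : NormedAddCommGroup E := NormedAddCommGroup.ofSeparation hE
  have hc : ContractingWith (1 / 2) f := by
    refine ⟨by rw [← NNReal.coe_lt_coe]; norm_num, LipschitzWith.of_dist_le_mul fun x y => ?_⟩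
    rw [dist_eq_norm, dist_eq_norm]
    simpa using hf x y
  exact ⟨hc.fixedPoint, hc.fixedPoint_isFixedPt⟩

end ZeroAtInfty

namespace GradedCStarCategory

variable {𝕜 : Type} [RCLike 𝕜] (A : GradedCStarCategory.{u, v} 𝕜)

section

variable {A} {a b : A.Ob} (F : A.suspHom a b) (r : ℝ)

theorem norm_susp_fst_le : ‖F.1.1 r‖ ≤ ‖F‖ :=
  (norm_zeroAtInfty_apply_le F.1.1 r).trans (norm_fst_le F.1)

theorem norm_susp_snd_le : ‖F.1.2 r‖ ≤ ‖F‖ :=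
  (norm_zeroAtInfty_apply_le F.1.2 r).trans (norm_snd_le F.1)

variable {F} in
theorem norm_susp_le {c : ℝ} (hc : 0 ≤ c) (h1 : ∀ r, ‖F.1.1 r‖ ≤ c) (h2 : ∀ r, ‖F.1.2 r‖ ≤ c) :
    ‖F‖ ≤ c :=
  norm_prod_le_iff.2 ⟨norm_zeroAtInfty_le hc h1, norm_zeroAtInfty_le hc h2⟩

end

theorem norm_comp_add_comp_le {a b b' c : A.Ob} {x : A.Hom b c} {y : A.Hom a b} {x' : A.Hom b' c}
    {y' : A.Hom a b'} {m n : ℝ} (hm : 0 ≤ m) (hx : ‖x‖ ≤ m) (hy : ‖y‖ ≤ n) (hx' : ‖x'‖ ≤ m)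
    (hy' : ‖y'‖ ≤ n) : ‖A.comp x y + A.comp x' y'‖ ≤ 2 * (m * n) := by
  rw [two_mul]
  refine (norm_add_le _ _).trans (add_le_add ?_ ?_)
  · exact (A.norm_comp_le _ _).trans (mul_le_mul hx hy (norm_nonneg _) hm)
  · exact (A.norm_comp_le _ _).trans (mul_le_mul hx' hy' (norm_nonneg _) hm)

theorem norm_suspComp_le {a b c : A.Ob} (F : A.suspHom b c) (G : A.suspHom a b) :
    ‖A.suspComp F G‖ ≤ 2 * (‖F‖ * ‖G‖) :=
  norm_susp_le (by positivity)
    (fun r => A.norm_comp_add_comp_le (norm_nonneg _) (norm_susp_fst_le F r) (norm_susp_fst_le G r)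
      (norm_susp_snd_le F r) (norm_susp_snd_le G (-r)))
    fun r => A.norm_comp_add_comp_le (norm_nonneg _) (norm_susp_fst_le F r) (norm_susp_snd_le G r)
      (norm_susp_snd_le F r) (norm_susp_fst_le G (-r))

theorem norm_suspStar_le {a b : A.Ob} (F : A.suspHom a b) : ‖A.suspStar F‖ ≤ ‖F‖ :=
  norm_susp_le (norm_nonneg _) (fun r => (A.norm_star _).le.trans (norm_susp_fst_le F r))
    fun r => (A.norm_star _).le.trans (norm_susp_snd_le F (-r))

/-- A morphism `h` of `S ⊗̂ A` of small norm has a quasi-inverse: `(1 + y)(1 - h) = 1`. It is found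
as a fixed point in the complete space `C₀(ℝ, A) × C₀(ℝ, A)`; that its components have the right
degrees follows from uniqueness. -/
theorem exists_quasiInverse {a : A.Ob} (h : A.suspHom a a) (hh : ‖h‖ ≤ 1 / 4) :
    ∃ y : A.suspHom a a, y = h + A.suspComp y h := by
  have h1 (r) : ‖h.1.1 r‖ ≤ 1 / 4 := (norm_susp_fst_le h r).trans hh
  have h2 (r) : ‖h.1.2 r‖ ≤ 1 / 4 := (norm_susp_snd_le h r).trans hh
  let E := C₀(ℝ, A.Hom a a) × C₀(ℝ, A.Hom a a)
  have : CompleteSpace (A.Hom a a) := A.complete a a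
  have hE (x : E) (hx : ‖x‖ = 0) : x = 0 := by
    have e1 (r : ℝ) : x.1 r = 0 := A.eq_zero_of_norm _ (le_antisymm
      (((norm_zeroAtInfty_apply_le x.1 r).trans (norm_fst_le x)).trans hx.le) (norm_nonneg _))
    have e2 (r : ℝ) : x.2 r = 0 := A.eq_zero_of_norm _ (le_antisymm
      (((norm_zeroAtInfty_apply_le x.2 r).trans (norm_snd_le x)).trans hx.le) (norm_nonneg _))
    exact Prod.ext (ZeroAtInftyContinuousMap.ext e1) (ZeroAtInftyContinuousMap.ext e2)
  obtain ⟨y, hy⟩ := exists_fixedPoint_of_norm_sub_le hE (f := fun y : E =>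
      (h.1.1 + A.comp₀ y.1 h.1.1 + A.comp₀ y.2 (A.refl₀ h.1.2),
        h.1.2 + A.comp₀ y.1 h.1.2 + A.comp₀ y.2 (A.refl₀ h.1.1))) fun x y => by
    have e1 (r : ℝ) : ‖x.1 r - y.1 r‖ ≤ ‖x - y‖ :=
      (norm_zeroAtInfty_apply_le (x.1 - y.1) r).trans (norm_fst_le (x - y))
    have e2 (r : ℝ) : ‖x.2 r - y.2 r‖ ≤ ‖x - y‖ :=
      (norm_zeroAtInfty_apply_le (x.2 - y.2) r).trans (norm_snd_le (x - y))
    have hs {b c : A.Ob} (u u' : A.Hom b c) {d : A.Ob} (w : A.Hom d b) :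
        A.comp (u - u') w = A.comp u w - A.comp u' w := by
      rw [sub_eq_add_neg, A.laws.add_comp, neg_comp, ← sub_eq_add_neg]
    refine norm_prod_le_iff.2 ⟨norm_zeroAtInfty_le (by positivity) fun r => ?_,
      norm_zeroAtInfty_le (by positivity) fun r => ?_⟩
    · refine (le_of_eq (congrArg norm ?_)).trans ((A.norm_comp_add_comp_le (norm_nonneg _) (e1 r)
        (h1 r) (e2 r) (h2 (-r))).trans_eq (by ring))
      rw [hs, hs]
      change (h.1.1 r + A.comp (x.1 r) (h.1.1 r) + A.comp (x.2 r) (h.1.2 (-r))) -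
        (h.1.1 r + A.comp (y.1 r) (h.1.1 r) + A.comp (y.2 r) (h.1.2 (-r))) = _
      abel
    · refine (le_of_eq (congrArg norm ?_)).trans ((A.norm_comp_add_comp_le (norm_nonneg _) (e1 r)
        (h2 r) (e2 r) (h1 (-r))).trans_eq (by ring))
      rw [hs, hs]
      change (h.1.2 r + A.comp (x.1 r) (h.1.2 r) + A.comp (x.2 r) (h.1.1 (-r))) -
        (h.1.2 r + A.comp (y.1 r) (h.1.2 r) + A.comp (y.2 r) (h.1.1 (-r))) = _
      abel
  have y1 (r : ℝ) : y.1 r = h.1.1 r + A.comp (y.1 r) (h.1.1 r) + A.comp (y.2 r) (h.1.2 (-r)) :=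
    DFunLike.congr_fun (congrArg Prod.fst hy).symm r
  have y2 (r : ℝ) : y.2 r = h.1.2 r + A.comp (y.1 r) (h.1.2 r) + A.comp (y.2 r) (h.1.1 (-r)) :=
    DFunLike.congr_fun (congrArg Prod.snd hy).symm r
  obtain ⟨hg1, hg2⟩ := h.2
  -- The deviation of `y(r)` from being homogeneous is reproduced by a contraction.
  have key (r : ℝ) : A.grade (y.1 r) = y.1 r ∧ A.grade (y.2 r) = -y.2 r := by
    set d := A.grade (y.1 r) - y.1 r with hd
    set e := A.grade (y.2 r) + y.2 r with he
    have d1 : d = A.comp d (h.1.1 r) + A.comp (-e) (h.1.2 (-r)) := by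
      rw [hd, he]
      conv_lhs => rw [y1 r]
      simp only [A.laws.grade_add, A.laws.grade_comp, hg1, hg2, sub_eq_add_neg, neg_add,
        A.laws.add_comp, neg_comp, comp_neg]
      abel
    have e1 : e = A.comp (-d) (h.1.2 r) + A.comp e (h.1.1 (-r)) := by
      rw [hd, he]
      conv_lhs => rw [y2 r]
      simp only [A.laws.grade_add, A.laws.grade_comp, hg1, hg2, sub_eq_add_neg, neg_add,
        A.laws.add_comp, neg_comp, comp_neg, neg_neg]
      abel
    have b1 := A.norm_comp_add_comp_le (x := d) (x' := -e) (le_max_of_le_left (norm_nonneg d))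
      (le_max_left ‖d‖ ‖e‖) (h1 r) (by rw [norm_neg]; exact le_max_right _ _) (h2 (-r))
    have b2 := A.norm_comp_add_comp_le (x := -d) (x' := e) (le_max_of_le_left (norm_nonneg d))
      (by rw [norm_neg]; exact le_max_left ‖d‖ ‖e‖) (h2 r) (le_max_right _ _) (h1 (-r))
    rw [← d1] at b1
    rw [← e1] at b2
    have b3 : max ‖d‖ ‖e‖ ≤ 0 := by
      have := max_le b1 b2
      linarith
    have d0 := A.eq_zero_of_norm d (le_antisymm ((le_max_left _ _).trans b3) (norm_nonneg _))
    have e0 := A.eq_zero_of_norm e (le_antisymm ((le_max_right _ _).trans b3) (norm_nonneg _))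
    exact ⟨sub_eq_zero.1 d0, eq_neg_of_add_eq_zero_left e0⟩
  refine ⟨⟨y, fun r => (key r).1, fun r => (key r).2⟩, A.suspHom_ext (fun r => ?_) fun r => ?_⟩
  · exact (y1 r).trans (add_assoc _ _ _)
  · exact (y2 r).trans (add_assoc _ _ _)

end GradedCStarCategory

section Hilbert

variable {𝕜 : Type} [RCLike 𝕜] {E F : Type v} [NormedAddCommGroup E] [InnerProductSpace 𝕜 E]
  [CompleteSpace E] [NormedAddCommGroup F] [InnerProductSpace 𝕜 F] [CompleteSpace F]

/-- If `T* T` is bounded by about `M`, and `1 - M⁻¹ T* T` is bounded below, then `T* T` is bounded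
by a number smaller than `M`. -/
theorem norm_sq_le_of_quasiInverse (T : E →L[𝕜] F) (Y : E →L[𝕜] E) {c M : ℝ} (hc : 0 ≤ c)
    (hM : 1 ≤ M) (hY : ‖Y‖ ≤ c)
    (hT : ‖T‖ ^ 2 ≤ M + 1 / (4 * (1 + c) ^ 2) / 8)
    (hZ : ‖Y - ((M⁻¹ : ℝ) : 𝕜) • (ContinuousLinearMap.adjoint T ∘L T) -
      ((M⁻¹ : ℝ) : 𝕜) • (Y ∘L ContinuousLinearMap.adjoint T ∘L T)‖ ≤ 1 / 2) :
    ‖T‖ ^ 2 ≤ M * (1 - 1 / (4 * (1 + c) ^ 2) / 4) := by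
  set N := ContinuousLinearMap.adjoint T ∘L T with hN
  set κ := 1 / (4 * (1 + c) ^ 2) with hκ
  have hM0 : 0 < M := by linarith
  have hκ0 : 0 < κ := by positivity
  have hκ1 : κ ≤ 1 := by
    rw [hκ, div_le_one (by positivity)]
    nlinarith
  have hNn : ‖N‖ ≤ M + κ / 8 := by
    rw [hN, ContinuousLinearMap.norm_adjoint_comp_self, ← pow_two]
    exact hT
  have key (ξ : E) : ‖T ξ‖ ^ 2 ≤ M * (1 - κ / 4) * ‖ξ‖ ^ 2 := by
    set η := ξ - ((M⁻¹ : ℝ) : 𝕜) • N ξ with hη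
    have h1 : ‖ξ‖ ≤ 2 * (1 + c) * ‖η‖ := by
      have e : ξ = (η + Y η) - (Y - ((M⁻¹ : ℝ) : 𝕜) • N - ((M⁻¹ : ℝ) : 𝕜) • (Y ∘L N)) ξ := by
        simp [hη]
        abel
      have e1 : ‖ξ‖ ≤ (‖η‖ + c * ‖η‖) + 1 / 2 * ‖ξ‖ := by
        conv_lhs => rw [e]
        refine (norm_sub_le _ _).trans (add_le_add ((norm_add_le _ _).trans
          (add_le_add le_rfl ?_)) ?_)
        · exact (Y.le_opNorm η).trans (mul_le_mul_of_nonneg_right hY (norm_nonneg _))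
        · exact (ContinuousLinearMap.le_opNorm _ ξ).trans
            (mul_le_mul_of_nonneg_right hZ (norm_nonneg _))
      linarith
    have h2 : ‖η‖ ^ 2 = ‖ξ‖ ^ 2 - 2 * (M⁻¹ * ‖T ξ‖ ^ 2) + (M⁻¹ * ‖N ξ‖) ^ 2 := by
      rw [hη, @norm_sub_sq 𝕜, norm_smul, RCLike.norm_ofReal, abs_of_pos (inv_pos.2 hM0),
        inner_smul_right, RCLike.re_ofReal_mul, hN, ContinuousLinearMap.comp_apply,
        ContinuousLinearMap.adjoint_inner_right, inner_self_eq_norm_sq]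
    have h3 : M⁻¹ * ‖N ξ‖ ≤ (1 + κ / 8) * ‖ξ‖ := by
      rw [inv_mul_le_iff₀ hM0, ← mul_assoc]
      refine (N.le_opNorm ξ).trans (mul_le_mul_of_nonneg_right (hNn.trans ?_) (norm_nonneg _))
      nlinarith
    have h4 : κ * ‖ξ‖ ^ 2 ≤ ‖η‖ ^ 2 := by
      rw [hκ, div_mul_eq_mul_div, one_mul, div_le_iff₀ (by positivity)]
      calc ‖ξ‖ ^ 2 ≤ (2 * (1 + c) * ‖η‖) ^ 2 := pow_le_pow_left₀ (norm_nonneg _) h1 2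
        _ = _ := by ring
    have h5 : (M⁻¹ * ‖N ξ‖) ^ 2 ≤ ((1 + κ / 8) * ‖ξ‖) ^ 2 := pow_le_pow_left₀ (by positivity) h3 2
    have h6 : M⁻¹ * ‖T ξ‖ ^ 2 ≤ (1 - κ / 4) * ‖ξ‖ ^ 2 := by
      have : (1 + κ / 8) ^ 2 * ‖ξ‖ ^ 2 ≤ (1 + κ / 2) * ‖ξ‖ ^ 2 :=
        mul_le_mul_of_nonneg_right (by nlinarith) (by positivity)
      nlinarith
    rw [inv_mul_le_iff₀ hM0] at h6
    linarith
  have hb : 0 ≤ M * (1 - κ / 4) := mul_nonneg hM0.le (by linarith)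
  have : ‖T‖ ≤ Real.sqrt (M * (1 - κ / 4)) := by
    refine T.opNorm_le_bound (Real.sqrt_nonneg _) fun ξ => ?_
    rw [← Real.sqrt_sq (norm_nonneg ξ), ← Real.sqrt_mul hb]
    exact Real.le_sqrt_of_sq_le (key ξ)
  calc ‖T‖ ^ 2 ≤ Real.sqrt (M * (1 - κ / 4)) ^ 2 := pow_le_pow_left₀ (norm_nonneg _) this 2
    _ = _ := Real.sq_sqrt hb

end Hilbert

namespace Rep

theorem mat_sub {𝕜 : Type} [RCLike 𝕜] {C : NormedGradedStarCategory.{u, v} 𝕜} {ι κ : Type}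
    [Fintype ι] [Fintype κ] {s : ι → C.Ob} {t : κ → C.Ob} (ρ : Rep C) (M N : Mat C.alg s t) :
    ρ.mat (M - N) = ρ.mat M - ρ.mat N := by
  ext x i; simp [Finset.sum_sub_distrib]

end Rep

namespace NormedGradedStarCategory

variable {𝕜 : Type} [RCLike 𝕜] (D : NormedGradedStarCategory.{u, v} 𝕜) {a b c : D.Ob}

theorem comp_sub (x : D.Hom b c) (y z : D.Hom a b) :
    D.comp x (y - z) = D.comp x y - D.comp x z := by
  have := D.laws.comp_smul (-1) x z
  rw [sub_eq_add_neg, D.laws.comp_add, sub_eq_add_neg]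
  simpa using this

theorem sub_comp (x y : D.Hom b c) (z : D.Hom a b) :
    D.comp (x - y) z = D.comp x z - D.comp y z := by
  have := D.laws.smul_comp (-1) y z
  rw [sub_eq_add_neg, D.laws.add_comp, sub_eq_add_neg]
  simpa using this

theorem star_sub (x y : D.Hom a b) : D.star (x - y) = D.star x - D.star y := by
  have := D.laws.star_smul (-1) y
  rw [sub_eq_add_neg, D.laws.star_add, sub_eq_add_neg]
  simpa using this

variable {D} {X : Type*} {l : Filter X}

theorem tendsto_comp_bounded {f : X → D.Hom b c} {g : X → D.Hom a b} (hf : Tendsto f l (𝓝 0))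
    (hg : ∃ K : ℝ, ∀ p, ‖g p‖ ≤ K) : Tendsto (fun p => D.comp (f p) (g p)) l (𝓝 0) := by
  obtain ⟨K, hK⟩ := hg
  have h := (tendsto_zero_iff_norm_tendsto_zero.1 hf).mul_const K
  rw [zero_mul] at h
  exact squeeze_zero_norm (fun p => (D.norm_comp_le _ _).trans
    (mul_le_mul_of_nonneg_left (hK p) (norm_nonneg _))) h

theorem tendsto_bounded_comp {f : X → D.Hom b c} {g : X → D.Hom a b}
    (hf : ∃ K : ℝ, ∀ p, ‖f p‖ ≤ K) (hg : Tendsto g l (𝓝 0)) :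
    Tendsto (fun p => D.comp (f p) (g p)) l (𝓝 0) := by
  obtain ⟨K, hK⟩ := hf
  have h := (tendsto_zero_iff_norm_tendsto_zero.1 hg).const_mul K
  rw [mul_zero] at h
  exact squeeze_zero_norm (fun p => (D.norm_comp_le _ _).trans
    (mul_le_mul_of_nonneg_right (hK p) (norm_nonneg _))) h

/-- The estimate `ETheory.norm_sq_le_of_quasiInverse` in all representations of `C_⊕` at once. -/
theorem norm_sq_le_of_quasiInverse (C : NormedGradedStarCategory.{u, v} 𝕜) {a b : C.add.Ob}
    (f : C.add.Hom a b) (g : C.add.Hom a a) {c M : ℝ} (hc : 0 ≤ c) (hM : 1 ≤ M) (hg : ‖g‖ ≤ c)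
    (hf : ‖f‖ ^ 2 ≤ M + 1 / (4 * (1 + c) ^ 2) / 8)
    (hz : ‖g - ((M⁻¹ : ℝ) : 𝕜) • C.add.comp (C.add.star f) f - ((M⁻¹ : ℝ) : 𝕜) •
      C.add.comp g (C.add.comp (C.add.star f) f)‖ ≤ 1 / 2) :
    ‖f‖ ^ 2 ≤ M * (1 - 1 / (4 * (1 + c) ^ 2) / 4) := by
  have hκ1 : 1 / (4 * (1 + c) ^ 2) ≤ 1 := by
    rw [div_le_one (by positivity)]
    nlinarith
  have hb : 0 ≤ M * (1 - 1 / (4 * (1 + c) ^ 2) / 4) := mul_nonneg (by linarith) (by linarith)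
  have key (s : Fin a.len → C.Ob) (t : Fin b.len → C.Ob) (F : Mat C.alg s t) (G : Mat C.alg s s)
      (hG : ‖C.matFamily s s G‖ ≤ c)
      (hF : ‖C.matFamily s t F‖ ^ 2 ≤ M + 1 / (4 * (1 + c) ^ 2) / 8)
      (hZ : ‖C.matFamily s s (G - ((M⁻¹ : ℝ) : 𝕜) • F.star.comp F - ((M⁻¹ : ℝ) : 𝕜) •
        G.comp (F.star.comp F))‖ ≤ 1 / 2) :
      ‖C.matFamily s t F‖ ≤ Real.sqrt (M * (1 - 1 / (4 * (1 + c) ^ 2) / 4)) := by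
    refine C.norm_matFamily_le _ _ F (Real.sqrt_nonneg _) fun ρ => Real.le_sqrt_of_sq_le ?_
    refine ETheory.norm_sq_le_of_quasiInverse (𝕜 := 𝕜) (ρ.mat F) (ρ.mat G) hc hM
      ((C.norm_mat_le_norm _ _ G ρ).trans hG) ?_ ?_
    · exact (pow_le_pow_left₀ (norm_nonneg _) (C.norm_mat_le_norm _ _ F ρ) 2).trans hF
    · have := (C.norm_mat_le_norm _ _ _ ρ).trans hZ
      rwa [ρ.mat_sub, ρ.mat_sub, ρ.mat_smul, ρ.mat_smul, ρ.mat_comp, ρ.mat_comp, ρ.mat_comp,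
        ρ.mat_star] at this
  calc ‖f‖ ^ 2 ≤ Real.sqrt (M * (1 - 1 / (4 * (1 + c) ^ 2) / 4)) ^ 2 :=
        pow_le_pow_left₀ (norm_nonneg _) (key a.fam b.fam f g hg hf hz) 2
    _ = _ := Real.sq_sqrt hb

end NormedGradedStarCategory

namespace IsGradedAsymptotic

variable {𝕜 : Type} [RCLike 𝕜] {A : GradedStarCategory.{u, v} 𝕜}
  {C : NormedGradedStarCategory.{u₂, v₂} 𝕜} {φ : FunctorData A C.add.alg}

/-- An asymptotic functor is asymptotically contractive at `x`, in the spatial norm of `C_⊕`, as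
soon as `1 - s x* x` has a left inverse for all `0 ≤ s ≤ 1`: if `M = limsup ‖φₜ(x)‖²` were greater
than `1`, then `1 - M⁻¹ φₜ(x)* φₜ(x)` would be bounded below, uniformly for large `t`. -/
theorem eventually_norm_sq_le (h : IsGradedAsymptotic (C := C.add) φ) {a b : A.Ob} (x : A.Hom a b)
    (hx : ∀ s : ℝ, 0 ≤ s → s ≤ 1 → ∃ y : A.Hom a a,
      y = (s : 𝕜) • A.comp (A.star x) x + (s : 𝕜) • A.comp y (A.comp (A.star x) x))
    {ε : ℝ} (hε : 0 < ε) :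
    ∀ᶠ t in atTop, ‖(φ.map t x : C.add.Hom (φ.obj a) (φ.obj b))‖ ^ 2 ≤ 1 + ε := by
  let f : Set.Ici (1 : ℝ) → C.add.Hom (φ.obj a) (φ.obj b) := fun t => φ.map t x
  let P : Set ℝ := {R | 0 ≤ R ∧ ∀ᶠ t in atTop, ‖f t‖ ^ 2 ≤ R}
  have hP : BddBelow P := ⟨0, fun R hR => hR.1⟩
  have hPn : P.Nonempty := by
    obtain ⟨K, hK⟩ := h.bounded x
    exact ⟨K ^ 2, by positivity, Eventually.of_forall fun t =>
      pow_le_pow_left₀ (norm_nonneg _) (hK t) 2⟩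
  have hlt {R : ℝ} (hR : sInf P < R) : ∀ᶠ t in atTop, ‖f t‖ ^ 2 ≤ R := by
    obtain ⟨R', h1, h2⟩ := exists_lt_of_csInf_lt hPn hR
    exact h1.2.mono fun t ht => ht.trans h2.le
  suffices hM : sInf P ≤ 1 from hlt (by linarith)
  by_contra! hM
  set M := sInf P
  have hM0 : 0 < M := by linarith
  obtain ⟨y, hy⟩ := hx M⁻¹ (by positivity) (inv_le_one_of_one_le₀ hM.le)
  set k := A.comp (A.star x) x with hk
  let g : Set.Ici (1 : ℝ) → C.add.Hom (φ.obj a) (φ.obj a) := fun t => φ.map t y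
  let N : Set.Ici (1 : ℝ) → C.add.Hom (φ.obj a) (φ.obj a) := fun t =>
    C.add.comp (C.add.star (f t)) (f t)
  have t1 : Tendsto (fun t => (φ.map t k : C.add.Hom (φ.obj a) (φ.obj a)) - N t) atTop (𝓝 0) := by
    have e1 := tendsto_zero_iff_norm_tendsto_zero.2 (h.comp (A.star x) x)
    have e2 := NormedGradedStarCategory.tendsto_comp_bounded (D := C.add) (g := f)
      (tendsto_zero_iff_norm_tendsto_zero.2 (h.star x)) (h.bounded x)
    have e3 := e1.add e2
    rw [add_zero] at e3
    refine e3.congr fun t => ?_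
    rw [NormedGradedStarCategory.sub_comp, sub_add_sub_cancel]
  have t2 : Tendsto (fun t => (φ.map t (A.comp y k) : C.add.Hom (φ.obj a) (φ.obj a)) -
      C.add.comp (g t) (N t)) atTop (𝓝 0) := by
    have e1 := tendsto_zero_iff_norm_tendsto_zero.2 (h.comp y k)
    have e2 := NormedGradedStarCategory.tendsto_bounded_comp (D := C.add) (f := g) (h.bounded y) t1
    have e3 := e1.add e2
    rw [add_zero] at e3
    refine e3.congr fun t => ?_
    rw [NormedGradedStarCategory.comp_sub, sub_add_sub_cancel]
  have t3 : Tendsto (fun t => g t - ((M⁻¹ : ℝ) : 𝕜) • N t - ((M⁻¹ : ℝ) : 𝕜) •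
      C.add.comp (g t) (N t)) atTop (𝓝 0) := by
    have e1 := tendsto_zero_iff_norm_tendsto_zero.2
      (h.linear ((M⁻¹ : ℝ) : 𝕜) ((M⁻¹ : ℝ) : 𝕜) k (A.comp y k))
    rw [← hy] at e1
    have e3 := (e1.add (t1.const_smul ((M⁻¹ : ℝ) : 𝕜))).add (t2.const_smul ((M⁻¹ : ℝ) : 𝕜))
    simp only [smul_zero, add_zero] at e3
    refine e3.congr fun t => ?_
    simp only [smul_sub, g]
    abel
  obtain ⟨c, hc⟩ := h.bounded y
  have hc0 : 0 ≤ c := (norm_nonneg _).trans (hc ⟨1, Set.mem_Ici.2 le_rfl⟩)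
  set κ := 1 / (4 * (1 + c) ^ 2) with hκ
  have hκ0 : 0 < κ := by positivity
  have hκ1 : κ ≤ 1 := by
    rw [hκ, div_le_one (by positivity)]
    nlinarith
  have hmem : M * (1 - κ / 4) ∈ P := by
    refine ⟨mul_nonneg hM0.le (by linarith), ?_⟩
    filter_upwards [hlt (show M < M + κ / 8 by linarith),
      (tendsto_zero_iff_norm_tendsto_zero.1 t3).eventually_le_const one_half_pos] with t h1 h2
    exact C.norm_sq_le_of_quasiInverse (f t) (g t) hc0 hM.le (hc t) h1 h2
  have := csInf_le hP hmem
  nlinarith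

end IsGradedAsymptotic

/-! ### The null-homotopy of `S ⊗̂ A → M₂(S ⊗̂ A)` -/

section Lines

variable {𝕜 : Type} [RCLike 𝕜] {E : Type v} [SeminormedAddCommGroup E] [NormedSpace 𝕜 E]

/-- The restriction of a `C₀`-function on the plane to a horizontal line. -/
def lineRestrict (g : C₀(ℂ, E)) (s : ℝ) : C₀(ℝ, E) where
  toFun r := g ⟨r, s⟩
  continuous_toFun := g.continuous.comp <| by
    have : Continuous fun r : ℝ => (r : ℂ) + (s : ℂ) * Complex.I := by fun_prop
    refine this.congr fun r => ?_
    rw [← Complex.mk_eq_add_mul_I]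
  zero_at_infty' := by
    refine g.zero_at_infty'.comp ?_
    rw [← Metric.cobounded_eq_cocompact, ← Metric.cobounded_eq_cocompact, ← comap_norm_atTop,
      ← comap_norm_atTop]
    refine tendsto_comap_iff.2 (tendsto_atTop_mono (fun r => ?_) tendsto_comap)
    exact Complex.abs_re_le_norm ⟨r, s⟩

theorem continuous_lineRestrict (g : C₀(ℂ, E)) : Continuous (lineRestrict g) := by
  rw [Metric.continuous_iff]
  intro s ε hε
  obtain ⟨δ, hδ, h⟩ := Metric.uniformContinuous_iff.1 (ZeroAtInftyContinuousMap.uniformContinuous g)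
    (ε / 2) (half_pos hε)
  refine ⟨δ, hδ, fun s' hs => ?_⟩
  rw [dist_eq_norm]
  refine lt_of_le_of_lt (norm_zeroAtInfty_le (half_pos hε).le fun r => ?_) (half_lt_self hε)
  have : dist (⟨r, s'⟩ : ℂ) ⟨r, s⟩ < δ := by
    rw [Complex.dist_of_re_eq (z := ⟨r, s'⟩) (w := ⟨r, s⟩) rfl]
    exact hs
  have := h this
  rw [dist_eq_norm] at this
  exact this.le

theorem tendsto_lineRestrict (g : C₀(ℂ, E)) : Tendsto (lineRestrict g) atTop (𝓝 0) := by
  have h := g.zero_at_infty'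
  rw [← Metric.cobounded_eq_cocompact, ← comap_norm_atTop] at h
  rw [Metric.tendsto_nhds]
  intro ε hε
  have h1 := (tendsto_zero_iff_norm_tendsto_zero.1 h).eventually_le_const (half_pos hε)
  obtain ⟨R, hR⟩ := eventually_atTop.1 (eventually_comap.1 h1)
  filter_upwards [eventually_ge_atTop R] with s hs
  rw [dist_zero_right]
  refine lt_of_le_of_lt (norm_zeroAtInfty_le (half_pos hε).le fun r => ?_) (half_lt_self hε)
  exact hR _ (hs.trans ((le_abs_self s).trans (Complex.abs_im_le_norm ⟨r, s⟩))) _ rfl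

/-- The combination with weights `(1 + p)/2` and `(1 - p)/2`. -/
def evenMix (p : 𝕜) (x y : E) : E := ((1 + p) / 2) • x + ((1 - p) / 2) • y

/-- The difference with weight `q/2`. -/
def oddMix (q : 𝕜) (x y : E) : E := (q / 2) • (x - y)

theorem continuous_smul_of_eq_zero {w : ℂ → ℝ} (hw : ∀ z, |w z| ≤ 1)
    (hw' : ∀ z, z ≠ 0 → ContinuousAt w z) {g : ℂ → E} (hg : Continuous g) (h0 : g 0 = 0) :
    Continuous fun z => ((w z : ℝ) : 𝕜) • g z := by
  refine continuous_iff_continuousAt.2 fun z => ?_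
  by_cases hz : z = 0
  · subst hz
    have h1 : Tendsto g (𝓝 0) (𝓝 0) := by
      have := hg.tendsto 0
      rwa [h0] at this
    have := tendsto_smul_zero (𝕜 := 𝕜) h1 hw
    rwa [ContinuousAt, h0, smul_zero]
  · exact ((RCLike.continuous_ofReal.continuousAt).comp (hw' z hz)).smul hg.continuousAt

/-- The function `z ↦ fₑ(|z|) + fₒ(|z|) re z / |z|` on the plane, where `f = fₑ + fₒ` is the
decomposition of `f` into its even and odd parts. -/
def planeEven (𝕜 : Type) [RCLike 𝕜] [NormedSpace 𝕜 E] (f : C₀(ℝ, E)) : C₀(ℂ, E) where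
  toFun z := evenMix ((z.re / ‖z‖ : ℝ) : 𝕜) (f ‖z‖) (f (-‖z‖))
  continuous_toFun := by
    have e : (fun z : ℂ => evenMix ((z.re / ‖z‖ : ℝ) : 𝕜) (f ‖z‖) (f (-‖z‖))) = fun z =>
        (2⁻¹ : 𝕜) • (f ‖z‖ + f (-‖z‖)) +
          ((z.re / ‖z‖ : ℝ) : 𝕜) • ((2⁻¹ : 𝕜) • (f ‖z‖ - f (-‖z‖))) := by
      funext z
      simp only [evenMix]
      module
    rw [e]
    have hf : Continuous f := f.continuous
    refine Continuous.add (by fun_prop) (continuous_smul_of_eq_zero (fun z => ?_) (fun z hz => ?_)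
      (by fun_prop) (by simp))
    · rw [abs_div, abs_norm]
      exact div_le_one_of_le₀ (Complex.abs_re_le_norm z) (norm_nonneg _)
    · exact Complex.continuous_re.continuousAt.div continuous_norm.continuousAt (norm_ne_zero_iff.2 hz)
  zero_at_infty' := by
    have h1 : Tendsto (fun z : ℂ => f ‖z‖) (cocompact ℂ) (𝓝 0) :=
      f.zero_at_infty'.comp ((tendsto_norm_cocompact_atTop (E := ℂ)).mono_right atTop_le_cocompact)
    have h2 : Tendsto (fun z : ℂ => f (-‖z‖)) (cocompact ℂ) (𝓝 0) :=
      f.zero_at_infty'.comp ((tendsto_neg_atTop_atBot.comp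
        (tendsto_norm_cocompact_atTop (E := ℂ))).mono_right atBot_le_cocompact)
    have h3 (z : ℂ) : |z.re / ‖z‖| ≤ 1 := by
      rw [abs_div, abs_norm]
      exact div_le_one_of_le₀ (Complex.abs_re_le_norm z) (norm_nonneg _)
    have h4 := ((h1.add h2).const_smul (2⁻¹ : 𝕜)).add
      (tendsto_smul_zero (𝕜 := 𝕜) (w := fun z : ℂ => z.re / ‖z‖) (K := 1)
        (by simpa using (h1.sub h2).const_smul (2⁻¹ : 𝕜)) h3)
    simp only [add_zero, smul_zero] at h4
    refine h4.congr fun z => ?_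
    simp only [evenMix]
    module

/-- The function `z ↦ fₒ(|z|) im z / |z|` on the plane, where `fₒ` is the odd part of `f`. -/
def planeOdd (𝕜 : Type) [RCLike 𝕜] [NormedSpace 𝕜 E] (f : C₀(ℝ, E)) : C₀(ℂ, E) where
  toFun z := oddMix ((z.im / ‖z‖ : ℝ) : 𝕜) (f ‖z‖) (f (-‖z‖))
  continuous_toFun := by
    have e : (fun z : ℂ => oddMix ((z.im / ‖z‖ : ℝ) : 𝕜) (f ‖z‖) (f (-‖z‖))) = fun z =>
        ((z.im / ‖z‖ : ℝ) : 𝕜) • ((2⁻¹ : 𝕜) • (f ‖z‖ - f (-‖z‖))) := by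
      funext z
      simp only [oddMix]
      module
    rw [e]
    have hf : Continuous f := f.continuous
    refine continuous_smul_of_eq_zero (fun z => ?_) (fun z hz => ?_) (by fun_prop) (by simp)
    · rw [abs_div, abs_norm]
      exact div_le_one_of_le₀ (Complex.abs_im_le_norm z) (norm_nonneg _)
    · exact Complex.continuous_im.continuousAt.div continuous_norm.continuousAt (norm_ne_zero_iff.2 hz)
  zero_at_infty' := by
    have h1 : Tendsto (fun z : ℂ => f ‖z‖) (cocompact ℂ) (𝓝 0) :=
      f.zero_at_infty'.comp ((tendsto_norm_cocompact_atTop (E := ℂ)).mono_right atTop_le_cocompact)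
    have h2 : Tendsto (fun z : ℂ => f (-‖z‖)) (cocompact ℂ) (𝓝 0) :=
      f.zero_at_infty'.comp ((tendsto_neg_atTop_atBot.comp
        (tendsto_norm_cocompact_atTop (E := ℂ))).mono_right atBot_le_cocompact)
    have h3 (z : ℂ) : |z.im / ‖z‖| ≤ 1 := by
      rw [abs_div, abs_norm]
      exact div_le_one_of_le₀ (Complex.abs_im_le_norm z) (norm_nonneg _)
    have h4 := tendsto_smul_zero (𝕜 := 𝕜) (w := fun z : ℂ => z.im / ‖z‖) (K := 1)
        (by simpa using (h1.sub h2).const_smul (2⁻¹ : 𝕜)) h3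
    refine h4.congr fun z => ?_
    simp only [oddMix]
    module

/-- In polar coordinates `r + is = ρ(p + iq)`, the values of `planeEven f` and `planeOdd f` at the
points `± r + is`. -/
theorem exists_polar (𝕜 : Type) [RCLike 𝕜] (s r : ℝ) : ∃ ρ p q : ℝ, p * p + q * q = 1 ∧
    ∀ (E : Type v) [SeminormedAddCommGroup E] [NormedSpace 𝕜 E] (f : C₀(ℝ, E)),
      lineRestrict (planeEven 𝕜 f) s r = evenMix (p : 𝕜) (f ρ) (f (-ρ)) ∧
      lineRestrict (planeEven 𝕜 f) s (-r) = evenMix (p : 𝕜) (f (-ρ)) (f ρ) ∧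
      lineRestrict (planeOdd 𝕜 f) s r = oddMix (q : 𝕜) (f ρ) (f (-ρ)) ∧
      lineRestrict (planeOdd 𝕜 f) s (-r) = oddMix (q : 𝕜) (f ρ) (f (-ρ)) := by
  set z : ℂ := ⟨r, s⟩ with hz
  have hn : ‖(⟨-r, s⟩ : ℂ)‖ = ‖z‖ := by
    simp [hz, Complex.norm_def, Complex.normSq_mk]
  by_cases h0 : z = 0
  · -- At the origin the angle is irrelevant, but `p² + q² = 1` has to be kept.
    have hr : r = 0 := congrArg Complex.re h0
    have hs : s = 0 := congrArg Complex.im h0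
    subst hr; subst hs
    refine ⟨0, 1, 0, by norm_num, fun E _ _ f => ?_⟩
    have e (x : E) (p : 𝕜) : evenMix p x x = x := by simp only [evenMix]; module
    have e' (x : E) (p : 𝕜) : oddMix p x x = 0 := by simp only [oddMix]; module
    have h1 : (⟨0, 0⟩ : ℂ) = 0 := rfl
    simp only [lineRestrict, planeEven, planeOdd, ZeroAtInftyContinuousMap.coe_mk, neg_zero, h1, e, e',
      norm_zero, and_self]
  · refine ⟨‖z‖, z.re / ‖z‖, z.im / ‖z‖, ?_, fun E _ _ f => ⟨rfl, ?_, rfl, ?_⟩⟩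
    · have h1 : ‖z‖ ≠ 0 := norm_ne_zero_iff.2 h0
      have h2 : z.re * z.re + z.im * z.im = ‖z‖ * ‖z‖ := by
        rw [← pow_two ‖z‖, Complex.sq_norm, Complex.normSq_apply]
      field_simp
      linarith
    · simp only [lineRestrict, planeEven, ZeroAtInftyContinuousMap.coe_mk, hn, evenMix]
      push_cast
      module
    · simp only [lineRestrict, planeOdd, ZeroAtInftyContinuousMap.coe_mk, hn]
      rfl

end Lines

namespace GradedCStarCategory

variable {𝕜 : Type} [RCLike 𝕜] (A : GradedCStarCategory.{u, v} 𝕜)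

section

variable {A} {a b c : A.Ob} {p q : 𝕜}

theorem evenMix_comp (h : p * p + q * q = 1) (x x' : A.Hom b c) (y y' : A.Hom a b) :
    evenMix p (A.comp x y) (A.comp x' y') =
      A.comp (evenMix p x x') (evenMix p y y') + A.comp (oddMix q x x') (oddMix q y y') := by
  simp only [evenMix, oddMix, sub_eq_add_neg, ← neg_one_smul 𝕜 x', ← neg_one_smul 𝕜 y', smul_add,
    A.laws.add_comp, A.laws.comp_add, A.laws.smul_comp, A.laws.comp_smul]
  linear_combination (norm := module) (-h) • ((1 / 4 : 𝕜) • (A.comp x y - A.comp x y' -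
    A.comp x' y + A.comp x' y'))

theorem oddMix_comp (x x' : A.Hom b c) (y y' : A.Hom a b) :
    oddMix q (A.comp x y) (A.comp x' y') =
      A.comp (evenMix p x x') (oddMix q y y') + A.comp (oddMix q x x') (evenMix p y' y) := by
  simp only [evenMix, oddMix, sub_eq_add_neg, ← neg_one_smul 𝕜 x', ← neg_one_smul 𝕜 y', smul_add,
    ← neg_one_smul 𝕜 (A.comp x' y'),
    A.laws.add_comp, A.laws.comp_add, A.laws.smul_comp, A.laws.comp_smul]
  module

theorem star_evenMix (t : ℝ) (x y : A.Hom a b) :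
    A.star (evenMix (t : 𝕜) x y) = evenMix (t : 𝕜) (A.star x) (A.star y) := by
  simp [evenMix, A.laws.star_add, A.laws.star_smul, map_ofNat (starRingEnd 𝕜) 2]

theorem star_oddMix (t : ℝ) (x y : A.Hom a b) :
    A.star (oddMix (t : 𝕜) x y) = oddMix (t : 𝕜) (A.star x) (A.star y) := by
  simp [oddMix, sub_eq_add_neg, A.laws.star_add, A.laws.star_smul, star_neg,
    map_ofNat (starRingEnd 𝕜) 2]

theorem evenMix_add (x x' y y' : A.Hom a b) :
    evenMix p (x + x') (y + y') = evenMix p x y + evenMix p x' y' := by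
  simp only [evenMix]; module

theorem evenMix_smul (t : 𝕜) (x y : A.Hom a b) :
    evenMix p (t • x) (t • y) = t • evenMix p x y := by
  simp only [evenMix]; module

theorem evenMix_neg (x y : A.Hom a b) : evenMix p (-x) (-y) = -evenMix p x y := by
  simp only [evenMix]; module

theorem oddMix_add (x x' y y' : A.Hom a b) :
    oddMix q (x + x') (y + y') = oddMix q x y + oddMix q x' y' := by
  simp only [oddMix]; module

theorem oddMix_smul (t : 𝕜) (x y : A.Hom a b) :
    oddMix q (t • x) (t • y) = t • oddMix q x y := by
  simp only [oddMix]; module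

theorem oddMix_swap (x y : A.Hom a b) : oddMix q y x = -oddMix q x y := by
  simp only [oddMix]; module

theorem oddMix_neg (x y : A.Hom a b) : oddMix q (-x) (-y) = -oddMix q x y := by
  simp only [oddMix]; module

theorem grade_evenMix (x y : A.Hom a b) :
    A.grade (evenMix p x y) = evenMix p (A.grade x) (A.grade y) := by
  simp [evenMix, A.laws.grade_add, A.laws.grade_smul]

theorem grade_neg (x : A.Hom a b) : A.grade (-x) = -A.grade x := by
  simpa using A.laws.grade_smul (-1) x

theorem grade_oddMix (x y : A.Hom a b) :
    A.grade (oddMix q x y) = oddMix q (A.grade x) (A.grade y) := by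
  simp [oddMix, sub_eq_add_neg, A.laws.grade_add, A.laws.grade_smul, grade_neg]

end

/-- The diagonal part of the rotation at height `s`. -/
def rotEven {a b : A.Ob} (s : ℝ) (F : A.suspHom a b) : A.suspHom a b :=
  ⟨(lineRestrict (planeEven 𝕜 F.1.1) s, lineRestrict (planeEven 𝕜 F.1.2) s), by
    obtain ⟨h1, h2⟩ := F.2
    refine ⟨fun r => ?_, fun r => ?_⟩ <;> obtain ⟨ρ, p, q, -, h⟩ := exists_polar.{v} 𝕜 s r
    · change A.grade (lineRestrict (planeEven 𝕜 F.1.1) s r) = lineRestrict (planeEven 𝕜 F.1.1) s r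
      rw [(h _ F.1.1).1, grade_evenMix, h1, h1]
    · change A.grade (lineRestrict (planeEven 𝕜 F.1.2) s r) = -lineRestrict (planeEven 𝕜 F.1.2) s r
      rw [(h _ F.1.2).1, grade_evenMix, h2, h2, evenMix_neg]⟩

/-- The off-diagonal part of the rotation at height `s`. -/
def rotOdd {a b : A.Ob} (s : ℝ) (F : A.suspHom a b) : A.suspHom a b :=
  ⟨(lineRestrict (planeOdd 𝕜 F.1.1) s, -lineRestrict (planeOdd 𝕜 F.1.2) s), by
    obtain ⟨h1, h2⟩ := F.2
    refine ⟨fun r => ?_, fun r => ?_⟩ <;> obtain ⟨ρ, p, q, -, h⟩ := exists_polar.{v} 𝕜 s r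
    · change A.grade (lineRestrict (planeOdd 𝕜 F.1.1) s r) = lineRestrict (planeOdd 𝕜 F.1.1) s r
      rw [(h _ F.1.1).2.2.1, grade_oddMix, h1, h1]
    · change A.grade (-lineRestrict (planeOdd 𝕜 F.1.2) s r) = - -lineRestrict (planeOdd 𝕜 F.1.2) s r
      rw [(h _ F.1.2).2.2.1, grade_neg, grade_oddMix, h2, h2, oddMix_neg]⟩

/-- The values of the rotated functions, in polar coordinates. -/
theorem exists_rot_eq (s r : ℝ) : ∃ ρ p q : ℝ, (p : 𝕜) * p + q * q = 1 ∧
    ∀ {a b : A.Ob} (F : A.suspHom a b),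
      (A.rotEven s F).1.1 r = evenMix (p : 𝕜) (F.1.1 ρ) (F.1.1 (-ρ)) ∧
      (A.rotEven s F).1.1 (-r) = evenMix (p : 𝕜) (F.1.1 (-ρ)) (F.1.1 ρ) ∧
      (A.rotEven s F).1.2 r = evenMix (p : 𝕜) (F.1.2 ρ) (F.1.2 (-ρ)) ∧
      (A.rotEven s F).1.2 (-r) = evenMix (p : 𝕜) (F.1.2 (-ρ)) (F.1.2 ρ) ∧
      (A.rotOdd s F).1.1 r = oddMix (q : 𝕜) (F.1.1 ρ) (F.1.1 (-ρ)) ∧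
      (A.rotOdd s F).1.1 (-r) = oddMix (q : 𝕜) (F.1.1 ρ) (F.1.1 (-ρ)) ∧
      (A.rotOdd s F).1.2 r = oddMix (q : 𝕜) (F.1.2 (-ρ)) (F.1.2 ρ) ∧
      (A.rotOdd s F).1.2 (-r) = oddMix (q : 𝕜) (F.1.2 (-ρ)) (F.1.2 ρ) := by
  obtain ⟨ρ, p, q, hpq, h⟩ := exists_polar.{v} 𝕜 s r
  refine ⟨ρ, p, q, by rw [← RCLike.ofReal_mul, ← RCLike.ofReal_mul, ← RCLike.ofReal_add, hpq,
    RCLike.ofReal_one], fun F => ?_⟩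
  obtain ⟨h1, h2, h3, h4⟩ := h _ F.1.1
  obtain ⟨k1, k2, k3, k4⟩ := h _ F.1.2
  refine ⟨h1, h2, k1, k2, h3, h4, ?_, ?_⟩
  · rw [oddMix_swap, ← k3]; rfl
  · rw [oddMix_swap, ← k4]; rfl

section

variable {A} {a b c : A.Ob} (s : ℝ) (F F' : A.suspHom b c) (G : A.suspHom a b)

theorem rotEven_comp : A.rotEven s (A.suspComp F G) =
    A.suspComp (A.rotEven s F) (A.rotEven s G) +
      A.suspComp (A.rotOdd s F) (A.suspGrade (A.rotOdd s G)) := by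
  refine A.suspHom_ext (fun r => ?_) fun r => ?_ <;>
    obtain ⟨ρ, p, q, hpq, h⟩ := A.exists_rot_eq s r <;>
    obtain ⟨f1, f2, f3, f4, f5, f6, f7, f8⟩ := h F <;>
    obtain ⟨g1, g2, g3, g4, g5, g6, g7, g8⟩ := h G <;>
    obtain ⟨k1, k2, k3, k4, k5, k6, k7, k8⟩ := h (A.suspComp F G)
  · simp only [susp_add_fst, suspComp_fst, suspGrade_fst, suspGrade_snd, neg_neg, k1, f1, f3, f5, f7,
      g1, g4, g6, g7, evenMix_add, evenMix_comp hpq]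
    rw [oddMix_swap (F.1.2 ρ), comp_neg, neg_comp]
    abel
  · simp only [susp_add_snd, suspComp_snd, suspGrade_fst, suspGrade_snd, neg_neg, k3, f1, f3, f5, f7,
      g2, g3, g5, g8, evenMix_add, evenMix_comp hpq]
    rw [oddMix_swap (F.1.2 ρ), oddMix_swap (G.1.1 ρ), oddMix_swap (G.1.2 ρ)]
    simp only [comp_neg, neg_comp, neg_neg]
    abel

theorem rotOdd_comp : A.rotOdd s (A.suspComp F G) =
    A.suspComp (A.rotEven s F) (A.rotOdd s G) +
      A.suspComp (A.rotOdd s F) (A.suspGrade (A.rotEven s G)) := by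
  refine A.suspHom_ext (fun r => ?_) fun r => ?_ <;>
    obtain ⟨ρ, p, q, hpq, h⟩ := A.exists_rot_eq s r <;>
    obtain ⟨f1, f2, f3, f4, f5, f6, f7, f8⟩ := h F <;>
    obtain ⟨g1, g2, g3, g4, g5, g6, g7, g8⟩ := h G <;>
    obtain ⟨k1, k2, k3, k4, k5, k6, k7, k8⟩ := h (A.suspComp F G)
  · simp only [susp_add_fst, suspComp_fst, suspGrade_fst, suspGrade_snd, neg_neg, k5, f1, f3, f5, f7,
      g2, g3, g5, g8, oddMix_add, oddMix_comp (p := (p : 𝕜))]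
    rw [oddMix_swap (F.1.2 ρ)]
    simp only [comp_neg, neg_comp, neg_neg]
    abel
  · simp only [susp_add_snd, suspComp_snd, suspGrade_fst, suspGrade_snd, neg_neg, k7, f1, f3, f5, f7,
      g1, g4, g6, g7, oddMix_add]
    rw [oddMix_swap (A.comp (F.1.1 ρ) _), oddMix_swap (A.comp (F.1.2 ρ) _),
      oddMix_comp (p := (p : 𝕜)), oddMix_comp (p := (p : 𝕜)),
      oddMix_swap (F.1.2 ρ), oddMix_swap (G.1.1 ρ), oddMix_swap (G.1.2 ρ)]
    simp only [comp_neg, neg_comp]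
    abel

theorem rotEven_star : A.rotEven s (A.suspStar F) = A.suspStar (A.rotEven s F) := by
  refine A.suspHom_ext (fun r => ?_) fun r => ?_ <;>
    obtain ⟨ρ, p, q, hpq, h⟩ := A.exists_rot_eq s r <;>
    obtain ⟨f1, f2, f3, f4, f5, f6, f7, f8⟩ := h F <;>
    obtain ⟨k1, k2, k3, k4, k5, k6, k7, k8⟩ := h (A.suspStar F)
  · simp only [k1, suspStar_fst, f1, star_evenMix]
  · simp only [k3, suspStar_snd, f4, star_evenMix, neg_neg]

theorem rotOdd_star : A.rotOdd s (A.suspStar F) = A.suspStar (A.suspGrade (A.rotOdd s F)) := by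
  refine A.suspHom_ext (fun r => ?_) fun r => ?_ <;>
    obtain ⟨ρ, p, q, hpq, h⟩ := A.exists_rot_eq s r <;>
    obtain ⟨f1, f2, f3, f4, f5, f6, f7, f8⟩ := h F <;>
    obtain ⟨k1, k2, k3, k4, k5, k6, k7, k8⟩ := h (A.suspStar F)
  · simp only [k5, suspStar_fst, suspGrade_fst, f6, star_oddMix]
  · simp only [k7, suspStar_snd, suspGrade_snd, f7, neg_neg, star_oddMix, star_neg]
    rw [oddMix_swap]

theorem rotEven_grade : A.rotEven s (A.suspGrade F) = A.suspGrade (A.rotEven s F) := by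
  refine A.suspHom_ext (fun r => ?_) fun r => ?_ <;>
    obtain ⟨ρ, p, q, hpq, h⟩ := A.exists_rot_eq s r <;>
    obtain ⟨f1, f2, f3, f4, f5, f6, f7, f8⟩ := h F <;>
    obtain ⟨k1, k2, k3, k4, k5, k6, k7, k8⟩ := h (A.suspGrade F)
  · simp only [k1, suspGrade_fst, f2, neg_neg]
  · simp only [k3, suspGrade_snd, f4, neg_neg, evenMix_neg]

theorem rotOdd_grade : A.rotOdd s (A.suspGrade F) = -A.suspGrade (A.rotOdd s F) := by
  refine A.suspHom_ext (fun r => ?_) fun r => ?_ <;>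
    obtain ⟨ρ, p, q, hpq, h⟩ := A.exists_rot_eq s r <;>
    obtain ⟨f1, f2, f3, f4, f5, f6, f7, f8⟩ := h F <;>
    obtain ⟨k1, k2, k3, k4, k5, k6, k7, k8⟩ := h (A.suspGrade F)
  · change _ = -(A.suspGrade (A.rotOdd s F)).1.1 r
    simp only [k5, suspGrade_fst, f6, neg_neg]
    rw [oddMix_swap]
  · change _ = -(A.suspGrade (A.rotOdd s F)).1.2 r
    simp only [k7, suspGrade_snd, f8, neg_neg, oddMix_neg]
    rw [oddMix_swap, neg_neg]

theorem rotEven_linear (t t' : 𝕜) :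
    A.rotEven s (t • F + t' • F') = t • A.rotEven s F + t' • A.rotEven s F' := by
  refine A.suspHom_ext (fun r => ?_) fun r => ?_ <;>
    obtain ⟨ρ, p, q, hpq, h⟩ := A.exists_rot_eq s r <;>
    obtain ⟨f1, f2, f3, f4, f5, f6, f7, f8⟩ := h F <;>
    obtain ⟨g1, g2, g3, g4, g5, g6, g7, g8⟩ := h F' <;>
    obtain ⟨k1, k2, k3, k4, k5, k6, k7, k8⟩ := h (t • F + t' • F')
  · simp only [k1, susp_add_fst, susp_smul_fst, f1, g1, evenMix_add, evenMix_smul]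
  · simp only [k3, susp_add_snd, susp_smul_snd, f3, g3, evenMix_add, evenMix_smul]

theorem rotOdd_linear (t t' : 𝕜) :
    A.rotOdd s (t • F + t' • F') = t • A.rotOdd s F + t' • A.rotOdd s F' := by
  refine A.suspHom_ext (fun r => ?_) fun r => ?_ <;>
    obtain ⟨ρ, p, q, hpq, h⟩ := A.exists_rot_eq s r <;>
    obtain ⟨f1, f2, f3, f4, f5, f6, f7, f8⟩ := h F <;>
    obtain ⟨g1, g2, g3, g4, g5, g6, g7, g8⟩ := h F' <;>
    obtain ⟨k1, k2, k3, k4, k5, k6, k7, k8⟩ := h (t • F + t' • F')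
  · simp only [k5, susp_add_fst, susp_smul_fst, f5, g5, oddMix_add, oddMix_smul]
  · simp only [k7, susp_add_snd, susp_smul_snd, f7, g7, oddMix_add, oddMix_smul]

end

end GradedCStarCategory

section

variable {𝕜 : Type} [RCLike 𝕜] {E : Type v} [SeminormedAddCommGroup E] [NormedSpace 𝕜 E]

theorem lineRestrict_planeEven_zero (f : C₀(ℝ, E)) (r : ℝ) :
    lineRestrict (planeEven 𝕜 f) 0 r = f r := by
  have hn : ‖(⟨r, 0⟩ : ℂ)‖ = |r| := Complex.norm_real r
  change evenMix ((r / ‖(⟨r, 0⟩ : ℂ)‖ : ℝ) : 𝕜) (f ‖(⟨r, 0⟩ : ℂ)‖) (f (-‖(⟨r, 0⟩ : ℂ)‖)) = f r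
  rw [hn]
  rcases lt_trichotomy r 0 with h | h | h
  · rw [abs_of_neg h, neg_neg, div_neg, div_self h.ne, evenMix]
    push_cast
    module
  · subst h
    simp only [evenMix, abs_zero, neg_zero]
    module
  · rw [abs_of_pos h, div_self h.ne', evenMix]
    push_cast
    module

theorem lineRestrict_planeOdd_zero (f : C₀(ℝ, E)) (r : ℝ) :
    lineRestrict (planeOdd 𝕜 f) 0 r = 0 := by
  change oddMix (((0 : ℝ) / ‖(⟨r, 0⟩ : ℂ)‖ : ℝ) : 𝕜) _ _ = 0
  simp [oddMix]

/-- A path on `[0,∞)` that converges at infinity, reparametrized by `[0,1]`. -/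
theorem continuous_reparametrize {X : Type*} [TopologicalSpace X] {k : ℝ → X} {x : X}
    (hk : Continuous k) (h : Tendsto k atTop (𝓝 x)) :
    Continuous fun u : unitInterval => if u = 1 then x else k (u / (1 - u)) := by
  have hc : Continuous fun u : unitInterval => (1 - u : ℝ) := by fun_prop
  refine continuous_iff_continuousAt.2 fun u => ?_
  by_cases hu : u = 1
  · subst hu
    refine continuousAt_iff_punctured_nhds.2 ?_
    rw [if_pos rfl]
    have h1 : Tendsto (fun u : unitInterval => (1 - u : ℝ)) (𝓝[≠] 1) (𝓝[>] 0) := by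
      refine tendsto_nhdsWithin_iff.2 ⟨?_, ?_⟩
      · have := (hc.tendsto 1).mono_left (nhdsWithin_le_nhds (s := {1}ᶜ))
        simpa using this
      · filter_upwards [self_mem_nhdsWithin] with u hu
        exact sub_pos.2 (lt_of_le_of_ne u.2.2 fun h => hu (Subtype.ext h))
    have h2 : Tendsto (fun u : unitInterval => (u : ℝ)) (𝓝[≠] 1) (𝓝 1) :=
      (continuous_subtype_val.tendsto (1 : unitInterval)).mono_left nhdsWithin_le_nhds
    have h3 := h.comp (h2.pos_mul_atTop one_pos (tendsto_inv_nhdsGT_zero.comp h1))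
    refine h3.congr' ?_
    filter_upwards [self_mem_nhdsWithin] with u hu
    rw [if_neg (show ¬u = 1 from hu)]
    rfl
  · have h0 : (1 - u : ℝ) ≠ 0 := fun h => hu (Subtype.ext (sub_eq_zero.1 h).symm)
    have h1 : ContinuousAt (fun u : unitInterval => k (u / (1 - u))) u :=
      hk.continuousAt.comp (continuous_subtype_val.continuousAt.div hc.continuousAt h0)
    refine h1.congr ?_
    filter_upwards [isOpen_compl_singleton.mem_nhds hu] with v hv
    rw [if_neg (show ¬v = 1 from hv)]

end

namespace GradedCStarCategory

variable {𝕜 : Type} [RCLike 𝕜] (A : GradedCStarCategory.{u, v} 𝕜)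

/-- The sign `-1` of the off-diagonal entries of a `2 × 2` matrix. -/
def offSign (𝕜 : Type) [RCLike 𝕜] (i j : Bool) : 𝕜 := if i = j then 1 else -1

/-- The entry `(i, j)` of the matrix `[[G F, H F], [δ H F, δ G F]]`, where `G` and `H` are the
diagonal and the off-diagonal part of the rotation at height `s`. -/
def rot {a b : A.Ob} (s : ℝ) (F : A.suspHom a b) : Bool → Bool → A.suspHom a b
  | false, false => A.rotEven s F
  | false, true => A.rotOdd s F
  | true, false => A.suspGrade (A.rotOdd s F)
  | true, true => A.suspGrade (A.rotEven s F)

section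

variable {A} {a b c : A.Ob} (s : ℝ) (F F' : A.suspHom b c) (G : A.suspHom a b) (i j : Bool)

theorem suspGrade_neg : A.suspGrade (-F) = -A.suspGrade F := by
  simpa using A.suspLaws.grade_smul (-1) F

theorem rot_comp : A.rot s (A.suspComp F G) i j =
    ∑ k, A.suspComp (A.rot s F i k) (A.rot s G k j) := by
  rw [Fintype.sum_bool]
  rcases i with _ | _ <;> rcases j with _ | _
  · simp only [rot, rotEven_comp, add_comm]
  · simp only [rot, rotOdd_comp, add_comm]
  · simp only [rot, rotOdd_comp, A.suspLaws.grade_add, A.suspLaws.grade_comp,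
      A.suspLaws.grade_grade]
  · simp only [rot, rotEven_comp, A.suspLaws.grade_add, A.suspLaws.grade_comp,
      A.suspLaws.grade_grade]

theorem rot_star : A.rot s (A.suspStar F) i j = A.suspStar (A.rot s F j i) := by
  rcases i with _ | _ <;> rcases j with _ | _
  · simp only [rot, rotEven_star]
  · simp only [rot, rotOdd_star]
  · simp only [rot, rotOdd_star, A.suspLaws.grade_star, A.suspLaws.grade_grade]
  · simp only [rot, rotEven_star, A.suspLaws.grade_star]

theorem rot_grade : A.suspGrade (A.rot s F i j) = offSign 𝕜 i j • A.rot s (A.suspGrade F) i j := by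
  rcases i with _ | _ <;> rcases j with _ | _
  · simp [rot, offSign, rotEven_grade]
  · simp [rot, offSign, rotOdd_grade]
  · simp [rot, offSign, rotOdd_grade, suspGrade_neg]
  · simp [rot, offSign, rotEven_grade]

theorem rot_linear (t t' : 𝕜) :
    A.rot s (t • F + t' • F') i j = t • A.rot s F i j + t' • A.rot s F' i j := by
  rcases i with _ | _ <;> rcases j with _ | _
  · simp only [rot, rotEven_linear]
  · simp only [rot, rotOdd_linear]
  · simp only [rot, rotOdd_linear, A.suspLaws.grade_add, A.suspLaws.grade_smul]
  · simp only [rot, rotEven_linear, A.suspLaws.grade_add, A.suspLaws.grade_smul]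

theorem rotEven_zero : A.rotEven 0 F = F :=
  A.suspHom_ext (lineRestrict_planeEven_zero _) (lineRestrict_planeEven_zero _)

theorem rotOdd_zero : A.rotOdd 0 F = 0 := by
  refine A.suspHom_ext (lineRestrict_planeOdd_zero (𝕜 := 𝕜) _) fun r => ?_
  exact (congrArg Neg.neg (lineRestrict_planeOdd_zero (𝕜 := 𝕜) F.1.2 r)).trans neg_zero

theorem continuous_suspGrade : Continuous (A.suspGrade : A.suspHom a b → A.suspHom a b) := by
  refine AddMonoidHomClass.continuous_of_bound
    (AddMonoidHom.mk' (A.suspGrade : A.suspHom a b → A.suspHom a b) A.suspLaws.grade_add) 1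
    fun F => ?_
  rw [one_mul]
  exact norm_susp_le (norm_nonneg _) (fun r => norm_susp_fst_le F (-r))
    fun r => (norm_neg _).le.trans (norm_susp_snd_le F (-r))

theorem suspGrade_zero : A.suspGrade (0 : A.suspHom a b) = 0 := by
  simpa using A.suspLaws.grade_smul 0 (0 : A.suspHom a b)

theorem continuous_rot : Continuous fun s => A.rot s G i j := by
  have h1 : Continuous fun s => A.rotEven s G :=
    ((continuous_lineRestrict _).prodMk (continuous_lineRestrict _)).subtype_mk _
  have h2 : Continuous fun s => A.rotOdd s G :=
    ((continuous_lineRestrict _).prodMk (continuous_lineRestrict _).neg).subtype_mk _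
  rcases i with _ | _ <;> rcases j with _ | _
  exacts [h1, h2, continuous_suspGrade.comp h2, continuous_suspGrade.comp h1]

theorem tendsto_rot : Tendsto (fun s => A.rot s G i j) atTop (𝓝 0) := by
  have h1 : Tendsto (fun s => A.rotEven s G) atTop (𝓝 0) :=
    tendsto_subtype_rng.2 ((tendsto_lineRestrict _).prodMk_nhds (tendsto_lineRestrict _))
  have h2 : Tendsto (fun s => A.rotOdd s G) atTop (𝓝 0) := by
    refine tendsto_subtype_rng.2 ?_
    have := (tendsto_lineRestrict (planeOdd 𝕜 G.1.1)).prodMk_nhds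
      (tendsto_lineRestrict (planeOdd 𝕜 G.1.2)).neg
    rwa [neg_zero] at this
  have h3 {f : ℝ → A.suspHom a b} (hf : Tendsto f atTop (𝓝 0)) :
      Tendsto (fun s => A.suspGrade (f s)) atTop (𝓝 0) := by
    have := (continuous_suspGrade.tendsto (0 : A.suspHom a b)).comp hf
    rwa [suspGrade_zero] at this
  rcases i with _ | _ <;> rcases j with _ | _
  exacts [h1, h2, h3 h2, h3 h1]

variable (A) in
/-- The path, parametrized by `u ∈ [0,1]`, of the matrix entries `rot s F i j`, for
`s = u / (1 - u)`. -/
def rotPath (i j : Bool) (G : A.suspHom a b) : C(unitInterval, A.suspHom a b) :=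
  ⟨fun u => if u = 1 then 0 else A.rot (u / (1 - u)) G i j,
    continuous_reparametrize (continuous_rot G i j) (tendsto_rot G i j)⟩

variable (u : unitInterval)

theorem rotPath_one : A.rotPath i j G 1 = 0 := if_pos rfl

theorem rotPath_zero : A.rotPath i j G 0 = A.rot 0 G i j := by
  have : (0 : unitInterval) ≠ 1 := zero_ne_one
  simp [rotPath, this]

theorem rotPath_comp : A.rotPath i j (A.suspComp F G) u =
    ∑ k, A.suspComp (A.rotPath i k F u) (A.rotPath k j G u) := by
  by_cases hu : u = 1
  · subst hu
    have h0 : A.suspComp (0 : A.suspHom b c) (0 : A.suspHom a b) = 0 := by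
      simpa using A.suspLaws.smul_comp 0 (0 : A.suspHom b c) (0 : A.suspHom a b)
    simp only [rotPath_one, h0, Finset.sum_const_zero]
  · simp only [rotPath, ContinuousMap.coe_mk, if_neg hu, rot_comp]

theorem rotPath_star : A.rotPath i j (A.suspStar F) u = A.suspStar (A.rotPath j i F u) := by
  by_cases hu : u = 1
  · subst hu
    have h0 : A.suspStar (0 : A.suspHom b c) = 0 := by
      simpa using A.suspLaws.star_smul 0 (0 : A.suspHom b c)
    simp only [rotPath_one, h0]
  · simp only [rotPath, ContinuousMap.coe_mk, if_neg hu, rot_star]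

theorem rotPath_grade :
    A.suspGrade (A.rotPath i j F u) = offSign 𝕜 i j • A.rotPath i j (A.suspGrade F) u := by
  by_cases hu : u = 1
  · subst hu
    simp only [rotPath_one, suspGrade_zero, smul_zero]
  · simp only [rotPath, ContinuousMap.coe_mk, if_neg hu, rot_grade]

theorem rotPath_linear (t t' : 𝕜) :
    A.rotPath i j (t • F + t' • F') u = t • A.rotPath i j F u + t' • A.rotPath i j F' u := by
  by_cases hu : u = 1
  · subst hu
    simp only [rotPath_one, smul_zero, add_zero]
  · simp only [rotPath, ContinuousMap.coe_mk, if_neg hu, rot_linear]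

end

end GradedCStarCategory

/-! ### Reversing the gradings of the Hilbert spaces -/

namespace GradedCStarCategory

variable {𝕜 : Type} [RCLike 𝕜] {B : GradedCStarCategory.{u, v} 𝕜}

/-- The object `b ⊗ H` or `b ⊗ Hᵒᵖᵖ`, according to the value of a Boolean. -/
def TensorOb.tw : Bool → B.TensorOb → B.TensorOb
  | false, p => p
  | true, p => p.opp

/-- An operator `ρ(b) ⊗ H → ρ(b') ⊗ H'`, regarded as an operator between the same Hilbert spaces
with possibly reversed gradings of `H` and `H'`, independently of each other. -/
def repTw (ρ : B.Reps) (p q : B.TensorOb) : ∀ i j : Bool,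
    (B.repSpace ρ p →L[𝕜] B.repSpace ρ q) →
      (B.repSpace ρ (TensorOb.tw j p) →L[𝕜] B.repSpace ρ (TensorOb.tw i q))
  | false, false => fun T => T
  | false, true => fun T => T
  | true, false => fun T => T
  | true, true => fun T => T

section

variable (ρ : B.Reps) (p q r : B.TensorOb) (i j k : Bool)

theorem norm_repTw_le (T : B.repSpace ρ p →L[𝕜] B.repSpace ρ q) : ‖repTw ρ p q i j T‖ ≤ ‖T‖ := by
  cases i <;> cases j <;>
    exact ContinuousLinearMap.opNorm_le_bound _ (norm_nonneg _) fun x =>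
      T.le_opNorm (show B.repSpace ρ p from x)

theorem repTw_add (T T' : B.repSpace ρ p →L[𝕜] B.repSpace ρ q) :
    repTw ρ p q i j (T + T') = repTw ρ p q i j T + repTw ρ p q i j T' := by
  cases i <;> cases j <;> exact ContinuousLinearMap.ext fun _ => rfl

theorem repTw_smul (c : 𝕜) (T : B.repSpace ρ p →L[𝕜] B.repSpace ρ q) :
    repTw ρ p q i j (c • T) = c • repTw ρ p q i j T := by
  cases i <;> cases j <;> exact ContinuousLinearMap.ext fun _ => rfl

theorem repTw_comp (T : B.repSpace ρ q →L[𝕜] B.repSpace ρ r)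
    (T' : B.repSpace ρ p →L[𝕜] B.repSpace ρ q) :
    repTw ρ p r i j (T ∘L T') = repTw ρ q r i k T ∘L repTw ρ p q k j T' := by
  cases i <;> cases j <;> cases k <;> exact ContinuousLinearMap.ext fun _ => rfl

theorem repTw_adjoint (T : B.repSpace ρ p →L[𝕜] B.repSpace ρ q) :
    repTw ρ q p i j (ContinuousLinearMap.adjoint T) =
      ContinuousLinearMap.adjoint (repTw ρ p q j i T) := by
  cases i <;> cases j <;> rfl

theorem repEps_tw : B.repEps ρ (TensorOb.tw i p) =
    repTw ρ p p i i ((if i then (-1 : 𝕜) else 1) • B.repEps ρ p) := by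
  cases i
  · exact (one_smul 𝕜 (B.repEps ρ p)).symm
  · have h : opTensor (ρ.obj p.ob).eps (-p.hilb.eps) = -B.repEps ρ p := opTensor_neg_right _ _
    exact h.trans (neg_one_smul 𝕜 (B.repEps ρ p)).symm

theorem repEps_comp_repTw (T : B.repSpace ρ p →L[𝕜] B.repSpace ρ q) :
    B.repEps ρ (TensorOb.tw i q) ∘L repTw ρ p q i j T ∘L B.repEps ρ (TensorOb.tw j p) =
      offSign 𝕜 i j • repTw ρ p q i j (B.repEps ρ q ∘L T ∘L B.repEps ρ p) := by
  rw [repEps_tw, repEps_tw, ← repTw_comp, ← repTw_comp, ← repTw_smul]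
  congr 1
  cases i <;> cases j <;> simp [offSign]

end

variable {p q r : B.TensorOb} (i j k : Bool)

/-- The same for families of operators. -/
def famTw (z : B.Fam p q) : B.Fam (TensorOb.tw j p) (TensorOb.tw i q) :=
  ⟨fun ρ => repTw ρ p q i j (z ρ), memℓp_infty ⟨‖z‖, by
    rintro _ ⟨ρ, rfl⟩; exact (norm_repTw_le ρ p q i j _).trans (z.norm_apply_le ρ)⟩⟩

theorem famTw_mem {z : B.Fam p q} (hz : z ∈ tensorHom p q) :
    famTw i j z ∈ tensorHom (TensorOb.tw j p) (TensorOb.tw i q) := by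
  let L : B.Fam p q →ₗ[𝕜] B.Fam (TensorOb.tw j p) (TensorOb.tw i q) :=
    { toFun := famTw i j
      map_add' := fun _ _ => Fam.ext fun _ => repTw_add _ _ _ _ _ _ _
      map_smul' := fun _ _ => Fam.ext fun _ => repTw_smul _ _ _ _ _ _ _ }
  refine mem_of_mem_closure_span (L.mkContinuous 1 fun z => by
    rw [one_mul]
    exact Fam.norm_le (norm_nonneg _) fun ρ =>
      (norm_repTw_le ρ p q i j _).trans (z.norm_apply_le ρ)) isClosed_tensorHom ?_ hz
  rintro z ⟨d, x, k, hx, hk, rfl⟩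
  -- Only the grading operator of the target enters into the definition of `elem d x k`.
  have h1 : ((-q.hilb.eps) ^ d) ∘L ((-1 : 𝕜) ^ d • k) = (q.hilb.eps ^ d) ∘L k :=
    neg_pow_comp_smul _ _ _
  refine elems_subset ?_
  cases i <;> cases j
  · exact ⟨d, x, k, hx, hk, rfl⟩
  · exact ⟨d, x, k, hx, hk, rfl⟩
  all_goals
    refine ⟨d, x, (-1 : 𝕜) ^ d • k, hx, hk.smul _, Fam.ext fun ρ => ?_⟩
    change opTensor (ρ.map x) ((q.hilb.eps ^ d) ∘L k) =
      opTensor (ρ.map x) (((-q.hilb.eps) ^ d) ∘L ((-1 : 𝕜) ^ d • k))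
    rw [h1]

variable {p q r : B.tensorK.spatial.Ob}

/-- The object `b ⊗ H` or `b ⊗ Hᵒᵖᵖ`, as an object of `B ⊗̂ K` with the spatial norm. -/
def twOb (p : B.tensorK.spatial.Ob) : B.tensorK.spatial.Ob :=
  B.tensorK.toSpatial (TensorOb.tw (B := B) i p)

/-- A morphism `b ⊗ H → b' ⊗ H'` of `B ⊗̂ K`, regarded as a morphism between the objects in which
the gradings of `H` and `H'` may be reversed. -/
def twist (z : B.tensorK.spatial.Hom p q) : B.tensorK.spatial.Hom (twOb j p) (twOb i q) :=
  (⟨famTw i j z.1, famTw_mem i j z.2⟩ : tensorHom (TensorOb.tw (B := B) j p) (TensorOb.tw i q))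

theorem twist_add (z w : B.tensorK.spatial.Hom p q) :
    twist i j (z + w) = twist i j z + twist i j w :=
  Subtype.ext (Fam.ext fun ρ => repTw_add ρ p q i j (z.1.1 ρ) (w.1.1 ρ))

theorem twist_smul (c : 𝕜) (z : B.tensorK.spatial.Hom p q) :
    twist i j (c • z) = c • twist i j z :=
  Subtype.ext (Fam.ext fun ρ => repTw_smul ρ p q i j c (z.1.1 ρ))

theorem twist_comp (z : B.tensorK.spatial.Hom q r) (w : B.tensorK.spatial.Hom p q) :
    twist i j (B.tensorK.spatial.comp z w) =
      B.tensorK.spatial.comp (twist i k z) (twist k j w) :=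
  Subtype.ext (Fam.ext fun ρ => repTw_comp ρ p q r i j k (z.1.1 ρ) (w.1.1 ρ))

theorem twist_star (z : B.tensorK.spatial.Hom p q) :
    twist i j (B.tensorK.spatial.star z) = B.tensorK.spatial.star (twist j i z) :=
  Subtype.ext (Fam.ext fun ρ => repTw_adjoint ρ p q i j (z.1.1 ρ))

theorem grade_twist (z : B.tensorK.spatial.Hom p q) :
    B.tensorK.spatial.grade (twist i j z) =
      offSign 𝕜 i j • twist i j (B.tensorK.spatial.grade z) := by
  refine Subtype.ext (Fam.ext fun ρ => ?_)
  exact repEps_comp_repTw ρ p q i j (z.1.1 ρ)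

/-- Reversing the gradings preserves the spatial norm. For the source this follows from
`‖z‖² = ‖z z*‖`, for the target from `‖z‖² = ‖z* z‖`. -/
theorem norm_twist (z : B.tensorK.spatial.Hom p q) : ‖twist i j z‖ = ‖z‖ := by
  have h1 : ‖twist i j z‖ ^ 2 = ‖twist false j z‖ ^ 2 := by
    rw [← NormedGradedStarCategory.spatial_norm_star_comp_self,
      ← NormedGradedStarCategory.spatial_norm_star_comp_self, ← twist_star, ← twist_star,
      ← twist_comp, ← twist_comp]
  have h2 : ‖twist false j z‖ ^ 2 = ‖z‖ ^ 2 := by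
    rw [← B.tensorK.spatial.norm_star (twist false j z), ← B.tensorK.spatial.norm_star z,
      ← NormedGradedStarCategory.spatial_norm_star_comp_self,
      ← NormedGradedStarCategory.spatial_norm_star_comp_self, B.tensorK.spatial.laws.star_star,
      B.tensorK.spatial.laws.star_star, ← twist_star, ← twist_comp]
    rfl
  exact (pow_left_inj₀ (norm_nonneg _) (norm_nonneg _) two_ne_zero).1 (h1.trans h2)

/-- `twist` as an additive map. -/
def twistHom (p q : B.tensorK.spatial.Ob) :
    B.tensorK.spatial.Hom p q →+ B.tensorK.spatial.Hom (twOb j p) (twOb i q) :=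
  AddMonoidHom.mk' (twist i j) (twist_add i j)

theorem twist_sub (z w : B.tensorK.spatial.Hom p q) :
    twist i j (z - w) = twist i j z - twist i j w := map_sub (twistHom i j p q) z w

theorem twist_sum {κ : Type} (S : Finset κ) (f : κ → B.tensorK.spatial.Hom p q) :
    twist i j (∑ m ∈ S, f m) = ∑ m ∈ S, twist i j (f m) := map_sum (twistHom i j p q) f S

theorem continuous_twist : Continuous (twist i j : B.tensorK.spatial.Hom p q → _) :=
  AddMonoidHomClass.continuous_of_bound (twistHom i j p q) 1 fun z => by
    rw [one_mul]; exact (norm_twist i j z).le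

theorem tendsto_twist {X : Type*} {l : Filter X} {f : X → B.tensorK.spatial.Hom p q}
    (hf : Tendsto f l (𝓝 0)) : Tendsto (fun x => twist i j (f x)) l (𝓝 0) := by
  refine squeeze_zero_norm (fun x => (norm_twist i j (f x)).le) ?_
  exact tendsto_zero_iff_norm_tendsto_zero.1 hf

end GradedCStarCategory

/-! ### The sum of an asymptotic functor and its opposite -/

namespace NormedGradedStarCategory

variable {𝕜 : Type} [RCLike 𝕜] (C : NormedGradedStarCategory.{u, v} 𝕜)

theorem grade_sub {a b : C.Ob} (x y : C.Hom a b) : C.grade (x - y) = C.grade x - C.grade y := by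
  have := C.laws.grade_smul (-1) y
  rw [sub_eq_add_neg, C.laws.grade_add, sub_eq_add_neg]
  simpa using this

theorem norm_spatial_grade_le {a b : C.spatial.Ob} (x : C.spatial.Hom a b) :
    ‖C.spatial.grade x‖ ≤ ‖x‖ := by
  refine C.norm_spatial_le _ (norm_nonneg _) fun ρ => ?_
  refine le_trans (le_of_eq (congrArg norm (@Rep.map_grade 𝕜 _ C ρ a b x))) ?_
  refine ((ContinuousLinearMap.opNorm_comp_le _ _).trans ?_).trans (C.norm_map_le_spatial x ρ)
  refine (mul_le_of_le_one_left (norm_nonneg _) (GradedCStarCategory.norm_eps_le _)).trans ?_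
  refine (ContinuousLinearMap.opNorm_comp_le _ _).trans ?_
  exact mul_le_of_le_one_right (norm_nonneg _) (GradedCStarCategory.norm_eps_le _)

end NormedGradedStarCategory

namespace MatFam

open GradedCStarCategory

variable {𝕜 : Type} [RCLike 𝕜] {A : GradedStarCategory.{u, v} 𝕜}
  {B : GradedCStarCategory.{u₂, v₂} 𝕜}

/-- The family of `2 × 2` block matrices with blocks `Λ i j`, in which the objects of the second
half carry the opposite gradings. -/
@[reducible] def twisted {T : Type} (F : MatFam (Set.Ici (1 : ℝ)) A B.tensorK.spatial.alg)
    (Λ : ∀ {a b : A.Ob}, A.Hom a b → Bool → Bool → ∀ (k : F.idx b) (l : F.idx a),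
      T → B.tensorK.spatial.Hom (F.fam a l) (F.fam b k)) :
    MatFam T A B.tensorK.spatial.alg where
  idx a := Bool × F.idx a
  fam a i := twOb i.1 (F.fam a i.2)
  map q _ _ x := fun i j => twist i.1 j.1 (Λ x i.1 j.1 i.2 j.2 q)

/-- If `β_u` is a path of homomorphisms from `A` to `2 × 2` matrices over `A`, then lifts `Λ` of the
paths `β_u(x)` along an asymptotic functor form a homotopy of asymptotic functors. -/
theorem IsAsymptotic.twisted {F : MatFam (Set.Ici (1 : ℝ)) A B.tensorK.spatial.alg}
    (hF : F.IsAsymptotic atTop)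
    (β : unitInterval → ∀ {a b : A.Ob}, A.Hom a b → Bool → Bool → A.Hom a b)
    (hlin : ∀ u {a b : A.Ob} (r s : 𝕜) (x y : A.Hom a b) i j,
      β u (r • x + s • y) i j = r • β u x i j + s • β u y i j)
    (hcomp : ∀ u {a b c : A.Ob} (x : A.Hom b c) (y : A.Hom a b) i j,
      β u (A.comp x y) i j = ∑ k, A.comp (β u x i k) (β u y k j))
    (hstar : ∀ u {a b : A.Ob} (x : A.Hom a b) i j, β u (A.star x) i j = A.star (β u x j i))
    (hgrade : ∀ u {a b : A.Ob} (x : A.Hom a b) i j,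
      A.grade (β u x i j) = offSign 𝕜 i j • β u (A.grade x) i j)
    (Λ : ∀ {a b : A.Ob}, A.Hom a b → Bool → Bool → ∀ (k : F.idx b) (l : F.idx a),
      Set.Ici (1 : ℝ) × unitInterval → B.tensorK.spatial.Hom (F.fam a l) (F.fam b k))
    (hc : ∀ {a b : A.Ob} (x : A.Hom a b) i j k l, Continuous (Λ x i j k l))
    (hb : ∀ {a b : A.Ob} (x : A.Hom a b) i j k l, ∃ R : ℝ, ∀ q, ‖Λ x i j k l q‖ ≤ R)
    (hΛ : ∀ {a b : A.Ob} (x : A.Hom a b) i j k l u, Tendsto (fun q => Λ x i j k l q -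
      (F.map q.1 (β u x i j) k l : B.tensorK.spatial.Hom (F.fam a l) (F.fam b k)))
        (atTop ×ˢ 𝓝 u) (𝓝 0)) :
    (F.twisted Λ).IsAsymptotic (atTop ×ˢ ⊤) where
  continuous x i j := (continuous_twist i.1 j.1).comp (hc x i.1 j.1 i.2 j.2)
  bounded x i j := (hb x i.1 j.1 i.2 j.2).imp fun R hR q => (norm_twist _ _ _).le.trans (hR q)
  linear {a b} r s x y := by
    rintro ⟨i, k⟩ ⟨j, l⟩
    refine tendsto_prod_top_of_forall_nhds fun u => ?_
    have h1 := (hF.linear r s (β u x i j) (β u y i j) k l).comp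
      (tendsto_fst (f := atTop) (g := 𝓝 u))
    have h2 := (((hΛ (r • x + s • y) i j k l u).sub ((hΛ x i j k l u).const_smul r)).sub
      ((hΛ y i j k l u).const_smul s)).add h1
    simp only [smul_zero, sub_zero, add_zero] at h2
    refine (tendsto_twist i j h2).congr fun q => ?_
    have e : twist i j (Λ (r • x + s • y) i j k l q) - r • twist i j (Λ x i j k l q) -
        s • twist i j (Λ y i j k l q) =
        twist i j (Λ (r • x + s • y) i j k l q - r • Λ x i j k l q - s • Λ y i j k l q) := by
      rw [twist_sub, twist_sub, twist_smul, twist_smul]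
    refine Eq.trans (congrArg (twist i j) ?_) e.symm
    simp only [hlin, smul_sub, Function.comp]
    abel
  comp {a b c} x y := by
    rintro ⟨i, k⟩ ⟨j, l⟩
    refine tendsto_prod_top_of_forall_nhds fun u => ?_
    have h1 := (hF.map_sum Finset.univ (fun m => A.comp (β u x i m) (β u y m j)) k l).comp
      (tendsto_fst (f := atTop) (g := 𝓝 u))
    have h2 := (tendsto_finsetSum Finset.univ fun m _ =>
      hF.comp (β u x i m) (β u y m j) k l).comp (tendsto_fst (f := atTop) (g := 𝓝 u))
    have h3 (m : Bool) (n : F.idx b) : Tendsto (fun q => B.tensorK.spatial.comp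
        (F.map q.1 (β u x i m) k n) (F.map q.1 (β u y m j) n l) -
        B.tensorK.spatial.comp (Λ x i m k n q) (Λ y m j n l q)) (atTop ×ˢ 𝓝 u) (𝓝 0) := by
      obtain ⟨R, hR⟩ := hF.bounded (β u x i m) k n
      have e1 := NormedGradedStarCategory.tendsto_bounded_comp (D := B.tensorK.spatial)
        (f := fun q : Set.Ici (1 : ℝ) × unitInterval => F.map q.1 (β u x i m) k n)
        ⟨R, fun q => hR q.1⟩ (hΛ y m j n l u)
      have e2 := NormedGradedStarCategory.tendsto_comp_bounded (D := B.tensorK.spatial)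
        (hΛ x i m k n u) (hb y m j n l)
      have e3 := (e1.add e2).neg
      rw [add_zero, neg_zero] at e3
      refine e3.congr fun q => ?_
      rw [NormedGradedStarCategory.comp_sub, NormedGradedStarCategory.sub_comp]
      abel
    have h4 := tendsto_finsetSum Finset.univ fun m (_ : m ∈ Finset.univ) =>
      tendsto_finsetSum Finset.univ fun n (_ : n ∈ Finset.univ) => h3 m n
    have h5 := (((hΛ (A.comp x y) i j k l u).add h1).add h2).add h4
    simp only [Finset.sum_const_zero, add_zero] at h5
    refine (tendsto_twist i j h5).congr fun q => ?_
    have e : twist i j (Λ (A.comp x y) i j k l q) - ∑ m : Bool × F.idx b,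
        B.tensorK.spatial.comp (twist i m.1 (Λ x i m.1 k m.2 q)) (twist m.1 j (Λ y m.1 j m.2 l q)) =
        twist i j (Λ (A.comp x y) i j k l q - ∑ m : Bool × F.idx b,
          B.tensorK.spatial.comp (Λ x i m.1 k m.2 q) (Λ y m.1 j m.2 l q)) := by
      rw [twist_sub, twist_sum]
      simp only [← twist_comp]
    refine Eq.trans (congrArg (twist i j) ?_) e.symm
    rw [Fintype.sum_prod_type]
    simp only [hcomp, Function.comp, Finset.sum_sub_distrib]
    abel
  star {a b} x := by
    rintro ⟨i, k⟩ ⟨j, l⟩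
    refine tendsto_prod_top_of_forall_nhds fun u => ?_
    have h1 := (hF.star (β u x j i) k l).comp (tendsto_fst (f := atTop) (g := 𝓝 u))
    have h2 : Tendsto (fun q => B.tensorK.spatial.star (Λ x j i l k q -
        F.map q.1 (β u x j i) l k)) (atTop ×ˢ 𝓝 u) (𝓝 0) :=
      squeeze_zero_norm (fun q => (B.tensorK.spatial.norm_star _).le)
        (tendsto_zero_iff_norm_tendsto_zero.1 (hΛ x j i l k u))
    have h3 := ((hΛ (A.star x) i j k l u).add h1).sub h2
    simp only [add_zero, sub_zero] at h3
    refine (tendsto_twist i j h3).congr fun q => ?_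
    have e : twist i j (Λ (A.star x) i j k l q) -
        B.tensorK.spatial.star (twist j i (Λ x j i l k q)) =
        twist i j (Λ (A.star x) i j k l q - B.tensorK.spatial.star (Λ x j i l k q)) := by
      rw [twist_sub, twist_star]
    refine Eq.trans (congrArg (twist i j) ?_) e.symm
    simp only [hstar, Function.comp, NormedGradedStarCategory.star_sub]
    abel
  grade {a b} x := by
    rintro ⟨i, k⟩ ⟨j, l⟩
    refine tendsto_prod_top_of_forall_nhds fun u => ?_
    have hs : offSign 𝕜 i j * offSign 𝕜 i j = 1 := by
      cases i <;> cases j <;> simp [offSign]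
    have h1 : Tendsto (fun q => B.tensorK.spatial.grade (Λ x i j k l q -
        F.map q.1 (β u x i j) k l)) (atTop ×ˢ 𝓝 u) (𝓝 0) :=
      squeeze_zero_norm (fun q => B.tensorK.norm_spatial_grade_le _)
        (tendsto_zero_iff_norm_tendsto_zero.1 (hΛ x i j k l u))
    have h2 := (hF.grade (β u x i j) k l).comp (tendsto_fst (f := atTop) (g := 𝓝 u))
    have h3 := (hF.map_smul (offSign 𝕜 i j) (β u (A.grade x) i j) k l).comp
      (tendsto_fst (f := atTop) (g := 𝓝 u))
    have h4 := (((h1.add h2).add h3).const_smul (offSign 𝕜 i j)).sub (hΛ (A.grade x) i j k l u)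
    simp only [add_zero, smul_zero, sub_zero] at h4
    refine (tendsto_twist i j h4).congr fun q => ?_
    have e : B.tensorK.spatial.grade (twist i j (Λ x i j k l q)) -
        twist i j (Λ (A.grade x) i j k l q) =
        twist i j (offSign 𝕜 i j • B.tensorK.spatial.grade (Λ x i j k l q) -
          Λ (A.grade x) i j k l q) := by
      rw [twist_sub, twist_smul, grade_twist]
    refine Eq.trans (congrArg (twist i j) ?_) e.symm
    simp only [hgrade, Function.comp, NormedGradedStarCategory.grade_sub, smul_add, smul_sub,
      smul_smul, hs, one_smul]
    abel

end MatFam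

namespace MatFam

open GradedCStarCategory

variable {𝕜 : Type} [RCLike 𝕜] {A : GradedStarCategory.{u, v} 𝕜}
  {B : GradedCStarCategory.{u₂, v₂} 𝕜}

/-- The family `x ↦ Fₜ(δ x)` with values in the objects with opposite gradings. -/
@[reducible] def opp {T : Type} (F : MatFam T A B.tensorK.spatial.alg) :
    MatFam T A B.tensorK.spatial.alg where
  idx a := F.idx a
  fam a i := twOb true (F.fam a i)
  map t _ _ x := fun i j => twist true true (F.map t (A.grade x) i j)

theorem IsAsymptotic.opp {T : Type} [TopologicalSpace T] {l : Filter T}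
    {F : MatFam T A B.tensorK.spatial.alg} (h : F.IsAsymptotic l) : F.opp.IsAsymptotic l where
  continuous x i j := (continuous_twist true true).comp (h.continuous (A.grade x) i j)
  bounded x i j := (h.bounded (A.grade x) i j).imp fun K hK t => (norm_twist _ _ _).le.trans (hK t)
  linear r s x y i j := by
    refine (tendsto_twist true true
      (h.linear r s (A.grade x) (A.grade y) i j)).congr fun t => ?_
    rw [twist_sub, twist_sub, twist_smul, twist_smul, ← A.laws.grade_smul,
      ← A.laws.grade_smul, ← A.laws.grade_add]
  comp x y i j := by
    refine (tendsto_twist true true (h.comp (A.grade x) (A.grade y) i j)).congr fun t => ?_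
    rw [twist_sub, twist_sum, ← A.laws.grade_comp]
    simp only [← twist_comp]
  star x i j := by
    refine (tendsto_twist true true (h.star (A.grade x) i j)).congr fun t => ?_
    rw [twist_sub, twist_star, ← A.laws.grade_star]
  grade x i j := by
    refine (tendsto_twist true true (h.grade (A.grade x) i j)).congr fun t => ?_
    rw [twist_sub, grade_twist, offSign]
    simp

end MatFam

namespace AddAsymp

section Linear

variable {𝕜 : Type} [RCLike 𝕜] {A : GradedCStarCategory.{u, v} 𝕜}
  {C : NormedGradedStarCategory.{u₂, v₂} 𝕜}

/-- The bound `1 / 3` is small enough for `‖x* x‖ ≤ 2 ‖x‖² ≤ 1 / 4`, so that `1 - s x* x` has a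
left inverse for `0 ≤ s ≤ 1`. -/
theorem eventually_norm_entry_le (φ : AddAsymp A.susp C) {a b : A.Ob} (x : A.suspHom a b)
    (hx : ‖x‖ ≤ 1 / 3) (k : Fin (φ.data.obj b).len) (l : Fin (φ.data.obj a).len) {ε : ℝ}
    (hε : 0 < ε) : ∀ᶠ t in atTop, ‖(φ.toMatFam.map t (a := a) (b := b) x k l :
      C.spatial.Hom (φ.toMatFam.fam a l) (φ.toMatFam.fam b k))‖ ≤ 1 + ε := by
  have h1 : ‖A.suspComp (A.suspStar x) x‖ ≤ 1 / 4 := by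
    refine (A.norm_suspComp_le _ _).trans ?_
    have := mul_le_mul (A.norm_suspStar_le x) le_rfl (norm_nonneg x) (norm_nonneg x)
    nlinarith [norm_nonneg x]
  have h2 : ∀ s : ℝ, 0 ≤ s → s ≤ 1 → ∃ y : A.suspHom a a,
      y = (s : 𝕜) • A.suspComp (A.suspStar x) x +
        (s : 𝕜) • A.suspComp y (A.suspComp (A.suspStar x) x) := by
    intro s hs0 hs1
    have hs : ‖(s : 𝕜) • A.suspComp (A.suspStar x) x‖ ≤ 1 / 4 := by
      rw [norm_smul, RCLike.norm_ofReal, abs_of_nonneg hs0]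
      exact (mul_le_of_le_one_left (norm_nonneg _) hs1).trans h1
    obtain ⟨y, hy⟩ := A.exists_quasiInverse _ hs
    exact ⟨y, hy.trans (congrArg (_ + ·) (A.suspLaws.comp_smul _ _ _))⟩
  have h3 := ((isGradedAsymptotic_iff φ.data).2 φ.isAsymptotic).eventually_norm_sq_le
    (a := a) (b := b) x h2 hε
  filter_upwards [h3] with t ht
  refine (C.norm_entry_le (a := φ.data.obj a) (b := φ.data.obj b) (φ.data.map t x) k l).trans ?_
  by_contra! h4
  nlinarith

/-- The entries of an asymptotic functor on `S ⊗̂ A` are asymptotically linear and asymptotically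
bounded by a multiple of the norm. -/
theorem isAsymptoticallyLinear (φ : AddAsymp A.susp C) {a b : A.Ob} (k : Fin (φ.data.obj b).len)
    (l : Fin (φ.data.obj a).len) : IsAsymptoticallyLinear 𝕜 (E := A.suspHom a b)
      (D := C.spatial.Hom (φ.toMatFam.fam a l) (φ.toMatFam.fam b k))
      (fun t x => φ.toMatFam.map t (a := a) (b := b) x k l) 3 where
  continuous x := φ.isAsymptotic.continuous (a := a) (b := b) x k l
  bounded x := φ.isAsymptotic.bounded (a := a) (b := b) x k l
  linear r s x y := φ.isAsymptotic.linear (a := a) (b := b) r s x y k l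
  norm_le x ε hε := by
    set c := 3 * ‖x‖ + ε / 4 with hc
    have hc0 : 0 < c := by positivity
    have hx : ‖((c⁻¹ : ℝ) : 𝕜) • x‖ ≤ 1 / 3 := by
      rw [norm_smul, RCLike.norm_ofReal, abs_of_pos (inv_pos.2 hc0), inv_mul_le_iff₀ hc0]
      linarith
    have h1 := φ.eventually_norm_entry_le _ hx k l (ε := ε / (4 * c)) (by positivity)
    have h2 := (tendsto_zero_iff_norm_tendsto_zero.1 (φ.isAsymptotic.map_smul (a := a) (b := b)
      (c : 𝕜) (((c⁻¹ : ℝ) : 𝕜) • x : A.suspHom a b) k l)).eventually_le_const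
      (show 0 < ε / 4 by positivity)
    have e : (c : 𝕜) • (((c⁻¹ : ℝ) : 𝕜) • x) = x := by
      rw [smul_smul, ← RCLike.ofReal_mul, mul_inv_cancel₀ hc0.ne', RCLike.ofReal_one, one_smul]
    filter_upwards [h1, h2] with t h1 h2
    have h3 := norm_le_norm_sub_add (φ.toMatFam.map t (a := a) (b := b)
      ((c : 𝕜) • (((c⁻¹ : ℝ) : 𝕜) • x) : A.suspHom a b) k l :
        C.spatial.Hom (φ.toMatFam.fam a l) (φ.toMatFam.fam b k))
      ((c : 𝕜) • φ.toMatFam.map t (a := a) (b := b) (((c⁻¹ : ℝ) : 𝕜) • x : A.suspHom a b) k l)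
    have h4 := h3.trans (add_le_add_left h2 _)
    rw [e, norm_smul, RCLike.norm_ofReal, abs_of_pos hc0] at h4
    have h5 : c * (1 + ε / (4 * c)) = c + ε / 4 := by field_simp
    have h6 := mul_le_mul_of_nonneg_left h1 hc0.le
    rw [h5] at h6
    linarith

end Linear

section Opposite

open GradedCStarCategory

variable {𝕜 : Type} [RCLike 𝕜] {B : GradedCStarCategory.{u₂, v₂} 𝕜}

/-- The opposite of an additive asymptotic functor. -/
@[reducible] def opp {A : GradedCStarCategory.{u, v} 𝕜} (φ : AddAsymp A.susp B.tensorK) :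
    AddAsymp A.susp B.tensorK :=
  ofData φ.data.opp φ.isAsymptotic.opp

variable {A : GradedCStarCategory.{u, v} 𝕜}

/-- The blocks of `φ ⊕ φᵒᵖᵖ`, before the reversal of the gradings. -/
def startBlock (φ : AddAsymp A.susp B.tensorK) {a b : A.Ob} (x : A.suspHom a b)
    (k : Fin (φ.data.obj b).len) (l : Fin (φ.data.obj a).len) (t : Set.Ici (1 : ℝ)) :
    Bool → Bool → B.tensorK.spatial.Hom (φ.toMatFam.fam a l) (φ.toMatFam.fam b k)
  | false, false => φ.toMatFam.map t (a := a) (b := b) x k l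
  | true, true => φ.toMatFam.map t (a := a) (b := b) (A.suspGrade x) k l
  | _, _ => 0

/-- The paths of the rotation have lifts along `φ` that start at the blocks of `φ ⊕ φᵒᵖᵖ` and end at
zero. -/
theorem exists_lift_rotPath (φ : AddAsymp A.susp B.tensorK) {a b : A.Ob} (x : A.suspHom a b)
    (i j : Bool) (k : Fin (φ.data.obj b).len) (l : Fin (φ.data.obj a).len) :
    ∃ Ψ : Set.Ici (1 : ℝ) × unitInterval →
        B.tensorK.spatial.Hom (φ.toMatFam.fam a l) (φ.toMatFam.fam b k),
      Continuous Ψ ∧ (∃ R : ℝ, ∀ q, ‖Ψ q‖ ≤ R) ∧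
      (∀ u, Tendsto (fun q => Ψ q - φ.toMatFam.map q.1 (a := a) (b := b) (A.rotPath i j x u) k l)
        (atTop ×ˢ 𝓝 u) (𝓝 0)) ∧
      (∀ t, Ψ (t, 0) = φ.startBlock x k l t i j) ∧ ∀ t, Ψ (t, 1) = 0 := by
  have hφ := φ.isAsymptotic
  have hz : Tendsto (fun t => (0 : B.tensorK.spatial.Hom (φ.toMatFam.fam a l)
      (φ.toMatFam.fam b k)) - φ.toMatFam.map t (a := a) (b := b) (0 : A.suspHom a b) k l)
      atTop (𝓝 0) := by
    have := (hφ.map_zero (a := a) (b := b) k l).neg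
    rw [neg_zero] at this
    exact this.congr fun t => (zero_sub _).symm
  have hself (y z : A.suspHom a b) (h : y = z) (t : Set.Ici (1 : ℝ)) :
      φ.toMatFam.map t (a := a) (b := b) z k l - φ.toMatFam.map t (a := a) (b := b) y k l =
        (0 : B.tensorK.spatial.Hom (φ.toMatFam.fam a l) (φ.toMatFam.fam b k)) := by
    subst h
    exact sub_self (G := B.tensorK.spatial.Hom (φ.toMatFam.fam a l) (φ.toMatFam.fam b k)) _
  refine (φ.isAsymptoticallyLinear k l).exists_lift_endpoints (by norm_num) (A.rotPath i j x)
    (p₀ := fun t => φ.startBlock x k l t i j) (p₁ := fun _ => 0) ?_ continuous_const ?_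
    ⟨0, fun _ => norm_zero.le⟩ ?_ ?_
  · cases i <;> cases j
    exacts [hφ.continuous (a := a) (b := b) x k l, continuous_const, continuous_const,
      hφ.continuous (a := a) (b := b) (A.suspGrade x) k l]
  · cases i <;> cases j
    exacts [hφ.bounded (a := a) (b := b) x k l, ⟨0, fun _ => norm_zero.le⟩,
      ⟨0, fun _ => norm_zero.le⟩, hφ.bounded (a := a) (b := b) (A.suspGrade x) k l]
  · rw [rotPath_zero]
    cases i <;> cases j
    · exact (tendsto_const_nhds (x := 0)).congr fun t => (hself _ _ (rotEven_zero x) t).symm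
    · simp only [rot, rotOdd_zero]
      exact hz
    · simp only [rot, rotOdd_zero, suspGrade_zero]
      exact hz
    · exact (tendsto_const_nhds (x := 0)).congr fun t =>
        (hself _ _ (congrArg A.suspGrade (rotEven_zero x)) t).symm
  · rw [rotPath_one]
    exact hz

/-- The sum `φ ⊕ φᵒᵖᵖ` is null-homotopic up to the order of its summands: the lifts of the rotation
connect it to a null functor. -/
theorem toClass_dsum_opp (φ : AddAsymp A.susp B.tensorK) :
    (φ.dsum φ.opp).toClass = (null fun _ => ⟨0, Fin.elim0⟩ : AddAsymp A.susp B.tensorK).toClass := by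
  choose Λ hc hb hΛ h0 h1 using fun {a b : A.Ob} (x : A.suspHom a b) => φ.exists_lift_rotPath x
  have h := φ.isAsymptotic.twisted (fun u {a b} x i j => A.rotPath i j x u)
    (fun u {a b} r s x y i j => rotPath_linear x y i j u r s)
    (fun u {a b c} x y i j => rotPath_comp x y i j u)
    (fun u {a b} x i j => rotPath_star x i j u) (fun u {a b} x i j => rotPath_grade x i j u)
    (fun {a b} x => Λ (a := a) (b := b) x) (fun {a b} x => hc (a := a) (b := b) x)
    (fun {a b} x => hb (a := a) (b := b) x) (fun {a b} x => hΛ (a := a) (b := b) x)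
  let n : A.Ob → ℕ := fun a => (φ.data.obj a).len
  let e (a : A.Ob) : Fin (n a + n a) ≃ Bool × Fin (n a) :=
    finSumFinEquiv.symm.trans (Equiv.boolProdEquivSum _).symm
  let O : A.susp.Ob → B.tensorK.alg.add.Ob := fun a =>
    ⟨n a + n a, fun m => TensorOb.tw (B := B) (e a m).1 ((φ.data.obj a).fam (e a m).2)⟩
  let m : Set.Ici (1 : ℝ) × unitInterval → ∀ {a b : A.susp.Ob}, A.susp.Hom a b →
      B.tensorK.alg.add.Hom (O a) (O b) := fun q a b x i j =>
    (φ.toMatFam.twisted fun {a b} x => Λ (a := a) (b := b) x).map q x (e b i) (e a j)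
  have hm : (famOf (C := B.tensorK) O m).IsAsymptotic (atTop ×ˢ ⊤) :=
    (MatFam.isAsymptotic_reindex_iff _ (fun a => Fin (n a + n a)) e).2 h
  let α (u : unitInterval) : AddAsymp A.susp B.tensorK := ofData (slice O m u)
    (hm.comap (l' := atTop) (g := fun t : Set.Ici (1 : ℝ) => (t, u))
      (by fun_prop) (tendsto_id.prodMk tendsto_top))
  have e1 : (α 0).toClass = (α 1).toClass :=
    Quot.sound (Or.inl (Homotopic.of_slice O m hm rfl rfl))
  have e2 : α 1 = null O := by
    refine ext (FunctorData.ext_map fun t a b x => ?_)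
    funext i j
    exact (congrArg (twist _ _) (h1 (a := a) (b := b) x _ _ _ _ t)).trans
      (map_zero (twistHom _ _ _ _))
  have e3 : (α 0).toMatFam.Equivalent (φ.toMatFam.dsum φ.opp.toMatFam) := by
    let F := (φ.toMatFam.twisted fun {a b} x => Λ (a := a) (b := b) x).comap
      fun t => (t, (0 : unitInterval))
    refine (MatFam.equivalent_reindex F (fun a => Fin (n a + n a)) e).trans
      ⟨fun a => Equiv.boolProdEquivSum _, ?_, ?_⟩
    · rintro a ⟨_ | _, i⟩ <;> rfl
    · rintro t a b x ⟨_ | _, i⟩ ⟨_ | _, j⟩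
      · exact heq_of_eq (h0 (a := a) (b := b) x false false i j t)
      · exact heq_of_eq ((congrArg (twist _ _) (h0 (a := a) (b := b) x false true i j t)).trans
          (map_zero (twistHom _ _ _ _)))
      · exact heq_of_eq ((congrArg (twist _ _) (h0 (a := a) (b := b) x true false i j t)).trans
          (map_zero (twistHom _ _ _ _)))
      · exact heq_of_eq (congrArg (twist _ _) (h0 (a := a) (b := b) x true true i j t))
  rw [← toClass_null O, ← e2, ← e1]
  exact toClass_eq_of_equivalent (e3.trans (toMatFam_dsum φ φ.opp).symm)

end Opposite

end AddAsymp

/-! ### The group of classes -/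

namespace Classes

variable {𝕜 : Type} [RCLike 𝕜]

/-- The sum of classes. -/
@[reducible] def add {A : GradedStarCategory.{u, v} 𝕜} {C : NormedGradedStarCategory.{u₂, v₂} 𝕜} :
    Classes A C → Classes A C → Classes A C :=
  Quot.lift₂ (fun φ ψ => (φ.dsum ψ).toClass) (fun φ _ _ h => AddAsymp.toClass_dsum_congr_right h φ)
    fun _ _ ψ h => AddAsymp.toClass_dsum_congr_left h ψ

variable {A : GradedCStarCategory.{u, v} 𝕜} {B : GradedCStarCategory.{u₂, v₂} 𝕜}

theorem exists_add_eq_zero (x : Classes A.susp B.tensorK) :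
    ∃ y : Classes A.susp B.tensorK, add x y = (AddAsymp.null fun _ => ⟨0, Fin.elim0⟩).toClass := by
  obtain ⟨φ⟩ := x
  exact ⟨φ.opp.toClass, φ.toClass_dsum_opp⟩

/-- The abelian group of classes. The inverse is chosen here; it is given by the opposite functor.
-/
@[reducible] def addCommGroup : AddCommGroup (Classes A.susp B.tensorK) :=
  let _ : Add (Classes A.susp B.tensorK) := ⟨add⟩
  let _ : Zero (Classes A.susp B.tensorK) := ⟨(AddAsymp.null fun _ => ⟨0, Fin.elim0⟩).toClass⟩
  let _ : Neg (Classes A.susp B.tensorK) := ⟨fun x => (exists_add_eq_zero x).choose⟩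
  have hcomm (x y : Classes A.susp B.tensorK) : x + y = y + x := by
    obtain ⟨φ⟩ := x
    obtain ⟨ψ⟩ := y
    exact AddAsymp.toClass_dsum_comm φ ψ
  { AddGroup.ofLeftAxioms
      (by rintro ⟨φ⟩ ⟨ψ⟩ ⟨χ⟩; exact AddAsymp.toClass_dsum_assoc φ ψ χ)
      (by rintro ⟨φ⟩; exact AddAsymp.toClass_null_dsum φ _)
      (fun x => (hcomm _ _).trans (exists_add_eq_zero x).choose_spec) with
    add_comm := hcomm }

end Classes

end ETheory

end

theorem mainTheorem5 {𝕜 : Type} [RCLike 𝕜] (A : ETheory.GradedCStarCategory.{u₁, v₁} 𝕜)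
    (B : ETheory.GradedCStarCategory.{u₂, v₂} 𝕜) :
    ∃ _ : AddCommGroup (ETheory.Classes A.susp B.tensorK),
      (∀ φ ψ : ETheory.AddAsymp A.susp B.tensorK, ∃ χ : ETheory.AddAsymp A.susp B.tensorK,
        χ.data = φ.data.dsum ψ.data ∧ φ.toClass + ψ.toClass = χ.toClass) ∧
      (∃ ζ : ETheory.AddAsymp A.susp B.tensorK,
        ζ.data = ETheory.FunctorData.zero ∧ ζ.toClass = 0) ∧
      (∀ φ : ETheory.AddAsymp A.susp B.tensorK, ∃ χ : ETheory.AddAsymp A.susp B.tensorK,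
        χ.data = φ.data.opp ∧ χ.toClass = -φ.toClass) := by
  let _ : AddCommGroup (ETheory.Classes A.susp B.tensorK) := ETheory.Classes.addCommGroup
  refine ⟨ETheory.Classes.addCommGroup, fun φ ψ => ⟨φ.dsum ψ, rfl, rfl⟩,
    ⟨ETheory.AddAsymp.null fun _ => ⟨0, Fin.elim0⟩, rfl, rfl⟩, fun φ => ⟨φ.opp, rfl, ?_⟩⟩
  have h : φ.toClass + φ.opp.toClass = 0 := φ.toClass_dsum_opp
  exact (neg_eq_of_add_eq_zero_right h).symm
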